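/- All manifolds are smooth, Hausdorff and second countable. For $\rho\in(0,\infty]$ put $G_\rho=\mathbb R/\rho\mathbb Z$ if $\rho<\infty$ and $G_\infty=\mathbb R$. Let $(N,\omega)$ be a symplectic manifold. A \emph{principal contactification of $(N,\omega)$ with minimal period $\rho$} is a manifold $M$ with a contact form $\eta$ and a surjective submersion $p:M\to N$ such that the Reeb vector field $\mathcal R$ of $\eta$ (the vector field with $i_{\mathcal R}\eta=1$, $i_{\mathcal R}d\eta=0$) is complete, its flow induces a smooth, free and proper action of $G_\rho$ on $M$, the fibres of $p$ are exactly the orbits of this flow, and $p^*\omega=d\eta$. **Theorem.** For $j=1,2$ let $M_j$ be connected of dimension $2n_j+1$ and let $(M_j,\eta_j)$, with projection $p_j:M_j\to N_j$ and Reeb vector field $\mathcal R_j$, be a principal contactification of a symplectic manifold $(N_j,\omega_j)$ with minimal period $\rho_j\in(0,\infty]$. Suppose that either $\rho_1=\infty$, or $\rho_1,\rho_2$ are both finite and $\rho_2/\rho_1=k/l$ with $k,l$ positive coprime integers. Then: 1. The vector field $\mathcal R_1-\mathcal R_2$ on $M_1\times M_2$ is complete. Its flow induces a smooth, free and proper action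 of $\mathbb R$ if $\rho_1=\infty$, and of $\mathbb R/\tau\mathbb Z$ with $\tau=k\rho_1=l\rho_2$ if $\rho_1<\infty$. 2. The $1$-form $\eta_1\oplus\eta_2=\mathrm{pr}_1^*\eta_1+\mathrm{pr}_2^*\eta_2$ is invariant under this flow. 3. The orbit space $M=(M_1\times M_2)/\langle\mathcal R_1-\mathcal R_2\rangle$, with the quotient topology, is Hausdorff, second countable and connected, and carries a smooth manifold structure of dimension $2(n_1+n_2)+1$ for which the projection $\pi:M_1\times M_2\to M$ is a submersion. There is a $1$-form $\eta$ on $M$ with $\pi^*\eta=\eta_1\oplus\eta_2$. The map $p:M\to N_1\times N_2$ determined by $p\circ\pi=p_1\times p_2$ is well defined, and $(M,\eta)$ with the projection $p$ is a principal contactification of the symplectic manifold $(N_1\times N_2,\omega_1\oplus\omega_2)$. Its minimal period is $$\rho=\rho_2\ \text{ if }\rho_1=\infty,\qquad \rho=\frac{\rho_2}{k}=\frac{\rho_1}{l}\ \text{ if }\rho_1<\infty .$$ 4. The Reeb vector field $\mathcal R$ of $\eta$ is the projection of $(\mathcal R_1+\mathcal R_2)/2$, that is, $d\pi_x\big(\tfrac12(\mathcal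 R_1+\mathcal R_2)(x)\big)=\mathcal R(\pi(x))$ for all $x\in M_1\times M_2$. -/

import Mathlib

open scoped Manifold ContDiff ENNReal

noncomputable section

namespace ContactProduct

section Forms

variable {E : Type*} [NormedAddCommGroup E] [NormedSpace ℝ E]
  {H : Type*} [TopologicalSpace H] (I : ModelWithCorners ℝ E H)
  {E' : Type*} [NormedAddCommGroup E'] [NormedSpace ℝ E']
  {H' : Type*} [TopologicalSpace H'] (J : ModelWithCorners ℝ E' H')
  (M : Type*) [TopologicalSpace M] [ChartedSpace H M]
  (N : Type*) [TopologicalSpace N] [ChartedSpace H' N]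

/-- Vector fields on the manifold `M` (no regularity imposed). -/
abbrev VField : Type _ := ∀ x : M, TangentSpace I x

/-- Differential `k`-forms on the manifold `M` (no regularity imposed):
alternating `k`-linear forms on each tangent space. -/
abbrev DForm (k : ℕ) : Type _ := ∀ x : M, TangentSpace I x [⋀^Fin k]→L[ℝ] ℝ

variable {I J M N} {k : ℕ}

/-- The pullback `f^* σ`. -/
def pullback (f : M → N) (σ : DForm J N k) : DForm I M k :=
  fun x => (σ (f x)).compContinuousLinearMap (mfderiv I J f x)

/-- The coordinate expression of the form `σ` in the preferred chart at `x₀`, i.e. its pullback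
under the inverse of that chart, a form on (an open subset of) the model space `E`. -/
def coordRep (σ : DForm I M k) (x₀ : M) : E → E [⋀^Fin k]→L[ℝ] ℝ :=
  fun y => (σ ((extChartAt I x₀).symm y)).compContinuousLinearMap
    (mfderivWithin 𝓘(ℝ, E) I (extChartAt I x₀).symm (Set.range I) y)

/-- A form is smooth if all its coordinate expressions are. -/
def IsSmoothForm (σ : DForm I M k) : Prop :=
  ∀ x₀ : M, ContDiffOn ℝ ∞ (coordRep σ x₀) (extChartAt I x₀).target

/-- The exterior derivative on a manifold: at `x`, take the exterior derivative of the coordinate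
expression in the chart at `x` and transport it back to the tangent space at `x`. -/
def extD (σ : DForm I M k) : DForm I M (k + 1) :=
  fun x => ContinuousAlternatingMap.compContinuousLinearMap
    (extDerivWithin (coordRep σ x) (Set.range I) (extChartAt I x x))
    (mfderiv I 𝓘(ℝ, E) (extChartAt I x) x)

/-- A contact form: a smooth nowhere vanishing `1`-form `η` such that `dη` is nondegenerate on the
hyperplane field `ker η`. -/
structure IsContactForm (η : DForm I M 1) : Prop where
  smooth : IsSmoothForm η
  ne_zero : ∀ x, η x ≠ 0
  nondegenerate : ∀ (x : M) (v : TangentSpace I x), η x ![v] = 0 →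
    (∀ w : TangentSpace I x, η x ![w] = 0 → extD η x ![v, w] = 0) → v = 0

/-- A symplectic form: a smooth closed nondegenerate `2`-form. -/
structure IsSymplecticForm (σ : DForm I M 2) : Prop where
  smooth : IsSmoothForm σ
  closed : extD σ = 0
  nondegenerate : ∀ (x : M) (v : TangentSpace I x),
    (∀ w : TangentSpace I x, σ x ![v, w] = 0) → v = 0

/-- `R` is the Reeb vector field of `η`: `i_R η = 1` and `i_R dη = 0`. -/
structure IsReebField (η : DForm I M 1) (R : VField I M) : Prop where
  apply_eq_one : ∀ x, η x ![R x] = 1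
  contract_eq_zero : ∀ (x : M) (v : TangentSpace I x), extD η x ![R x, v] = 0

/-- The direct sum `α ⊕ β = pr₁^* α + pr₂^* β` of forms on a product manifold. -/
def directSum (α : DForm I M k) (β : DForm J N k) : DForm (I.prod J) (M × N) k :=
  fun x => pullback (I := I.prod J) (Prod.fst : M × N → M) α x +
    pullback (I := I.prod J) (Prod.snd : M × N → N) β x

/-- The vector field `X + Y` on a product manifold, for `X` on the first and `Y` on the second
factor. -/
def sumField (X : VField I M) (Y : VField J N) : VField (I.prod J) (M × N) :=
  fun x => ((X x.1, Y x.2) : E × E')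

end Forms

section Flows

/-- The group `ℝ / ρℤ` for `ρ ∈ (0, ∞]`: a circle of length `ρ` if `ρ < ∞`, and `ℝ = ℝ / 0` if
`ρ = ∞` (recall that `(∞ : ℝ≥0∞).toReal = 0`). -/
abbrev PeriodGroup (ρ : ℝ≥0∞) : Type := AddCircle ρ.toReal

variable {E : Type*} [NormedAddCommGroup E] [NormedSpace ℝ E]
  {H : Type*} [TopologicalSpace H] (I : ModelWithCorners ℝ E H)
  {M : Type*} [TopologicalSpace M]

/-- The action of `ℝ / ρℤ` induced by a flow which is `ρ`-periodic. -/
abbrev periodAction (φ : Flow ℝ M) (ρ : ℝ≥0∞)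
    (h : ∀ t ∈ AddSubgroup.zmultiples ρ.toReal, ∀ x, φ t x = x) :
    AddAction (PeriodGroup ρ) M where
  vadd g x := Quotient.liftOn' g (fun t => φ t x) (by
    intro s t hst
    have h1 := h _ (QuotientAddGroup.leftRel_apply.mp hst) x
    have h2 : t = s + (-s + t) := by ring
    show φ s x = φ t x
    rw [h2, φ.map_add, h1])
  zero_vadd x := φ.map_zero_apply x
  add_vadd g g' x := by
    induction g using QuotientAddGroup.induction_on
    induction g' using QuotientAddGroup.induction_on
    exact φ.map_add _ _ x

/-- The orbit relation of a flow. -/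
abbrev orbitSetoid (φ : Flow ℝ M) : Setoid M := @AddAction.orbitRel ℝ M _ φ.toAddAction

/-- The space of orbits of a flow, with the quotient topology. -/
abbrev OrbitSpace (φ : Flow ℝ M) : Type _ := Quotient (orbitSetoid φ)

/-- The canonical projection onto the space of orbits. -/
def orbitProj (φ : Flow ℝ M) : M → OrbitSpace φ := Quotient.mk (orbitSetoid φ)

variable [ChartedSpace H M]

variable {I} in
/-- `φ` is the flow `exp(tX)` of the (complete) vector field `X`: the curves `t ↦ φ t x` are
integral curves of `X`. -/
def IsFlowOf (φ : Flow ℝ M) (X : VField I M) : Prop :=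
  ∀ x : M, IsMIntegralCurve (fun t => φ t x) X

/-- The flow `φ` is smooth and induces a free and proper action of the Lie group `ℝ / ρℤ`, where
`ρ ∈ (0, ∞]`; in other words it induces a principal action of the circle (if `ρ < ∞`) or of `ℝ`
(if `ρ = ∞`). The fields `periodic` and `free` say that all orbits have minimal period `ρ`. -/
structure IsPrincipalFlow (φ : Flow ℝ M) (ρ : ℝ≥0∞) : Prop where
  period_pos : 0 < ρ
  smooth : ContMDiff (𝓘(ℝ, ℝ).prod I) I ∞ (fun q : ℝ × M => φ q.1 q.2)
  periodic : ∀ t ∈ AddSubgroup.zmultiples ρ.toReal, ∀ x, φ t x = x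
  free : ∀ (t : ℝ) (x : M), φ t x = x → t ∈ AddSubgroup.zmultiples ρ.toReal
  proper : @ProperVAdd (PeriodGroup ρ) M _ _ _ (periodAction φ ρ periodic)

end Flows

section Contactifications

variable {E : Type*} [NormedAddCommGroup E] [NormedSpace ℝ E]
  {H : Type*} [TopologicalSpace H] {I : ModelWithCorners ℝ E H}
  {E' : Type*} [NormedAddCommGroup E'] [NormedSpace ℝ E']
  {H' : Type*} [TopologicalSpace H'] {J : ModelWithCorners ℝ E' H'}
  {M : Type*} [TopologicalSpace M] [ChartedSpace H M]
  {N : Type*} [TopologicalSpace N] [ChartedSpace H' N]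

/-- `(M, η)`, with the Reeb vector field `R` and the projection `p : M → N`, is a principal
contactification of the symplectic manifold `(N, σ)`, with minimal period `ρ ∈ (0, ∞]`:
`η` is a contact form, its Reeb vector field `R` is complete and generates a principal action of
`ℝ / ρℤ`, `p` is a surjective submersion whose fibres are the orbits of `R` (so that `N = M / R`),
and `p^* σ = dη`. -/
structure IsPrincipalContactification (η : DForm I M 1) (R : VField I M) (p : M → N)
    (σ : DForm J N 2) (ρ : ℝ≥0∞) : Prop where
  contact : IsContactForm η
  reeb : IsReebField η R
  symplectic : IsSymplecticForm σ
  submersion : Manifold.IsSubmersion I J ∞ p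
  surjective : Function.Surjective p
  principal : ∃ φ : Flow ℝ M, IsFlowOf φ R ∧ IsPrincipalFlow I φ ρ ∧
    ∀ x y : M, p x = p y ↔ y ∈ φ.orbit x
  pullback_eq : pullback p σ = extD η

end Contactifications

end ContactProduct

end

open ContactProduct

/-! Let `φ₁`, `φ₂` be the two Reeb flows. The plane acts on the product by letting `(a, b)` move the
factors by times `a` and `b`; every stabilizer is `ρ₁ℤ × ρ₂ℤ` (with `∞ℤ` read as `0`), and the
orbits are the fibres of `p₁ × p₂`. After dividing by the antidiagonal times `(s, -s)`, only the
total time `a + b` still acts (`quotientFlow_proj_eq_iff`). Hence the periods of `R₁ - R₂` form `ρ₁ℤ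
∩ ρ₂ℤ`, and those of the residual flow form `ρ₁ℤ + ρ₂ℤ`. Commensurability makes both groups discrete
with explicit generators, an lcm and a gcd (`exists_periods`). The residual flow runs for time `t /
2` in each factor, which explains the field `(R₁ + R₂) / 2`.

Properness is automatic for a circle. For `ℝ` it means that times converge along ultrafilters, a
property inherited from the factors (`HasConvergentTimes`). A proper action has a Hausdorff orbit
space.

Smooth structure: local sections of `p₁` and `p₂` give slices, and the flows turn these into local
coordinates `(u₁, t₁)` and `(u₂, t₂)`. There the quotient map reads `(u₁, u₂, t₁ + t₂)`, which
supplies charts with smooth transitions (`exists_isSlice`, `exists_isQuotientChart`).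

Forms: a Reeb flow preserves its contact form (`IsReebField.pullback_flow`), so `η₁ ⊕ η₂` is
invariant. It kills `R₁ - R₂` because `1 - 1 = 0`, so it descends to a form `η`
(`exists_pullback_eq`). The remaining identities are verified after pulling back along the
surjective submersion, where `d` is natural (`extD_pullback`). Nondegeneracy of `dη` on `ker η`
comes from the symplectic form on the base (`IsReebField.isContactForm`). -/

noncomputable section

open scoped Manifold ContDiff ENNReal Topology
open Set Filter

namespace ContactProduct

set_option linter.unusedSectionVars false

/-! ### Smooth dependence of the linear pullback of alternating forms -/

section MultilinearPullback

variable {E : Type*} [NormedAddCommGroup E] [NormedSpace ℝ E]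
  {F : Type*} [NormedAddCommGroup F] [NormedSpace ℝ F]
  {W : Type*} [NormedAddCommGroup W] [NormedSpace ℝ W]

variable (E) in
/-- Averaging over permutations, as a continuous linear projection onto alternating maps. -/
def alternatizationCLM (k : ℕ) :
    ContinuousMultilinearMap ℝ (fun _ : Fin k => E) ℝ →L[ℝ] E [⋀^Fin k]→L[ℝ] ℝ :=
  LinearMap.mkContinuous
    { toFun := fun f => (k.factorial : ℝ)⁻¹ • ContinuousMultilinearMap.alternatization f
      map_add' := fun f g => by rw [map_add, smul_add]
      map_smul' := fun c f => by
        rw [RingHom.id_apply, smul_comm c]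
        congr 1
        ext v
        simp [ContinuousMultilinearMap.alternatization_apply_apply, Finset.mul_sum,
          mul_smul_comm] }
    1 (fun f => by
      refine ContinuousAlternatingMap.opNorm_le_bound _ (by positivity) fun v => ?_
      have hk : (0 : ℝ) < k.factorial := by positivity
      have hsum : ‖∑ s : Equiv.Perm (Fin k), Equiv.Perm.sign s • f (v ∘ s)‖ ≤
          ∑ _s : Equiv.Perm (Fin k), ‖f‖ * ∏ i, ‖v i‖ := by
        refine norm_sum_le_of_le _ fun s _ => ?_
        have h1 : ‖Equiv.Perm.sign s • f (v ∘ s)‖ = ‖f (v ∘ s)‖ := by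
          rcases Int.units_eq_one_or (Equiv.Perm.sign s) with h | h <;> simp [h]
        rw [h1, ← Equiv.prod_comp s fun i => ‖v i‖]
        exact f.le_opNorm _
      simp only [LinearMap.coe_mk, AddHom.coe_mk, ContinuousAlternatingMap.smul_apply,
        ContinuousMultilinearMap.alternatization_apply_apply]
      rw [norm_smul, norm_inv, Real.norm_of_nonneg hk.le, inv_mul_le_iff₀ hk, one_mul]
      refine hsum.trans (le_of_eq ?_)
      simp [Finset.card_univ, Fintype.card_perm])

theorem alternatizationCLM_coe {k : ℕ} (α : E [⋀^Fin k]→L[ℝ] ℝ) :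
    alternatizationCLM E k α.toContinuousMultilinearMap = α := by
  ext v
  have hk : (k.factorial : ℝ) ≠ 0 := by positivity
  have hs : ∀ s : Equiv.Perm (Fin k),
      (Equiv.Perm.sign s • α (v ∘ s) : ℝ) = α v := fun s => by
    rw [show α (v ∘ s) = Equiv.Perm.sign s • α v from α.toAlternatingMap.map_perm v s, smul_smul,
      Int.units_mul_self, one_smul]
  simp only [alternatizationCLM, LinearMap.mkContinuous_apply, LinearMap.coe_mk, AddHom.coe_mk,
    ContinuousAlternatingMap.smul_apply, ContinuousMultilinearMap.alternatization_apply_apply,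
    ContinuousAlternatingMap.coe_toContinuousMultilinearMap, hs]
  simp [Finset.card_univ, Fintype.card_perm, hk]

/-- For plain multilinear maps the pullback is itself continuous and multilinear in the tuple of
linear maps, hence smooth. The alternating case is embedded into the multilinear one and brought
back by the averaging projection, which fixes alternating maps. -/
theorem ContDiffAt.compContinuousLinearMap {k : ℕ} {n : WithTop ℕ∞} {x : W}
    {α : W → F [⋀^Fin k]→L[ℝ] ℝ} {L : W → E →L[ℝ] F}
    (hα : ContDiffAt ℝ n α x) (hL : ContDiffAt ℝ n L x) :
    ContDiffAt ℝ n (fun y => (α y).compContinuousLinearMap (L y)) x := by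
  have h1 : ContDiffAt ℝ n (fun y => ContinuousMultilinearMap.compContinuousLinearMapContinuousMultilinear
      ℝ (fun _ : Fin k => E) (fun _ => F) ℝ (fun _ => L y)) x :=
    (ContinuousMultilinearMap.contDiff _).contDiffAt.comp x (contDiffAt_pi.2 fun _ => hL)
  have h2 : ContDiffAt ℝ n (fun y => (α y).toContinuousMultilinearMap) x :=
    (ContinuousAlternatingMap.toContinuousMultilinearMapLI (𝕜 := ℝ) (E := F) (F := ℝ)
      (ι := Fin k)).contDiff.contDiffAt.comp x hα
  have h3 := (alternatizationCLM E k).contDiff.contDiffAt.comp x (h1.clm_apply h2)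
  refine h3.congr_of_eventuallyEq (Eventually.of_forall fun y => ?_)
  exact (alternatizationCLM_coe ((α y).compContinuousLinearMap (L y))).symm

end MultilinearPullback

/-! ### Pullback of forms in charts and naturality of the exterior derivative -/

section Pullback

variable {E : Type*} [NormedAddCommGroup E] [NormedSpace ℝ E]
  {H : Type*} [TopologicalSpace H] {I : ModelWithCorners ℝ E H} [I.Boundaryless]
  {E' : Type*} [NormedAddCommGroup E'] [NormedSpace ℝ E']
  {H' : Type*} [TopologicalSpace H'] {J : ModelWithCorners ℝ E' H'} [J.Boundaryless]
  {M : Type*} [TopologicalSpace M] [ChartedSpace H M] [IsManifold I ∞ M]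
  {N : Type*} [TopologicalSpace N] [ChartedSpace H' N] [IsManifold J ∞ N] {k : ℕ}

theorem isManifold_one_of_infty : IsManifold I 1 M :=
  IsManifold.of_le (n := ∞) (by exact_mod_cast le_top)

theorem coordRep_apply (σ : DForm I M k) (x₀ : M) (y : E) :
    coordRep σ x₀ y = (σ ((extChartAt I x₀).symm y)).compContinuousLinearMap
      (mfderiv 𝓘(ℝ, E) I (extChartAt I x₀).symm y) := by
  rw [coordRep, I.range_eq_univ, mfderivWithin_univ]
  rfl

theorem coordRep_congr {σ τ : DForm I M k} {x₀ : M} {y : E}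
    (hy : y ∈ (extChartAt I x₀).target)
    (h : ∀ᶠ z in 𝓝 ((extChartAt I x₀).symm y), σ z = τ z) :
    coordRep σ x₀ =ᶠ[𝓝 y] coordRep τ x₀ := by
  have := (continuousAt_extChartAt_symm'' (I := I) hy).eventually h
  filter_upwards [this] with z hz
  rw [coordRep_apply, coordRep_apply, hz]

theorem mdifferentiableAt_extChartAt_symm {x₀ : M} {y : E}
    (hy : y ∈ (extChartAt I x₀).target) :
    MDifferentiableAt 𝓘(ℝ, E) I (extChartAt I x₀).symm y := by
  have := isManifold_one_of_infty (I := I) (M := M)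
  have h := mdifferentiableWithinAt_extChartAt_symm (I := I) hy
  rwa [I.range_eq_univ, mdifferentiableWithinAt_univ] at h

theorem contMDiffAt_extChartAt_symm_of_mem {x₀ : M} {y : E}
    (hy : y ∈ (extChartAt I x₀).target) :
    ContMDiffAt 𝓘(ℝ, E) I ∞ (extChartAt I x₀).symm y :=
  (contMDiffOn_extChartAt_symm x₀).contMDiffAt ((isOpen_extChartAt_target x₀).mem_nhds hy)

/-- With `g` the local representative of `f`, the maps `f ∘ e⁻¹` and `e'⁻¹ ∘ g` agree near `y`. The
chain rule applied to both sides gives the equality of differentials that is needed. -/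
theorem coordRep_pullback {f : M → N} (σ : DForm J N k) {x₀ : M} {y₀ : N} {y : E}
    (hy : y ∈ (extChartAt I x₀).target)
    (hf : MDifferentiableAt I J f ((extChartAt I x₀).symm y))
    (hfy : f ((extChartAt I x₀).symm y) ∈ (chartAt H' y₀).source) :
    coordRep (pullback f σ : DForm I M k) x₀ y =
      (coordRep σ y₀ (extChartAt J y₀ (f ((extChartAt I x₀).symm y)))).compContinuousLinearMap
        (fderiv ℝ (fun z => extChartAt J y₀ (f ((extChartAt I x₀).symm z))) y) := by
  have := isManifold_one_of_infty (I := I) (M := M)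
  have := isManifold_one_of_infty (I := J) (M := N)
  set g : E → E' := fun z => extChartAt J y₀ (f ((extChartAt I x₀).symm z)) with hg
  have hsy := mdifferentiableAt_extChartAt_symm (I := I) hy
  have hfs : MDifferentiableAt 𝓘(ℝ, E) J (fun z => f ((extChartAt I x₀).symm z)) y :=
    MDifferentiableAt.comp y hf hsy
  have hgd : MDifferentiableAt 𝓘(ℝ, E) 𝓘(ℝ, E') g y :=
    MDifferentiableAt.comp y (mdifferentiableAt_extChartAt (I := J) hfy) hfs
  have hsrc : f ((extChartAt I x₀).symm y) ∈ (extChartAt J y₀).source := by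
    rwa [extChartAt_source]
  have hgt : g y ∈ (extChartAt J y₀).target := (extChartAt J y₀).map_source hsrc
  have hinv : (extChartAt J y₀).symm (g y) = f ((extChartAt I x₀).symm y) :=
    (extChartAt J y₀).left_inv hsrc
  have hev : (fun z => (extChartAt J y₀).symm (g z)) =ᶠ[𝓝 y]
      fun z => f ((extChartAt I x₀).symm z) := by
    filter_upwards [hfs.continuousAt.preimage_mem_nhds (extChartAt_source_mem_nhds' (I := J) hsrc)]
      with z hz
    exact (extChartAt J y₀).left_inv hz
  have hd1 : mfderiv 𝓘(ℝ, E) J (fun z => f ((extChartAt I x₀).symm z)) y =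
      (mfderiv I J f ((extChartAt I x₀).symm y)).comp
        (mfderiv 𝓘(ℝ, E) I (extChartAt I x₀).symm y) := mfderiv_comp y hf hsy
  have hd2 : mfderiv 𝓘(ℝ, E) J (fun z => (extChartAt J y₀).symm (g z)) y =
      (mfderiv 𝓘(ℝ, E') J (extChartAt J y₀).symm (g y)).comp
        (mfderiv 𝓘(ℝ, E) 𝓘(ℝ, E') g y) :=
    mfderiv_comp y (mdifferentiableAt_extChartAt_symm (I := J) hgt) hgd
  have hd3 : (mfderiv 𝓘(ℝ, E) J (fun z => (extChartAt J y₀).symm (g z)) y : E →L[ℝ] E') =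
      mfderiv 𝓘(ℝ, E) J (fun z => f ((extChartAt I x₀).symm z)) y := hev.mfderiv_eq
  rw [hd1, hd2, mfderiv_eq_fderiv] at hd3
  rw [coordRep_apply, coordRep_apply, pullback]
  let σ' : N → E' [⋀^Fin k]→L[ℝ] ℝ := σ
  have e1 : σ' ((extChartAt J y₀).symm (g y)) = σ' (f ((extChartAt I x₀).symm y)) := by rw [hinv]
  ext v
  change σ' (f ((extChartAt I x₀).symm y)) _ = σ' ((extChartAt J y₀).symm (g y)) _
  rw [e1]
  congr 1
  ext1 i
  exact (congrArg (fun L : E →L[ℝ] E' => L (v i)) hd3).symm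

/-- The local representative of a map near `x` in preferred charts is smooth. -/
theorem contDiffAt_chart_rep {f : M → N} {x₀ : M} {y₀ : N} {y : E}
    (hy : y ∈ (extChartAt I x₀).target)
    (hf : ContMDiffAt I J ∞ f ((extChartAt I x₀).symm y))
    (hfy : f ((extChartAt I x₀).symm y) ∈ (chartAt H' y₀).source) :
    ContDiffAt ℝ ∞ (fun z => extChartAt J y₀ (f ((extChartAt I x₀).symm z))) y := by
  rw [← contMDiffAt_iff_contDiffAt]
  exact ContMDiffAt.comp y (contMDiffAt_extChartAt' hfy)
    (ContMDiffAt.comp y hf (contMDiffAt_extChartAt_symm_of_mem hy))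

theorem coordRep_pullback_eventuallyEq {f : M → N} (σ : DForm J N k) {x₀ : M} {y₀ : N} {y : E}
    (hy : y ∈ (extChartAt I x₀).target)
    (hf : ∀ᶠ z in 𝓝 ((extChartAt I x₀).symm y), ContMDiffAt I J ∞ f z)
    (hfy : f ((extChartAt I x₀).symm y) ∈ (chartAt H' y₀).source) :
    coordRep (pullback f σ : DForm I M k) x₀ =ᶠ[𝓝 y] fun z =>
      (coordRep σ y₀ (extChartAt J y₀ (f ((extChartAt I x₀).symm z)))).compContinuousLinearMap
        (fderiv ℝ (fun z => extChartAt J y₀ (f ((extChartAt I x₀).symm z))) z) := by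
  have hc := continuousAt_extChartAt_symm'' (I := I) hy
  have h1 : ∀ᶠ z in 𝓝 y, f ((extChartAt I x₀).symm z) ∈ (chartAt H' y₀).source :=
    (hf.self_of_nhds.continuousAt.comp hc).eventually
      ((chartAt H' y₀).open_source.mem_nhds hfy)
  filter_upwards [hc.eventually hf, h1, (isOpen_extChartAt_target x₀).mem_nhds hy] with z h2 h3 h4
  exact coordRep_pullback σ h4 (h2.mdifferentiableAt (by simp)) h3

theorem IsSmoothForm.contDiffAt {σ : DForm I M k} (hσ : IsSmoothForm σ) {x₀ : M} {y : E}
    (hy : y ∈ (extChartAt I x₀).target) : ContDiffAt ℝ ∞ (coordRep σ x₀) y :=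
  (hσ x₀).contDiffAt ((isOpen_extChartAt_target x₀).mem_nhds hy)

theorem IsSmoothForm.contDiffAt_coordRep_pullback {f : M → N} {σ : DForm J N k}
    (hσ : IsSmoothForm σ) {x₀ : M} {y : E} (hy : y ∈ (extChartAt I x₀).target)
    (hf : ∀ᶠ z in 𝓝 ((extChartAt I x₀).symm y), ContMDiffAt I J ∞ f z) :
    ContDiffAt ℝ ∞ (coordRep (pullback f σ : DForm I M k) x₀) y := by
  have hfy := mem_chart_source H' (f ((extChartAt I x₀).symm y))
  refine ContDiffAt.congr_of_eventuallyEq ?_ (coordRep_pullback_eventuallyEq σ hy hf hfy)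
  have hg := contDiffAt_chart_rep hy hf.self_of_nhds hfy
  refine ContDiffAt.compContinuousLinearMap ?_ ?_
  · exact ContDiffAt.comp y (hσ.contDiffAt (mem_extChartAt_target (I := J) _)) hg
  · exact hg.fderiv_right (m := ∞) (by simp)

theorem IsSmoothForm.pullback {f : M → N} {σ : DForm J N k} (hσ : IsSmoothForm σ)
    (hf : ContMDiff I J ∞ f) : IsSmoothForm (pullback f σ : DForm I M k) := fun _ _ hy =>
  (hσ.contDiffAt_coordRep_pullback hy (Eventually.of_forall hf)).contDiffWithinAt

/-- The exterior derivative is natural. -/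
theorem extD_pullback {f : M → N} {σ : DForm J N k} (hσ : IsSmoothForm σ) {x : M}
    (hf : ∀ᶠ z in 𝓝 x, ContMDiffAt I J ∞ f z) :
    extD (ContactProduct.pullback f σ : DForm I M k) x =
      (ContactProduct.pullback f (extD σ) : DForm I M (k + 1)) x := by
  have := isManifold_one_of_infty (I := I) (M := M)
  have := isManifold_one_of_infty (I := J) (M := N)
  have hx : (extChartAt I x).symm (extChartAt I x x) = x := extChartAt_to_inv x
  have hy := mem_extChartAt_target (I := I) x
  have hf' : ∀ᶠ z in 𝓝 ((extChartAt I x).symm (extChartAt I x x)), ContMDiffAt I J ∞ f z := by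
    rwa [hx]
  have hfy : f ((extChartAt I x).symm (extChartAt I x x)) ∈ (chartAt H' (f x)).source := by
    rw [hx]; exact mem_chart_source H' (f x)
  have hg := contDiffAt_chart_rep hy hf'.self_of_nhds hfy
  have hfx := hf.self_of_nhds.mdifferentiableAt (n := ∞) (by simp)
  set g : E → E' := fun z => extChartAt J (f x) (f ((extChartAt I x).symm z)) with hgdef
  have hgx : g (extChartAt I x x) = extChartAt J (f x) (f x) := by simp only [hgdef, hx]
  have hd : DifferentiableAt ℝ (coordRep σ (f x)) (g (extChartAt I x x)) := by
    rw [hgx]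
    exact (hσ.contDiffAt (mem_extChartAt_target _)).differentiableAt (by simp)
  rw [extD, I.range_eq_univ, extDerivWithin_univ,
    (coordRep_pullback_eventuallyEq σ hy hf' hfy).extDeriv_eq,
    extDeriv_pullback (r := ∞) hd hg (by
      rw [minSmoothness_of_isRCLikeNormedField]; exact WithTop.coe_le_coe.2 (le_top : (2 : ℕ∞) ≤ ⊤)), hgx,
    ContactProduct.pullback, extD, J.range_eq_univ, extDerivWithin_univ]
  have hgd : MDifferentiableAt 𝓘(ℝ, E) 𝓘(ℝ, E') g (extChartAt I x x) :=
    (hg.differentiableAt (by simp)).mdifferentiableAt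
  -- What remains is the change between charts and tangent spaces: `g ∘ e = e' ∘ f` near `x`,
  -- differentiated both ways.
  have hev : (fun z => g (extChartAt I x z)) =ᶠ[𝓝 x] fun z => extChartAt J (f x) (f z) := by
    filter_upwards [extChartAt_source_mem_nhds (I := I) x] with z hz
    simp only [hgdef, (extChartAt I x).left_inv hz]
  have hd1 : mfderiv I 𝓘(ℝ, E') (fun z => g (extChartAt I x z)) x =
      (mfderiv 𝓘(ℝ, E) 𝓘(ℝ, E') g (extChartAt I x x)).comp
        (mfderiv I 𝓘(ℝ, E) (extChartAt I x) x) :=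
    mfderiv_comp x hgd (mdifferentiableAt_extChartAt (mem_chart_source H x))
  have hd2 : mfderiv I 𝓘(ℝ, E') (fun z => extChartAt J (f x) (f z)) x =
      (mfderiv J 𝓘(ℝ, E') (extChartAt J (f x)) (f x)).comp (mfderiv I J f x) :=
    mfderiv_comp x (mdifferentiableAt_extChartAt (mem_chart_source H' (f x))) hfx
  have hd3 : (mfderiv I 𝓘(ℝ, E') (fun z => g (extChartAt I x z)) x : E →L[ℝ] E') =
      mfderiv I 𝓘(ℝ, E') (fun z => extChartAt J (f x) (f z)) x := hev.mfderiv_eq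
  rw [hd1, hd2, mfderiv_eq_fderiv] at hd3
  ext v
  change extDeriv (coordRep σ (f x)) (extChartAt J (f x) (f x)) _ =
    extDeriv (coordRep σ (f x)) (extChartAt J (f x) (f x)) _
  congr 1
  ext1 i
  exact congrArg (fun L : E →L[ℝ] E' => L (v i)) hd3

theorem pullback_pullback {E'' : Type*} [NormedAddCommGroup E''] [NormedSpace ℝ E'']
    {H'' : Type*} [TopologicalSpace H''] {K : ModelWithCorners ℝ E'' H''}
    {P : Type*} [TopologicalSpace P] [ChartedSpace H'' P]
    {f : M → N} {g : N → P} (σ : DForm K P k) {x : M}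
    (hf : MDifferentiableAt I J f x) (hg : MDifferentiableAt J K g (f x)) :
    (pullback f (pullback g σ : DForm J N k) : DForm I M k) x =
      (pullback (fun z => g (f z)) σ : DForm I M k) x := by
  have h : mfderiv I K (fun z => g (f z)) x = (mfderiv J K g (f x)).comp (mfderiv I J f x) :=
    mfderiv_comp x hg hf
  simp only [pullback, h]
  rfl

theorem pullback_congr_eventuallyEq {f g : M → N} {σ : DForm J N k} {x : M} (h : f =ᶠ[𝓝 x] g) :
    (pullback f σ : DForm I M k) x = (pullback g σ : DForm I M k) x := by
  let σ' : N → E' [⋀^Fin k]→L[ℝ] ℝ := σ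
  have h1 : (mfderiv I J f x : E →L[ℝ] E') = mfderiv I J g x := h.mfderiv_eq
  have h2 : σ' (f x) = σ' (g x) := by rw [h.self_of_nhds]
  change (σ' (f x)).compContinuousLinearMap (mfderiv I J f x : E →L[ℝ] E') =
    (σ' (g x)).compContinuousLinearMap (mfderiv I J g x : E →L[ℝ] E')
  rw [h1, h2]

/-- Naturality along a local section: a form `η` with `f^*η = θ` is locally `s^*θ`. -/
theorem eq_pullback_section {f : M → N} {s : N → M} {σ : DForm J N k} {y : N}
    (hs : MDifferentiableAt J I s y) (hf : MDifferentiableAt I J f (s y))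
    (h : ∀ᶠ z in 𝓝 y, f (s z) = z) :
    σ y = (pullback s (pullback f σ : DForm I M k) : DForm J N k) y := by
  rw [pullback_pullback σ hs hf, pullback_congr_eventuallyEq (g := id) h]
  ext v
  simp [pullback, mfderiv_id]

end Pullback

/-! ### Direct sums of forms on a product -/

section DirectSum

variable {E : Type*} [NormedAddCommGroup E] [NormedSpace ℝ E]
  {H : Type*} [TopologicalSpace H] {I : ModelWithCorners ℝ E H} [I.Boundaryless]
  {E' : Type*} [NormedAddCommGroup E'] [NormedSpace ℝ E']
  {H' : Type*} [TopologicalSpace H'] {J : ModelWithCorners ℝ E' H'} [J.Boundaryless]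
  {M : Type*} [TopologicalSpace M] [ChartedSpace H M] [IsManifold I ∞ M]
  {N : Type*} [TopologicalSpace N] [ChartedSpace H' N] [IsManifold J ∞ N] {k : ℕ}

theorem coordRep_add (σ τ : DForm I M k) (x₀ : M) :
    coordRep (fun x => σ x + τ x : DForm I M k) x₀ = coordRep σ x₀ + coordRep τ x₀ := by
  ext y v
  rfl

theorem IsSmoothForm.add {σ τ : DForm I M k} (hσ : IsSmoothForm σ) (hτ : IsSmoothForm τ) :
    IsSmoothForm (fun x => σ x + τ x : DForm I M k) := fun x₀ => by
  rw [coordRep_add]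
  exact (hσ x₀).add (hτ x₀)

theorem extD_add {σ τ : DForm I M k} (hσ : IsSmoothForm σ) (hτ : IsSmoothForm τ) (x : M) :
    extD (fun x => σ x + τ x : DForm I M k) x = extD σ x + extD τ x := by
  have hx := mem_extChartAt_target (I := I) x
  rw [extD, coordRep_add, I.range_eq_univ, extDerivWithin_univ,
    extDeriv_add ((hσ.contDiffAt hx).differentiableAt (by simp))
      ((hτ.contDiffAt hx).differentiableAt (by simp)), extD, extD, I.range_eq_univ,
    extDerivWithin_univ, extDerivWithin_univ]
  rfl

theorem IsSmoothForm.directSum {α : DForm I M k} {β : DForm J N k} (hα : IsSmoothForm α)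
    (hβ : IsSmoothForm β) : IsSmoothForm (directSum α β) :=
  (hα.pullback contMDiff_fst).add (hβ.pullback contMDiff_snd)

theorem extD_directSum {α : DForm I M k} {β : DForm J N k} (hα : IsSmoothForm α)
    (hβ : IsSmoothForm β) : extD (directSum α β) = directSum (extD α) (extD β) := by
  funext x
  have h := extD_add (I := I.prod J) (M := M × N)
    (hα.pullback (contMDiff_fst (I := I) (J := J) (M := M) (N := N)))
    (hβ.pullback (contMDiff_snd (I := I) (J := J) (M := M) (N := N))) x
  rw [extD_pullback hα (Eventually.of_forall contMDiff_fst),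
    extD_pullback hβ (Eventually.of_forall contMDiff_snd)] at h
  exact h

theorem directSum_apply (α : DForm I M k) (β : DForm J N k) (x : M × N)
    (v : Fin k → TangentSpace (I.prod J) x) :
    directSum α β x v = α x.1 (fun i => (v i : E × E').1) + β x.2 (fun i => (v i : E × E').2) := by
  simp only [directSum, pullback, mfderiv_fst, mfderiv_snd]
  rfl

theorem IsSymplecticForm.directSum {α : DForm I M 2} {β : DForm J N 2} (hα : IsSymplecticForm α)
    (hβ : IsSymplecticForm β) : IsSymplecticForm (directSum α β) where
  smooth := hα.smooth.directSum hβ.smooth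
  closed := by
    rw [extD_directSum hα.smooth hβ.smooth, hα.closed, hβ.closed]
    funext x
    ext v
    rw [directSum_apply]
    exact add_zero (0 : ℝ)
  nondegenerate x v h := by
    have h1 : (v : E × E').1 = 0 := hα.nondegenerate x.1 _ fun w => by
      -- Testing against vectors tangent to one factor isolates that factor's form.
      have := h ((w, 0) : E × E')
      rw [directSum_apply] at this
      convert this using 1
      have h0 : β x.2 (fun i => ((![v, ((w, 0) : E × E')] : Fin 2 → E × E') i).2) = 0 :=
        (β x.2).map_coord_zero 1 rfl
      refine (add_zero _).symm.trans (congrArg₂ (· + ·) ?_ h0.symm)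
      congr 1
      ext i
      fin_cases i <;> rfl
    have h2 : (v : E × E').2 = 0 := hβ.nondegenerate x.2 _ fun w => by
      have := h ((0, w) : E × E')
      rw [directSum_apply] at this
      convert this using 1
      have h0 : α x.1 (fun i => ((![v, ((0, w) : E × E')] : Fin 2 → E × E') i).1) = 0 :=
        (α x.1).map_coord_zero 1 rfl
      refine (zero_add _).symm.trans (congrArg₂ (· + ·) h0.symm ?_)
      congr 1
      ext i
      fin_cases i <;> rfl
    exact Prod.ext h1 h2

end DirectSum

/-! ### Invariance of a contact form under its Reeb flow -/

section Invariance

variable {E : Type*} [NormedAddCommGroup E] [NormedSpace ℝ E]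
  {H : Type*} [TopologicalSpace H] {I : ModelWithCorners ℝ E H} [I.Boundaryless]
  {M : Type*} [TopologicalSpace M] [ChartedSpace H M] [IsManifold I ∞ M] {k : ℕ}

theorem coordRep_self (σ : DForm 𝓘(ℝ, E) E k) (x : E) : coordRep σ x = σ := by
  funext y
  ext v
  rw [coordRep_apply, extChartAt_model_space_eq_id]
  change ((σ y).compContinuousLinearMap (mfderiv 𝓘(ℝ, E) 𝓘(ℝ, E) id y)) v = _
  rw [mfderiv_id]
  rfl

theorem extD_self (σ : DForm 𝓘(ℝ, E) E k) (x : E) : extD σ x = extDeriv σ x := by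
  rw [extD, coordRep_self, extChartAt_model_space_eq_id]
  ext v
  change ((extDerivWithin σ (range id) x).compContinuousLinearMap
    (mfderiv 𝓘(ℝ, E) 𝓘(ℝ, E) id x)) v = _
  rw [mfderiv_id, range_id]
  exact congrArg (fun L : E [⋀^Fin (k + 1)]→L[ℝ] ℝ => L v)
    (congrFun (extDerivWithin_univ (E := E) (𝕜 := ℝ) (fun y => (σ y : E [⋀^Fin k]→L[ℝ] ℝ))) x)

/-- The Cartan formula for `1`-forms and constant vector fields. -/
theorem extDeriv_one_form_apply {α : E → E [⋀^Fin 1]→L[ℝ] ℝ} {x : E}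
    (h : DifferentiableAt ℝ α x) (v w : E) :
    extDeriv α x ![v, w] = fderiv ℝ (fun y => α y ![w]) x v - fderiv ℝ (fun y => α y ![v]) x w := by
  rw [extDeriv_apply h, Fin.sum_univ_two]
  have e0 : (0 : Fin 2).removeNth ![v, w] = ![w] := by ext i; fin_cases i; rfl
  have e1 : (1 : Fin 2).removeNth ![v, w] = ![v] := by ext i; fin_cases i; rfl
  simp only [e0, e1]
  simp [sub_eq_add_neg]

/-- This is Cartan's formula `L_R η = i_R dη + d(i_R η) = 0`, carried out in coordinates. Let `α` be
the pullback of `η` under `G (s, y) = φ s (e⁻¹ y)`, a form on an open part of `ℝ × E`. Since `G`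
carries `∂ₛ` to `R`, one has `α(∂ₛ) = 1` and `i_{∂ₛ} dα = 0`. Hence the coefficients of `α` on `(0,
v)` do not depend on `s`, and their values at times `t` and `0` agree. -/
theorem IsReebField.pullback_flow {η : DForm I M 1} {R : VField I M} (hR : IsReebField η R)
    (hη : IsSmoothForm η) {φ : Flow ℝ M} (hφ : IsFlowOf φ R)
    (hs : ContMDiff (𝓘(ℝ, ℝ).prod I) I ∞ (fun q : ℝ × M => φ q.1 q.2)) (t : ℝ) :
    pullback (φ t) η = η := by
  have := isManifold_one_of_infty (I := I) (M := M)
  funext x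
  let R' : M → E := R
  set e := extChartAt I x with he
  set G : ℝ × E → M := fun p => φ p.1 (e.symm p.2) with hG
  have hGs : ∀ p : ℝ × E, p.2 ∈ e.target → ContMDiffAt 𝓘(ℝ, ℝ × E) I ∞ G p := fun p hp => by
    have h1 : ContMDiffAt 𝓘(ℝ, ℝ × E) (𝓘(ℝ, ℝ).prod I) ∞
        (fun p : ℝ × E => (p.1, e.symm p.2)) p :=
      ContMDiffAt.prodMk contDiff_fst.contMDiff.contMDiffAt
        ((contMDiffAt_extChartAt_symm_of_mem hp).comp p contDiff_snd.contMDiff.contMDiffAt)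
    exact (hs _).comp p h1
  have hGe : ∀ p : ℝ × E, p.2 ∈ e.target → ∀ᶠ q in 𝓝 p, ContMDiffAt 𝓘(ℝ, ℝ × E) I ∞ G q :=
    fun p hp => by
      filter_upwards [(continuous_snd.tendsto p).eventually
        ((isOpen_extChartAt_target x).mem_nhds hp)] with q hq
      exact hGs q hq
  set α : ℝ × E → (ℝ × E) [⋀^Fin 1]→L[ℝ] ℝ := pullback (I := 𝓘(ℝ, ℝ × E)) G η with hα
  have hαd : ∀ p : ℝ × E, p.2 ∈ e.target → DifferentiableAt ℝ α p := fun p hp => by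
    have := hη.contDiffAt_coordRep_pullback (I := 𝓘(ℝ, ℝ × E)) (x₀ := p) (f := G) (y := p)
      (by rw [extChartAt_model_space_eq_id]; trivial)
      (by rw [extChartAt_model_space_eq_id]; exact hGe p hp)
    rw [coordRep_self] at this
    exact this.differentiableAt (by simp)
  have hdt : ∀ p : ℝ × E, p.2 ∈ e.target →
      mfderiv 𝓘(ℝ, ℝ × E) I G p ((1, 0) : ℝ × E) = R (G p) := fun p hp => by
    have h1 := (hGs p hp).mdifferentiableAt (by simp)
    have hc : HasMFDerivAt 𝓘(ℝ, ℝ) 𝓘(ℝ, ℝ × E) (fun s : ℝ => ((s, p.2) : ℝ × E)) p.1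
        (ContinuousLinearMap.inl ℝ ℝ E) :=
      (hasFDerivAt_prodMk_left (𝕜 := ℝ) p.1 p.2).hasMFDerivAt
    have h2 := HasMFDerivAt.comp (I' := 𝓘(ℝ, ℝ × E)) p.1 h1.hasMFDerivAt hc
    have h3 := hasMFDerivAt_unique h2 (hφ (e.symm p.2) p.1)
    have h4 := congrArg (fun L : ℝ →L[ℝ] E => L 1) h3
    refine Eq.trans ?_ (h4.trans ?_)
    · rfl
    · exact one_smul ℝ (R' (G p))
  have hα1 : ∀ p : ℝ × E, p.2 ∈ e.target → α p ![((1, 0) : ℝ × E)] = 1 := fun p hp => by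
    refine Eq.trans ?_ (hR.apply_eq_one (G p))
    change η (G p) _ = η (G p) _
    congr 1
    ext i
    fin_cases i
    exact hdt p hp
  have hdα : ∀ p : ℝ × E, p.2 ∈ e.target → ∀ v : E,
      fderiv ℝ (fun q => α q ![((0, v) : ℝ × E)]) p (1, 0) = 0 := fun p hp v => by
    have h1 := extDeriv_one_form_apply (hαd p hp) (1, 0) (0, v)
    have h2 : extDeriv α p ![(1, 0), (0, v)] = 0 := by
      rw [hα, ← extD_self, extD_pullback hη (hGe p hp)]
      refine Eq.trans ?_ (hR.contract_eq_zero (G p) (mfderiv 𝓘(ℝ, ℝ × E) I G p ((0, v) : ℝ × E)))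
      change extD η (G p) _ = extD η (G p) _
      congr 1
      ext i
      fin_cases i
      · exact hdt p hp
      · rfl
    -- The term differentiating `α(∂ₛ)` drops out because this function is constant near `p`.
    have h3 : (fun q => α q ![((1, 0) : ℝ × E)]) =ᶠ[𝓝 p] fun _ => 1 := by
      filter_upwards [(continuous_snd.tendsto p).eventually
        ((isOpen_extChartAt_target x).mem_nhds hp)] with q hq
      exact hα1 q hq
    rw [h2, h3.fderiv_eq] at h1
    simpa using h1.symm
  have hxt : e x ∈ e.target := mem_extChartAt_target x
  have hconst : ∀ v : E, α (t, e x) ![((0, v) : ℝ × E)] = α (0, e x) ![((0, v) : ℝ × E)] :=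
    fun v => by
      refine is_const_of_deriv_eq_zero (f := fun s : ℝ => α (s, e x) ![((0, v) : ℝ × E)])
        ?_ ?_ t 0
      all_goals
        have key : ∀ s : ℝ, HasDerivAt (fun s : ℝ => α (s, e x) ![((0, v) : ℝ × E)]) 0 s :=
          fun s => by
            have hd : DifferentiableAt ℝ (fun q => α q ![((0, v) : ℝ × E)]) (s, e x) := by
              exact ((ContinuousAlternatingMap.apply ℝ (ℝ × E) ℝ
                ![((0, v) : ℝ × E)]).differentiableAt).comp _ (hαd (s, e x) hxt)
            have := hd.hasFDerivAt.comp_hasDerivAt s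
              ((hasDerivAt_id s).prodMk (hasDerivAt_const s (e x)))
            rw [hdα (s, e x) hxt v] at this
            exact this
      · exact fun s => (key s).differentiableAt
      · exact fun s => (key s).deriv
  have hpull : ∀ s : ℝ, ∀ v : E, α (s, e x) ![((0, v) : ℝ × E)] =
      pullback (I := 𝓘(ℝ, E)) e.symm (pullback (φ s) η : DForm I M 1) (e x) ![v] := fun s v => by
    have hφs : ContMDiff I I ∞ (φ s) := hs.comp (contMDiff_const.prodMk contMDiff_id)
    have hc : HasMFDerivAt 𝓘(ℝ, E) 𝓘(ℝ, ℝ × E) (fun y : E => ((s, y) : ℝ × E)) (e x)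
        (ContinuousLinearMap.inr ℝ ℝ E) :=
      (hasFDerivAt_prodMk_right (𝕜 := ℝ) s (e x)).hasMFDerivAt
    rw [pullback_pullback η (mdifferentiableAt_extChartAt_symm hxt)
      (hφs.mdifferentiableAt (by simp))]
    have h2 := (HasMFDerivAt.comp (I' := 𝓘(ℝ, ℝ × E)) (e x)
      ((hGs (s, e x) hxt).mdifferentiableAt (by simp)).hasMFDerivAt hc).mfderiv
    change η (G (s, e x)) _ = η (G (s, e x)) _
    congr 1
    ext i
    fin_cases i
    exact (congrArg (fun L : E →L[ℝ] E => L v) h2).symm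
  have hzero : pullback (φ 0) η = η := by
    have : (φ 0 : M → M) = id := funext φ.map_zero_apply
    rw [this]
    funext z
    ext v
    simp [pullback, mfderiv_id]
  have hfin : (pullback (I := 𝓘(ℝ, E)) e.symm (pullback (φ t) η : DForm I M 1) :
      DForm 𝓘(ℝ, E) E 1) (e x) = (pullback (I := 𝓘(ℝ, E)) e.symm η : DForm 𝓘(ℝ, E) E 1) (e x) := by
    ext v
    have hv : v = ![v 0] := by ext i; fin_cases i; rfl
    have h1 := ((hpull t (v 0)).symm.trans (hconst (v 0))).trans (hpull 0 (v 0))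
    rw [hzero] at h1
    rw [hv]
    exact h1
  -- A form is recovered at `x` from its expression in a chart, so the coordinate equality `hfin`
  -- suffices.
  have hsec : ∀ τ : DForm I M 1, τ x = (pullback e (pullback (I := 𝓘(ℝ, E)) e.symm τ :
      DForm 𝓘(ℝ, E) E 1) : DForm I M 1) x := fun τ =>
    eq_pullback_section (mdifferentiableAt_extChartAt (mem_chart_source H x))
      (mdifferentiableAt_extChartAt_symm hxt) (by
        filter_upwards [extChartAt_source_mem_nhds (I := I) x] with z hz
        exact e.left_inv hz)
  rw [hsec (pullback (φ t) η), hsec η]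
  simp only [pullback] at hfin ⊢
  rw [hfin]

end Invariance

/-! ### Inverse function theorem, submersions and local sections -/

section InverseFunction

variable {E : Type*} [NormedAddCommGroup E] [NormedSpace ℝ E] [FiniteDimensional ℝ E]
  {H : Type*} [TopologicalSpace H] {I : ModelWithCorners ℝ E H} [I.Boundaryless]
  {E' : Type*} [NormedAddCommGroup E'] [NormedSpace ℝ E'] [FiniteDimensional ℝ E']
  {H' : Type*} [TopologicalSpace H'] {J : ModelWithCorners ℝ E' H'} [J.Boundaryless]
  {M : Type*} [TopologicalSpace M] [ChartedSpace H M] [IsManifold I ∞ M]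
  {N : Type*} [TopologicalSpace N] [ChartedSpace H' N] [IsManifold J ∞ N]

/-- A smooth map between vector spaces with bijective derivative at a point is a local
diffeomorphism there. -/
theorem isLocalDiffeomorphAt_of_bijective_fderiv {f : E → E'} {x : E}
    (hf : ∀ᶠ z in 𝓝 x, ContDiffAt ℝ ∞ f z) (hb : Function.Bijective (fderiv ℝ f x)) :
    IsLocalDiffeomorphAt 𝓘(ℝ, E) 𝓘(ℝ, E') ∞ f x := by
  have hfx := hf.self_of_nhds
  let L : E ≃L[ℝ] E' := (LinearEquiv.ofBijective (fderiv ℝ f x).toLinearMap hb).toContinuousLinearEquiv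
  have hL : (L : E →L[ℝ] E') = fderiv ℝ f x := by ext v; rfl
  have hd : HasFDerivAt f (L : E →L[ℝ] E') x := by
    rw [hL]; exact (hfx.differentiableAt (by simp)).hasFDerivAt
  let Φ := hfx.toOpenPartialHomeomorph f hd (by simp)
  -- Invertibility is an open condition. Restricting to a set where it holds makes the inverse
  -- smooth on its whole domain, not only at `f x`.
  have hinv : ∀ᶠ z in 𝓝 x, fderiv ℝ f z ∈ range ((↑) : (E ≃L[ℝ] E') → E →L[ℝ] E') := by
    have hc : ContinuousAt (fderiv ℝ f) x :=
      (hfx.fderiv_right (m := ∞) (by simp)).continuousAt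
    exact hc.eventually (ContinuousLinearEquiv.isOpen.mem_nhds ⟨L, hL⟩)
  obtain ⟨U, hU, hUo, hxU⟩ := eventually_nhds_iff.1 (hf.and hinv)
  let Ψ := Φ.restrOpen U hUo
  have hΨ : ∀ z, Ψ z = f z := fun z => rfl
  have hxΦ : x ∈ Φ.source := hfx.mem_toOpenPartialHomeomorph_source hd (by simp)
  have hs : Ψ.source ⊆ U := fun z hz => hz.2
  refine ⟨⟨Ψ.toPartialEquiv, Ψ.open_source, Ψ.open_target, ?_, ?_⟩, ⟨hxΦ, hxU⟩, fun z _ => rfl⟩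
  · exact fun z hz => ((hU z (hs hz)).1).contMDiffAt.contMDiffWithinAt
  · intro y hy
    obtain ⟨h1, A, hA⟩ := hU _ (hs (Ψ.map_target hy))
    have h2 : ContDiffAt ℝ ∞ Ψ.symm y := Ψ.contDiffAt_symm hy (f₀' := A) (by
      rw [hA]; exact (h1.differentiableAt (by simp)).hasFDerivAt) h1
    exact h2.contMDiffAt.contMDiffWithinAt

theorem isLocalDiffeomorphAt_congr {f g : M → N} {x : M} (h : IsLocalDiffeomorphAt I J ∞ f x)
    (hfg : f =ᶠ[𝓝 x] g) : IsLocalDiffeomorphAt I J ∞ g x := by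
  obtain ⟨Φ, hx, hΦ⟩ := h
  obtain ⟨U, hU, hUo, hxU⟩ := eventually_nhds_iff.1 hfg
  let Ψ := Φ.toOpenPartialHomeomorph.restrOpen U hUo
  refine ⟨⟨Ψ.toPartialEquiv, Ψ.open_source, Ψ.open_target, ?_, ?_⟩, ⟨hx, hxU⟩, fun z hz => ?_⟩
  · exact Φ.contMDiffOn_toFun.mono fun z hz => hz.1
  · exact Φ.contMDiffOn_invFun.mono fun z hz => hz.1
  · exact (hU z hz.2).symm.trans (hΦ hz.1)

variable (I) in
/-- The preferred chart as a partial diffeomorphism. -/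
def extChartDiffeo (x : M) : PartialDiffeomorph I 𝓘(ℝ, E) M E ∞ where
  toPartialEquiv := extChartAt I x
  open_source := isOpen_extChartAt_source x
  open_target := isOpen_extChartAt_target x
  contMDiffOn_toFun := by rw [extChartAt_source]; exact contMDiffOn_extChartAt
  contMDiffOn_invFun := contMDiffOn_extChartAt_symm x

theorem isLocalDiffeomorphAt_extChartAt (x : M) :
    IsLocalDiffeomorphAt I 𝓘(ℝ, E) ∞ (extChartAt I x) x :=
  ⟨extChartDiffeo I x, mem_extChartAt_source x, fun _ _ => rfl⟩

theorem isLocalDiffeomorphAt_extChartAt_symm (x : M) :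
    IsLocalDiffeomorphAt 𝓘(ℝ, E) I ∞ (extChartAt I x).symm (extChartAt I x x) :=
  ⟨(extChartDiffeo I x).symm, mem_extChartAt_target x, fun _ _ => rfl⟩

theorem _root_.IsLocalDiffeomorphAt.bijective_mfderiv {f : M → N} {x : M}
    (h : IsLocalDiffeomorphAt I J ∞ f x) : Function.Bijective (mfderiv I J f x) := by
  have h1 := (h.mfderivToContinuousLinearEquiv (by simp)).bijective
  rwa [← h.mfderivToContinuousLinearEquiv_coe (by simp)]

/-- The inverse function theorem on manifolds. -/
theorem isLocalDiffeomorphAt_of_bijective_mfderiv {f : M → N} {x : M}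
    (hf : ∀ᶠ z in 𝓝 x, ContMDiffAt I J ∞ f z) (hb : Function.Bijective (mfderiv I J f x)) :
    IsLocalDiffeomorphAt I J ∞ f x := by
  set e := extChartAt I x
  set e' := extChartAt J (f x)
  have hx : e.symm (e x) = x := extChartAt_to_inv x
  have hc : ContinuousAt e.symm (e x) := continuousAt_extChartAt_symm x
  have hfc : ContinuousAt (fun z => f (e.symm z)) (e x) :=
    ContinuousAt.comp (by rw [hx]; exact hf.self_of_nhds.continuousAt) hc
  have hg : ∀ᶠ z in 𝓝 (e x), ContDiffAt ℝ ∞ (fun z => e' (f (e.symm z))) z := by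
    have h1 : ∀ᶠ z in 𝓝 (e x), ContMDiffAt I J ∞ f (e.symm z) :=
      hc.eventually (by rwa [hx])
    have h2 : ∀ᶠ z in 𝓝 (e x), f (e.symm z) ∈ (chartAt H' (f x)).source :=
      hfc.eventually ((chartAt H' (f x)).open_source.mem_nhds (by
        show f (e.symm (e x)) ∈ _
        rw [hx]; exact mem_chart_source H' (f x)))
    filter_upwards [h1, h2, (isOpen_extChartAt_target x).mem_nhds (mem_extChartAt_target x)]
      with z hz1 hz2 hz3
    exact contDiffAt_chart_rep hz3 hz1 hz2
  have he := (isLocalDiffeomorphAt_extChartAt_symm (I := I) x).bijective_mfderiv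
  have he' := (isLocalDiffeomorphAt_extChartAt (I := J) (f x)).bijective_mfderiv
  have hfd := hf.self_of_nhds.mdifferentiableAt (n := ∞) (by simp)
  have hch : HasMFDerivAt 𝓘(ℝ, E) 𝓘(ℝ, E') (fun z => e' (f (e.symm z))) (e x)
      ((mfderiv J 𝓘(ℝ, E') e' (f x)).comp ((mfderiv I J f x).comp
        (mfderiv 𝓘(ℝ, E) I e.symm (e x)))) := by
    have k1 : HasMFDerivAt 𝓘(ℝ, E) I e.symm (e x) (mfderiv 𝓘(ℝ, E) I e.symm (e x)) :=
      (mdifferentiableAt_extChartAt_symm (mem_extChartAt_target x)).hasMFDerivAt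
    have k2 : HasMFDerivAt I J f (e.symm (e x)) (mfderiv I J f x : E →L[ℝ] E') := by
      rw [hx]; exact hfd.hasMFDerivAt
    have k3 : HasMFDerivAt J 𝓘(ℝ, E') e' (f (e.symm (e x))) (mfderiv J 𝓘(ℝ, E') e' (f x) :
        E' →L[ℝ] E') := by
      rw [hx]
      have := isManifold_one_of_infty (I := J) (M := N)
      exact (mdifferentiableAt_extChartAt (mem_chart_source H' (f x))).hasMFDerivAt
    exact HasMFDerivAt.comp (e x) k3 (HasMFDerivAt.comp (e x) k2 k1)
  have hgb : Function.Bijective (fderiv ℝ (fun z => e' (f (e.symm z))) (e x)) := by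
    have := hch.mfderiv
    rw [mfderiv_eq_fderiv] at this
    rw [this]
    exact he'.comp (hb.comp he)
  have hgl := isLocalDiffeomorphAt_of_bijective_fderiv hg hgb
  have h1 := (isLocalDiffeomorphAt_extChartAt (I := I) x).comp _ _ hgl
  have hv : ((fun z => e' (f (e.symm z))) ∘ e) x = e' (f x) := by
    simp only [Function.comp, hx]
  have h2 := IsLocalDiffeomorphAt.comp J N h1 (g := e'.symm) (by
    rw [hv]; exact isLocalDiffeomorphAt_extChartAt_symm (I := J) (f x))
  refine isLocalDiffeomorphAt_congr h2 ?_
  have h3 : ∀ᶠ z in 𝓝 x, f z ∈ e'.source :=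
    hf.self_of_nhds.continuousAt.eventually (extChartAt_source_mem_nhds (I := J) (f x))
  filter_upwards [extChartAt_source_mem_nhds (I := I) x, h3] with z hz hz3
  simp only [Function.comp]
  rw [e.left_inv hz, e'.left_inv hz3]


theorem hasMFDerivAt_prodMk_space {F G : Type*} [NormedAddCommGroup F] [NormedSpace ℝ F]
    [NormedAddCommGroup G] [NormedSpace ℝ G] {f : M → F} {g : M → G} {x : M} {f' : E →L[ℝ] F}
    {g' : E →L[ℝ] G} (hf : HasMFDerivAt I 𝓘(ℝ, F) f x f') (hg : HasMFDerivAt I 𝓘(ℝ, G) g x g') :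
    HasMFDerivAt I 𝓘(ℝ, F × G) (fun z => (f z, g z)) x (f'.prod g') :=
  ⟨hf.1.prodMk hg.1, hf.2.prodMk hg.2⟩

/-- A surjective linear map can be completed to an isomorphism onto a product. -/
theorem exists_complementary_map {K : Type*} [NormedAddCommGroup K] [NormedSpace ℝ K]
    [FiniteDimensional ℝ K] (L : E →L[ℝ] E') (hL : Function.Surjective L)
    (hK : Module.finrank ℝ E = Module.finrank ℝ E' + Module.finrank ℝ K) :
    ∃ B : E →L[ℝ] K, Function.Bijective fun v => (L v, B v) := by
  obtain ⟨C, hC⟩ := Submodule.exists_isCompl L.ker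
  have hr : Module.finrank ℝ L.range = Module.finrank ℝ E' := by
    rw [LinearMap.range_eq_top.2 hL, finrank_top]
  have hk := LinearMap.finrank_range_add_finrank_ker L.toLinearMap
  let eK : L.ker ≃ₗ[ℝ] K := LinearEquiv.ofFinrankEq _ _ (by omega)
  let B : E →ₗ[ℝ] K := eK.toLinearMap ∘ₗ Submodule.projectionOnto _ _ hC
  refine ⟨B.toContinuousLinearMap, ?_⟩
  let T : E →ₗ[ℝ] E' × K := L.toLinearMap.prod B
  have hinj : Function.Injective T := by
    rw [← LinearMap.ker_eq_bot, LinearMap.ker_eq_bot']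
    intro v hv
    have h1 : L v = 0 := congrArg Prod.fst hv
    have h2 : B v = 0 := congrArg Prod.snd hv
    have h3 : Submodule.projectionOnto _ _ hC v = 0 := eK.map_eq_zero_iff.1 h2
    have h4 : v ∈ L.ker := h1
    have h5 := Submodule.projectionOnto_apply_left hC ⟨v, h4⟩
    rw [h3] at h5
    exact (congrArg Subtype.val h5).symm
  have hfin : Module.finrank ℝ E = Module.finrank ℝ (E' × K) := by
    rw [Module.finrank_prod, hK]
  exact ⟨hinj, (LinearMap.injective_iff_surjective_of_finrank_eq_finrank hfin).1 hinj⟩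

/-- A smooth map with everywhere surjective differential is a submersion. -/
theorem isSubmersion_of_surjective_mfderiv {f : M → N} (hf : ContMDiff I J ∞ f)
    (hs : ∀ x, Function.Surjective (mfderiv I J f x)) : Manifold.IsSubmersion I J ∞ f := by
  have hI := isManifold_one_of_infty (I := I) (M := M)
  have hJ := isManifold_one_of_infty (I := J) (M := N)
  let K := EuclideanSpace ℝ (Fin (Module.finrank ℝ E - Module.finrank ℝ E'))
  refine Manifold.IsSubmersionOfComplement.isSubmersion (F := K) fun x => ?_
  have hle : Module.finrank ℝ E' ≤ Module.finrank ℝ E :=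
    LinearMap.finrank_le_finrank_of_surjective (f := (mfderiv I J f x).toLinearMap) (hs x)
  have hK : Module.finrank ℝ E = Module.finrank ℝ E' + Module.finrank ℝ K := by
    rw [finrank_euclideanSpace_fin]; omega
  set e := extChartAt I x
  set e' := extChartAt J (f x)
  have he := isLocalDiffeomorphAt_extChartAt (I := I) x
  have he' := isLocalDiffeomorphAt_extChartAt (I := J) (f x)
  have hfx : MDifferentiableAt I J f x := (hf x).mdifferentiableAt (by simp)
  let L : E →L[ℝ] E' := (mfderiv J 𝓘(ℝ, E') e' (f x)).comp (mfderiv I J f x)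
  have hLs : Function.Surjective L := he'.bijective_mfderiv.surjective.comp (hs x)
  obtain ⟨B, hB⟩ := exists_complementary_map L hLs hK
  let D : E ≃L[ℝ] E := he.mfderivToContinuousLinearEquiv (by simp)
  let A : E →L[ℝ] K := B.comp (D.symm : E →L[ℝ] E)
  -- The coordinates of `f` are completed by a linear function of the source chart, chosen so that
  -- the differential at `x` is an isomorphism. Then `F` is a local diffeomorphism, and in the chart
  -- `dom` built from it `f` becomes the first projection after `q`.
  let F : M → E' × K := fun z => (e' (f z), A (e z))
  have hd1 : HasMFDerivAt I 𝓘(ℝ, E') (fun z => e' (f z)) x L :=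
    HasMFDerivAt.comp x
      (mdifferentiableAt_extChartAt (mem_chart_source H' (f x))).hasMFDerivAt hfx.hasMFDerivAt
  have hd2 : HasMFDerivAt I 𝓘(ℝ, K) (fun z => A (e z)) x B := by
    have := HasMFDerivAt.comp (I' := 𝓘(ℝ, E)) (g := A) x A.hasMFDerivAt
      (mdifferentiableAt_extChartAt (I := I) (mem_chart_source H x)).hasMFDerivAt
    refine this.congr_mfderiv ?_
    ext v
    exact congrArg B (D.symm_apply_apply v)
  have hFs : ∀ᶠ z in 𝓝 x, ContMDiffAt I 𝓘(ℝ, E' × K) ∞ F z := by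
    have h1 : ∀ᶠ z in 𝓝 x, f z ∈ (chartAt H' (f x)).source :=
      (hf x).continuousAt.eventually ((chartAt H' (f x)).open_source.mem_nhds
        (mem_chart_source H' (f x)))
    filter_upwards [h1, (chartAt H x).open_source.mem_nhds (mem_chart_source H x)] with z hz1 hz2
    exact ((contMDiffAt_extChartAt' hz1).comp z (hf z)).prodMk_space
      (A.contMDiff.contMDiffAt.comp z (contMDiffAt_extChartAt' hz2))
  have hFd : mfderiv I 𝓘(ℝ, E' × K) F x = L.prod B := by
    have := hasMFDerivAt_prodMk_space hd1 hd2
    exact this.mfderiv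
  obtain ⟨Φ, hxΦ, hΦ⟩ := isLocalDiffeomorphAt_of_bijective_mfderiv hFs (by
    rw [hFd]; exact hB)
  let q : E ≃L[ℝ] E' × K := ContinuousLinearEquiv.ofFinrankEq (by rw [Module.finrank_prod]; exact hK)
  let dom : OpenPartialHomeomorph M H := (Φ.toOpenPartialHomeomorph.transHomeomorph
    q.symm.toHomeomorph).transHomeomorph I.toHomeomorph.symm
  have hds : dom.source = Φ.source := rfl
  have hdom : dom ∈ IsManifold.maximalAtlas I ∞ M := by
    rw [IsManifold.mem_maximalAtlas_iff_contMDiffOn]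
    constructor
    · have h1 : ContMDiffOn 𝓘(ℝ, E) I ∞ I.symm univ := by
        have := I.contMDiffOn_symm (n := ∞)
        rwa [I.range_eq_univ] at this
      exact h1.comp (q.symm.contDiff.contMDiff.comp_contMDiffOn Φ.contMDiffOn_toFun)
        (fun _ _ => mem_univ _)
    · exact Φ.contMDiffOn_invFun.comp
        (q.contDiff.contMDiff.comp I.contMDiff).contMDiffOn (fun z hz => by simpa [dom] using hz)
  refine Manifold.IsSubmersionAtOfComplement.mk_of_continuousAt (hf x).continuousAt q dom
    (chartAt H' (f x)) hxΦ (mem_chart_source H' (f x)) hdom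
    (IsManifold.chart_mem_maximalAtlas _) ?_
  intro y hy
  have hIy : I (I.symm y) = y := I.right_inv (by rw [I.range_eq_univ]; trivial)
  have hy' : q y ∈ Φ.target := by
    have h1 : (∃ z, I z = y) ∧ q (I (I.symm y)) ∈ Φ.target := by
      simpa [dom, OpenPartialHomeomorph.extend_target] using hy
    have h2 := h1.2
    rwa [hIy] at h2
  have h2 : (dom.extend I).symm y = Φ.invFun (q y) := by
    change Φ.invFun (q (I (I.symm y))) = _
    rw [hIy]
  have h3 : F (Φ.invFun (q y)) = q y := by
    exact (hΦ (Φ.map_target hy')).trans (Φ.right_inv hy')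
  simp only [Function.comp, h2]
  exact congrArg Prod.fst h3

/-- A submersion has smooth local sections. -/
theorem _root_.Manifold.IsSubmersionAt.exists_section {f : M → N} {x : M}
    (h : Manifold.IsSubmersionAt I J ∞ f x) :
    ∃ s : N → M, (∀ᶠ y in 𝓝 (f x), ContMDiffAt J I ∞ s y) ∧ s (f x) = x ∧
      ∀ᶠ y in 𝓝 (f x), f (s y) = y := by
  set d := h.domChart.extend I
  set c := h.codChart.extend J
  -- In the submersion charts, the section freezes the complementary coordinate at its value at `x`,
  -- so that it passes through `x`.
  let j : E' → E := fun u => h.equiv.symm (u, (h.equiv (d x)).2)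
  have hxs : x ∈ d.source := by
    rw [OpenPartialHomeomorph.extend_source]; exact h.mem_domChart_source
  have hfxs : f x ∈ c.source := by
    rw [OpenPartialHomeomorph.extend_source]; exact h.mem_codChart_source
  have hdx : d x ∈ d.target := d.map_source hxs
  have hcf : c (f x) = (h.equiv (d x)).1 := by
    have : c (f (d.symm (d x))) = (h.equiv (d x)).1 := h.writtenInCharts hdx
    rwa [d.left_inv hxs] at this
  have hjx : j (c (f x)) = d x := by
    simp only [j, hcf, Prod.mk.eta, ContinuousLinearEquiv.symm_apply_apply]
  have hjd : ContDiff ℝ ∞ j := h.equiv.symm.contDiff.comp (contDiff_id.prodMk contDiff_const)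
  have hto : IsOpen d.target := h.domChart.isOpen_extend_target
  have hso : IsOpen c.source := by
    rw [OpenPartialHomeomorph.extend_source]; exact h.codChart.open_source
  have hcc : ∀ y ∈ c.source, ContMDiffAt J 𝓘(ℝ, E') ∞ c y := fun y hy =>
    OpenPartialHomeomorph.contMDiffAt_extend h.codChart_mem_maximalAtlas (by
      rwa [OpenPartialHomeomorph.extend_source] at hy)
  have hdd : ∀ z ∈ d.target, ContMDiffAt 𝓘(ℝ, E) I ∞ d.symm z := fun z hz => by
    have := contMDiffOn_extend_symm h.domChart_mem_maximalAtlas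
    rw [← OpenPartialHomeomorph.extend_target'] at this
    exact this.contMDiffAt (hto.mem_nhds hz)
  have hev : ∀ᶠ y in 𝓝 (f x), y ∈ c.source ∧ j (c y) ∈ d.target := by
    have : ContinuousAt (fun y => j (c y)) (f x) :=
      hjd.continuous.continuousAt.comp (hcc _ hfxs).continuousAt
    exact (show ∀ᶠ y in 𝓝 (f x), y ∈ c.source from hso.mem_nhds hfxs).and
      (this.eventually (hto.mem_nhds (by
        show j (c (f x)) ∈ _
        rw [hjx]; exact hdx)))
  refine ⟨fun y => d.symm (j (c y)), ?_, ?_, ?_⟩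
  · filter_upwards [hev] with y hy
    exact (hdd _ hy.2).comp y (hjd.contMDiff.contMDiffAt.comp y (hcc y hy.1))
  · show d.symm (j (c (f x))) = x
    rw [hjx, d.left_inv hxs]
  · filter_upwards [hev] with y hy
    have h1 := h.writtenInCharts hy.2
    simp only [Function.comp, j, ContinuousLinearEquiv.apply_symm_apply] at h1
    have h2 : d.symm (j (c y)) ∈ h.domChart.source := by
      have := d.map_target hy.2
      rwa [OpenPartialHomeomorph.extend_source] at this
    have h3 : f (d.symm (j (c y))) ∈ c.source := by
      rw [OpenPartialHomeomorph.extend_source]; exact h.source_subset_preimage_source h2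
    exact c.injOn h3 hy.1 h1

/-- Differentiating `f ∘ s = id` exhibits the differential of `s` as a right inverse. -/
theorem surjective_mfderiv_of_section {f : M → N} {x : M} (hf : MDifferentiableAt I J f x)
    {s : N → M} (hs : MDifferentiableAt J I s (f x)) (hsx : s (f x) = x)
    (hfs : ∀ᶠ y in 𝓝 (f x), f (s y) = y) : Function.Surjective (mfderiv I J f x) := by
  have h2 : HasMFDerivAt I J f (s (f x)) (mfderiv I J f x : E →L[ℝ] E') := by
    rw [hsx]; exact hf.hasMFDerivAt
  have h3 := (HasMFDerivAt.comp (f x) h2 hs.hasMFDerivAt).congr_of_eventuallyEq (f₁ := id)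
    (hfs.mono fun y hy => hy.symm)
  have h4 := hasMFDerivAt_unique h3 (hasMFDerivAt_id (f x))
  exact fun v => ⟨(mfderiv J I s (f x) : E' →L[ℝ] E) v,
    congrArg (fun T : E' →L[ℝ] E' => T v) h4⟩

/-- The differential of a submersion is surjective. -/
theorem _root_.Manifold.IsSubmersionAt.surjective_mfderiv {f : M → N} {x : M}
    (h : Manifold.IsSubmersionAt I J ∞ f x) : Function.Surjective (mfderiv I J f x) := by
  obtain ⟨s, hs, hsx, hfs⟩ := h.exists_section
  exact surjective_mfderiv_of_section (h.contMDiffAt.mdifferentiableAt (by simp))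
    (hs.self_of_nhds.mdifferentiableAt (by simp)) hsx hfs

end InverseFunction

/-! ### Proper actions and the topology of orbit spaces -/

section FlowTopology

variable {M : Type*} [TopologicalSpace M]

/-- Sequential-type form of properness of an `ℝ`-action: times converge along an ultrafilter
as soon as the points and their images do. -/
def HasConvergentTimes (φ : Flow ℝ M) : Prop :=
  ∀ (𝒰 : Ultrafilter (ℝ × M)) (x y : M), Tendsto Prod.snd (𝒰 : Filter (ℝ × M)) (𝓝 x) →
    Tendsto (fun q : ℝ × M => φ q.1 q.2) (𝒰 : Filter (ℝ × M)) (𝓝 y) →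
    ∃ t : ℝ, Tendsto Prod.fst (𝒰 : Filter (ℝ × M)) (𝓝 t)

theorem HasConvergentTimes.exists_tendsto {φ : Flow ℝ M} (h : HasConvergentTimes φ)
    {ι : Type*} (𝒰 : Ultrafilter ι) {t : ι → ℝ} {a : ι → M} {x y : M}
    (hx : Tendsto a (𝒰 : Filter ι) (𝓝 x))
    (hy : Tendsto (fun i => φ (t i) (a i)) (𝒰 : Filter ι) (𝓝 y)) :
    ∃ s : ℝ, Tendsto t (𝒰 : Filter ι) (𝓝 s) := by
  have := h (𝒰.map fun i => (t i, a i)) x y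
  simp only [Ultrafilter.coe_map, tendsto_map'_iff] at this
  exact this hx hy

theorem continuous_periodAction (φ : Flow ℝ M) (ρ : ℝ≥0∞)
    (h : ∀ t ∈ AddSubgroup.zmultiples ρ.toReal, ∀ x, φ t x = x) :
    Continuous fun q : PeriodGroup ρ × M =>
      (periodAction φ ρ h).toVAdd.vadd q.1 q.2 := by
  have hq : IsOpenQuotientMap (Prod.map (QuotientAddGroup.mk : ℝ → PeriodGroup ρ) (id : M → M)) :=
    QuotientAddGroup.isOpenQuotientMap_mk.prodMap IsOpenQuotientMap.id
  rw [← hq.continuous_comp_iff]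
  exact φ.cont'

/-- The acting circle is compact, so group elements always converge along an ultrafilter; the
Hausdorff property identifies the limit of the images. -/
theorem properVAdd_of_ne_top [T2Space M] (φ : Flow ℝ M) {ρ : ℝ≥0∞} (h0 : 0 < ρ) (hρ : ρ ≠ ⊤)
    (h : ∀ t ∈ AddSubgroup.zmultiples ρ.toReal, ∀ x, φ t x = x) :
    @ProperVAdd (PeriodGroup ρ) M _ _ _ (periodAction φ ρ h) := by
  let _ := periodAction φ ρ h
  have : Fact (0 < ρ.toReal) := ⟨ENNReal.toReal_pos h0.ne' hρ⟩
  have hc := continuous_periodAction φ ρ h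
  refine ⟨isProperMap_iff_ultrafilter.2 ⟨hc.prodMk continuous_snd, fun 𝒰 y hy => ?_⟩⟩
  have hx : Tendsto Prod.snd (𝒰 : Filter (PeriodGroup ρ × M)) (𝓝 y.2) :=
    (continuous_snd.tendsto y).comp hy
  have hg : Tendsto Prod.fst (𝒰 : Filter (PeriodGroup ρ × M)) (𝓝 (𝒰.map Prod.fst).lim) :=
    (𝒰.map Prod.fst).le_nhds_lim
  have h1 : Tendsto id (𝒰 : Filter (PeriodGroup ρ × M)) (𝓝 ((𝒰.map Prod.fst).lim, y.2)) := by
    rw [nhds_prod_eq]; exact hg.prodMk hx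
  have h2 := ((hc.prodMk continuous_snd).tendsto ((𝒰.map Prod.fst).lim, y.2)).comp h1
  exact ⟨_, tendsto_nhds_unique h2 hy, h1⟩

/-- Needed because the period group for `ρ = ∞` is the quotient of `ℝ` by the trivial subgroup
rather than `ℝ` itself. -/
theorem isHomeomorph_mk_zmultiples {r : ℝ} (hr : r = 0) :
    IsHomeomorph (QuotientAddGroup.mk : ℝ → AddCircle r) where
  continuous := continuous_quotient_mk'
  isOpenMap := QuotientAddGroup.isOpenQuotientMap_mk.isOpenMap
  bijective := by
    refine ⟨fun a b hab => ?_, QuotientAddGroup.mk_surjective⟩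
    have := QuotientAddGroup.eq.1 hab
    rw [hr, AddSubgroup.zmultiples_zero_eq_bot, AddSubgroup.mem_bot] at this
    linarith

/-- Properness of `(g, x) ↦ (g +ᵥ x, x)` asks that an ultrafilter with convergent image converge.
The point component converges by assumption, so the only content is convergence of the times. -/
theorem properVAdd_top_iff [T2Space M] (φ : Flow ℝ M) {ρ : ℝ≥0∞} (hρ : ρ = ⊤)
    (h : ∀ t ∈ AddSubgroup.zmultiples ρ.toReal, ∀ x, φ t x = x) :
    @ProperVAdd (PeriodGroup ρ) M _ _ _ (periodAction φ ρ h) ↔ HasConvergentTimes φ := by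
  let _ := periodAction φ ρ h
  have hm := isHomeomorph_mk_zmultiples (r := ρ.toReal) (by simp [hρ])
  let m : ℝ ≃ₜ PeriodGroup ρ := hm.homeomorph
  have hc := continuous_periodAction φ ρ h
  constructor
  · intro hp 𝒰 x y hx hy
    have h1 := (isProperMap_iff_ultrafilter.1 hp.isProperMap_vadd_pair).2
      (𝒰 := 𝒰.map (Prod.map m id)) (y := (y, x)) (by
        rw [Ultrafilter.coe_map, tendsto_map'_iff, nhds_prod_eq]
        exact hy.prodMk hx)
    obtain ⟨g, -, hg⟩ := h1
    refine ⟨m.symm g.1, ?_⟩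
    have h2 : Tendsto (fun q : ℝ × M => m q.1) (𝒰 : Filter (ℝ × M)) (𝓝 g.1) :=
      (continuous_fst.tendsto g).comp (show Tendsto (Prod.map m id) _ _ from hg)
    have h3 := (m.symm.continuous.tendsto g.1).comp h2
    refine h3.congr fun q => m.symm_apply_apply q.1
  · intro hp
    refine ⟨isProperMap_iff_ultrafilter.2 ⟨hc.prodMk continuous_snd, fun 𝒰 y hy => ?_⟩⟩
    have hx : Tendsto Prod.snd (𝒰 : Filter (PeriodGroup ρ × M)) (𝓝 y.2) :=
      (continuous_snd.tendsto y).comp hy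
    have hv : ∀ q : PeriodGroup ρ × M, φ (m.symm q.1) q.2 = q.1 +ᵥ q.2 := fun q => by
      have : q.1 = m (m.symm q.1) := (m.apply_symm_apply q.1).symm
      conv_rhs => rw [this]
      rfl
    obtain ⟨t, ht⟩ := hp.exists_tendsto 𝒰 (t := fun q => m.symm q.1) (a := Prod.snd) hx
      (y := y.1) (((continuous_fst.tendsto y).comp hy).congr fun q => (hv q).symm)
    have hg : Tendsto Prod.fst (𝒰 : Filter (PeriodGroup ρ × M)) (𝓝 (m t)) := by
      refine ((m.continuous.tendsto t).comp ht).congr fun q => m.apply_symm_apply q.1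
    have h1 : Tendsto id (𝒰 : Filter (PeriodGroup ρ × M)) (𝓝 (m t, y.2)) := by
      rw [nhds_prod_eq]; exact hg.prodMk hx
    have h2 := ((hc.prodMk continuous_snd).tendsto (m t, y.2)).comp h1
    exact ⟨_, tendsto_nhds_unique h2 hy, h1⟩

theorem properVAdd_of_hasConvergentTimes [T2Space M] (φ : Flow ℝ M) {ρ : ℝ≥0∞} (h0 : 0 < ρ)
    (hφ : ρ = ⊤ → HasConvergentTimes φ)
    (h : ∀ t ∈ AddSubgroup.zmultiples ρ.toReal, ∀ x, φ t x = x) :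
    @ProperVAdd (PeriodGroup ρ) M _ _ _ (periodAction φ ρ h) := by
  by_cases hρ : ρ = ⊤
  · exact (properVAdd_top_iff φ hρ h).2 (hφ hρ)
  · exact properVAdd_of_ne_top φ h0 hρ h

theorem orbitProj_eq_iff (φ : Flow ℝ M) {x y : M} :
    orbitProj φ x = orbitProj φ y ↔ ∃ t, φ t x = y := by
  let _ := φ.toAddAction
  rw [eq_comm]
  exact Quotient.eq.trans (AddAction.orbitRel_apply.trans Iff.rfl)

theorem orbitProj_flow (φ : Flow ℝ M) (t : ℝ) (x : M) : orbitProj φ (φ t x) = orbitProj φ x :=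
  ((orbitProj_eq_iff φ).2 ⟨t, rfl⟩).symm

theorem orbitProj_surjective (φ : Flow ℝ M) : Function.Surjective (orbitProj φ) :=
  Quotient.mk_surjective

theorem isOpenQuotientMap_orbitProj (φ : Flow ℝ M) : IsOpenQuotientMap (orbitProj φ) where
  surjective := orbitProj_surjective φ
  continuous := continuous_quotient_mk'
  isOpenMap U hU := by
    have h1 : IsOpen (orbitProj φ ⁻¹' (orbitProj φ '' U)) := by
      -- The saturation of an open set is a union of its translates by the flow, hence open.
      have : orbitProj φ ⁻¹' (orbitProj φ '' U) = ⋃ t : ℝ, (φ t) ⁻¹' U := by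
        ext x
        simp only [mem_preimage, mem_image, mem_iUnion]
        constructor
        · rintro ⟨y, hy, hxy⟩
          obtain ⟨t, ht⟩ := (orbitProj_eq_iff φ).1 hxy.symm
          exact ⟨t, by rwa [ht]⟩
        · rintro ⟨t, ht⟩
          exact ⟨_, ht, orbitProj_flow φ t x⟩
      rw [this]
      exact isOpen_iUnion fun t => hU.preimage (φ.continuous_toFun t)
    exact isQuotientMap_quotient_mk'.isOpen_preimage.1 h1

theorem secondCountableTopology_orbitSpace [SecondCountableTopology M] (φ : Flow ℝ M) :
    SecondCountableTopology (OrbitSpace φ) :=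
  TopologicalSpace.Quotient.secondCountableTopology (isOpenQuotientMap_orbitProj φ).isOpenMap

/-- The orbit space of a proper action is Hausdorff. -/
theorem t2Space_orbitSpace (φ : Flow ℝ M) {ρ : ℝ≥0∞}
    (h : ∀ t ∈ AddSubgroup.zmultiples ρ.toReal, ∀ x, φ t x = x)
    (hp : @ProperVAdd (PeriodGroup ρ) M _ _ _ (periodAction φ ρ h)) :
    T2Space (OrbitSpace φ) := by
  rw [t2Space_iff_of_isOpenQuotientMap (isOpenQuotientMap_orbitProj φ)]
  let _ := periodAction φ ρ h
  -- The orbit relation is the range of a proper map, hence closed; with an open quotient map this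
  -- is the Hausdorff property.
  have := hp.isProperMap_vadd_pair.isClosedMap.isClosed_range
  convert this using 1
  ext q
  simp only [mem_ofPred_eq, mem_range]
  constructor
  · intro hq
    obtain ⟨t, ht⟩ := (orbitProj_eq_iff φ).1 hq.symm
    exact ⟨((t : PeriodGroup ρ), q.2), Prod.ext ht rfl⟩
  · rintro ⟨⟨g, x⟩, rfl⟩
    induction g using QuotientAddGroup.induction_on with
    | H t => exact orbitProj_flow φ t x

end FlowTopology

/-! ### The antidiagonal flow and the residual flow on its orbit space -/

section ProductFlow

variable {M₁ M₂ : Type*} [TopologicalSpace M₁] [TopologicalSpace M₂]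

/-- The flow of `R₁ - R₂` on a product. -/
def antidiagonalFlow (φ₁ : Flow ℝ M₁) (φ₂ : Flow ℝ M₂) : Flow ℝ (M₁ × M₂) where
  toFun t q := (φ₁ t q.1, φ₂ (-t) q.2)
  cont' := (φ₁.continuous continuous_fst (continuous_fst.comp continuous_snd)).prodMk
    (φ₂.continuous continuous_fst.neg (continuous_snd.comp continuous_snd))
  map_add' s t q := by
    rw [φ₁.map_add, neg_add, φ₂.map_add]
  map_zero' q := by
    rw [neg_zero, φ₁.map_zero_apply, φ₂.map_zero_apply]

variable (φ₁ : Flow ℝ M₁) (φ₂ : Flow ℝ M₂)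

theorem antidiagonalFlow_apply (t : ℝ) (q : M₁ × M₂) :
    antidiagonalFlow φ₁ φ₂ t q = (φ₁ t q.1, φ₂ (-t) q.2) := rfl

theorem antidiagonal_proj_eq_iff {q q' : M₁ × M₂} :
    orbitProj (antidiagonalFlow φ₁ φ₂) q = orbitProj (antidiagonalFlow φ₁ φ₂) q' ↔
      ∃ t, φ₁ t q.1 = q'.1 ∧ φ₂ (-t) q.2 = q'.2 := by
  rw [orbitProj_eq_iff]
  simp only [antidiagonalFlow_apply, Prod.ext_iff]

/-- The times can already be controlled in the first factor, so nothing is asked of the second. -/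
theorem HasConvergentTimes.antidiagonalFlow {φ₁ : Flow ℝ M₁} (h : HasConvergentTimes φ₁)
    (φ₂ : Flow ℝ M₂) : HasConvergentTimes (antidiagonalFlow φ₁ φ₂) := fun 𝒰 x y hx hy =>
  h.exists_tendsto 𝒰 (t := Prod.fst) (a := fun q => q.2.1)
    ((continuous_fst.tendsto x).comp hx) ((continuous_fst.tendsto y).comp hy)

/-- The flow of `(R₁ + R₂) / 2` on the space of orbits of `R₁ - R₂`. -/
def quotientFlow : Flow ℝ (OrbitSpace (antidiagonalFlow φ₁ φ₂)) where
  toFun t := Quotient.map (sa := orbitSetoid (antidiagonalFlow φ₁ φ₂))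
    (sb := orbitSetoid (antidiagonalFlow φ₁ φ₂))
    (fun q => (φ₁ (t / 2) q.1, φ₂ (t / 2) q.2)) (fun a b hab => Quotient.exact (by
      have h1 : orbitProj (antidiagonalFlow φ₁ φ₂) a = orbitProj (antidiagonalFlow φ₁ φ₂) b :=
        Quotient.sound hab
      obtain ⟨s, hs1, hs2⟩ := (antidiagonal_proj_eq_iff φ₁ φ₂).1 h1
      refine (antidiagonal_proj_eq_iff φ₁ φ₂).2 ⟨s, ?_, ?_⟩
      · rw [← hs1, ← φ₁.map_add, ← φ₁.map_add, add_comm]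
      · rw [← hs2, ← φ₂.map_add, ← φ₂.map_add, add_comm]))
  cont' := by
    have hq := (IsOpenQuotientMap.id (X := ℝ)).prodMap
      (isOpenQuotientMap_orbitProj (antidiagonalFlow φ₁ φ₂))
    rw [← hq.continuous_comp_iff]
    exact (isOpenQuotientMap_orbitProj (antidiagonalFlow φ₁ φ₂)).continuous.comp
      ((φ₁.continuous (continuous_fst.div_const 2) (continuous_fst.comp continuous_snd)).prodMk
        (φ₂.continuous (continuous_fst.div_const 2) (continuous_snd.comp continuous_snd)))
  map_add' s t z := by
    induction z using Quotient.inductionOn with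
    | h q =>
      refine congrArg (orbitProj (antidiagonalFlow φ₁ φ₂)) ?_
      simp only [add_div, φ₁.map_add, φ₂.map_add]
  map_zero' z := by
    induction z using Quotient.inductionOn with
    | h q =>
      refine congrArg (orbitProj (antidiagonalFlow φ₁ φ₂)) ?_
      simp only [zero_div, φ₁.map_zero_apply, φ₂.map_zero_apply]

theorem quotientFlow_proj (t : ℝ) (q : M₁ × M₂) :
    quotientFlow φ₁ φ₂ t (orbitProj (antidiagonalFlow φ₁ φ₂) q) =
      orbitProj (antidiagonalFlow φ₁ φ₂) (φ₁ (t / 2) q.1, φ₂ (t / 2) q.2) := rfl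

/-- Pairs of times with sum `t` are exactly `(t / 2, t / 2) + (s, -s)`, and the last summand is
invisible in the quotient. Fibres, periods and properness of the residual flow are all read off from
this. -/
theorem quotientFlow_proj_eq_iff {t : ℝ} {q q' : M₁ × M₂} :
    quotientFlow φ₁ φ₂ t (orbitProj (antidiagonalFlow φ₁ φ₂) q) =
      orbitProj (antidiagonalFlow φ₁ φ₂) q' ↔
    ∃ a b, a + b = t ∧ φ₁ a q.1 = q'.1 ∧ φ₂ b q.2 = q'.2 := by
  rw [quotientFlow_proj, antidiagonal_proj_eq_iff]
  simp only [← φ₁.map_add, ← φ₂.map_add]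
  constructor
  · rintro ⟨s, h1, h2⟩
    exact ⟨s + t / 2, -s + t / 2, by ring, h1, h2⟩
  · rintro ⟨a, b, rfl, h1, h2⟩
    refine ⟨a - (a + b) / 2, ?_, ?_⟩
    · rw [← h1]; congr 1; ring
    · rw [← h2]; congr 1; ring

/-- Sections near the two limits lift points and images to convergent families upstairs. There the
elapsed time splits as `a + b`, each part converges by properness in its factor, and so does the
sum. -/
theorem HasConvergentTimes.quotientFlow {φ₁ : Flow ℝ M₁} {φ₂ : Flow ℝ M₂}
    (h₁ : HasConvergentTimes φ₁) (h₂ : HasConvergentTimes φ₂)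
    (hσ : ∀ z, ∃ σ : OrbitSpace (ContactProduct.antidiagonalFlow φ₁ φ₂) → M₁ × M₂,
      ContinuousAt σ z ∧ ∀ᶠ w in 𝓝 z, orbitProj (ContactProduct.antidiagonalFlow φ₁ φ₂) (σ w) = w) :
    HasConvergentTimes (quotientFlow φ₁ φ₂) := by
  intro 𝒰 z z' hz hz'
  obtain ⟨σ, hσc, hσ1⟩ := hσ z
  obtain ⟨σ', hσc', hσ1'⟩ := hσ z'
  have key : ∀ᶠ q in (𝒰 : Filter (ℝ × OrbitSpace (ContactProduct.antidiagonalFlow φ₁ φ₂))),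
      ∃ a b, a + b = q.1 ∧ φ₁ a (σ q.2).1 = (σ' (ContactProduct.quotientFlow φ₁ φ₂ q.1 q.2)).1 ∧
        φ₂ b (σ q.2).2 = (σ' (ContactProduct.quotientFlow φ₁ φ₂ q.1 q.2)).2 := by
    filter_upwards [hz.eventually hσ1, hz'.eventually hσ1'] with q h1 h2
    rw [← quotientFlow_proj_eq_iff, h1, h2]
  obtain ⟨a, ha⟩ := key.choice
  obtain ⟨b, hb⟩ := ha.choice
  have c1 : Tendsto (fun q : ℝ × OrbitSpace (ContactProduct.antidiagonalFlow φ₁ φ₂) => σ q.2)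
      (𝒰 : Filter _) (𝓝 (σ z)) := Tendsto.comp hσc hz
  have c2 : Tendsto (fun q : ℝ × OrbitSpace (ContactProduct.antidiagonalFlow φ₁ φ₂) =>
      σ' (ContactProduct.quotientFlow φ₁ φ₂ q.1 q.2)) (𝒰 : Filter _) (𝓝 (σ' z')) :=
    Tendsto.comp hσc' hz'
  obtain ⟨s, hs⟩ := h₁.exists_tendsto 𝒰 (t := a) ((continuous_fst.tendsto _).comp c1)
    (((continuous_fst.tendsto _).comp c2).congr' (hb.mono fun q hq => hq.2.1.symm))
  obtain ⟨r, hr⟩ := h₂.exists_tendsto 𝒰 (t := b) ((continuous_snd.tendsto _).comp c1)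
    (((continuous_snd.tendsto _).comp c2).congr' (hb.mono fun q hq => hq.2.2.symm))
  exact ⟨s + r, (hs.add hr).congr' (hb.mono fun q hq => hq.1)⟩

end ProductFlow

/-! ### Arithmetic of the periods -/

section Periods

open AddSubgroup

/-- In units of `c` these are the lcm and the gcd of the coprime integers `l` and `k`: divisibility
gives the intersection, Bézout's identity the sum. -/
theorem zmultiples_mul_inf_sup {k l : ℕ} (hkl : k.Coprime l) {c : ℝ} (hc : 0 < c) :
    (∀ t : ℝ, t ∈ zmultiples ((k * l : ℕ) * c) ↔
      t ∈ zmultiples (l * c) ∧ t ∈ zmultiples (k * c)) ∧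
    (∀ t : ℝ, t ∈ zmultiples c ↔
      ∃ a ∈ zmultiples (l * c), ∃ b ∈ zmultiples (k * c), a + b = t) := by
  have hcop : IsCoprime (k : ℤ) (l : ℤ) := Nat.isCoprime_iff_coprime.2 hkl
  simp only [mem_zmultiples_iff, zsmul_eq_mul]
  constructor
  · refine fun t => ⟨?_, ?_⟩
    · rintro ⟨m, rfl⟩
      exact ⟨⟨m * k, by push_cast; ring⟩, ⟨m * l, by push_cast; ring⟩⟩
    · rintro ⟨⟨m, rfl⟩, ⟨n, hn⟩⟩
      have h1 : n * (k : ℤ) = m * l := by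
        have : ((n * (k : ℤ) : ℤ) : ℝ) = ((m * (l : ℤ) : ℤ) : ℝ) := by
          push_cast
          exact mul_right_cancel₀ hc.ne' (by linarith)
        exact_mod_cast this
      obtain ⟨j, rfl⟩ : (k : ℤ) ∣ m := hcop.dvd_of_dvd_mul_right ⟨n, by linarith⟩
      exact ⟨j, by push_cast; ring⟩
  · refine fun t => ⟨?_, ?_⟩
    · rintro ⟨m, rfl⟩
      obtain ⟨u, v, huv⟩ := hcop
      refine ⟨_, ⟨m * v, rfl⟩, _, ⟨m * u, rfl⟩, ?_⟩
      have : ((u * k + v * l : ℤ) : ℝ) = 1 := by rw [huv]; simp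
      push_cast at this ⊢
      linear_combination m * c * this
    · rintro ⟨_, ⟨m, rfl⟩, _, ⟨n, rfl⟩, rfl⟩
      exact ⟨m * l + n * k, by push_cast; ring⟩

/-- The periods of the antidiagonal flow and of the induced flow on its orbit space. -/
theorem exists_periods {ρ₁ ρ₂ : ℝ≥0∞} (h₁ : 0 < ρ₁) (h₂ : 0 < ρ₂) {k l : ℕ}
    (hρ : ρ₁ = ⊤ ∨ (ρ₁ ≠ ⊤ ∧ ρ₂ ≠ ⊤ ∧ 0 < k ∧ 0 < l ∧ k.Coprime l ∧
      ρ₂ / ρ₁ = (k : ℝ≥0∞) / (l : ℝ≥0∞))) :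
    ∃ τ ρ : ℝ≥0∞, (ρ₁ = ⊤ → τ = ⊤ ∧ ρ = ρ₂) ∧
      (ρ₁ ≠ ⊤ → τ = k * ρ₁ ∧ τ = l * ρ₂ ∧ ρ = ρ₂ / k ∧ ρ = ρ₁ / l) ∧
      0 < τ ∧ 0 < ρ ∧ (τ = ⊤ → ρ₁ = ⊤) ∧ (ρ = ⊤ → ρ₁ = ⊤ ∧ ρ₂ = ⊤) ∧
      (∀ t : ℝ, t ∈ zmultiples τ.toReal ↔
        t ∈ zmultiples ρ₁.toReal ∧ t ∈ zmultiples ρ₂.toReal) ∧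
      (∀ t : ℝ, t ∈ zmultiples ρ.toReal ↔
        ∃ a ∈ zmultiples ρ₁.toReal, ∃ b ∈ zmultiples ρ₂.toReal, a + b = t) := by
  rcases hρ with rfl | ⟨h1t, h2t, hk, hl, hkl, hq⟩
  -- Since `(⊤ : ℝ≥0∞).toReal = 0`, the first group of periods is trivial: it is the intersection,
  -- and adding it leaves the second group unchanged.
  · refine ⟨⊤, ρ₂, fun _ => ⟨rfl, rfl⟩, fun h => absurd rfl h, h₁, h₂, fun _ => rfl,
      fun h => ⟨rfl, h⟩, ?_, ?_⟩
    · simp only [ENNReal.toReal_top, zmultiples_zero_eq_bot]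
      exact fun t => ⟨fun h => ⟨h, h ▸ zero_mem _⟩, fun h => h.1⟩
    · simp [zmultiples_zero_eq_bot]
  · have hk' : (k : ℝ) ≠ 0 := by positivity
    have hl' : (l : ℝ) ≠ 0 := by positivity
    have hr1 : 0 < ρ₁.toReal := ENNReal.toReal_pos h₁.ne' h1t
    -- The common measure of the two periods: `ρ₁ = l c` and `ρ₂ = k c`.
    set c : ℝ := ρ₁.toReal / l with hc
    have hc0 : 0 < c := by positivity
    have e1 : ρ₁.toReal = l * c := by rw [hc]; field_simp
    have e2 : ρ₂.toReal = k * c := by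
      have := congrArg ENNReal.toReal hq
      rw [ENNReal.toReal_div, ENNReal.toReal_div, ENNReal.toReal_natCast,
        ENNReal.toReal_natCast, div_eq_div_iff hr1.ne' hl'] at this
      rw [hc]; field_simp; linarith
    have hkE : (k : ℝ≥0∞) ≠ 0 := by exact_mod_cast hk.ne'
    have hlE : (l : ℝ≥0∞) ≠ 0 := by exact_mod_cast hl.ne'
    have hτ : (k : ℝ≥0∞) * ρ₁ = l * ρ₂ := by
      rw [← ENNReal.toReal_eq_toReal_iff' (ENNReal.mul_ne_top (by simp) h1t)
        (ENNReal.mul_ne_top (by simp) h2t)]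
      simp only [ENNReal.toReal_mul, ENNReal.toReal_natCast, e1, e2]
      ring
    have hρ' : ρ₂ / k = ρ₁ / l := by
      rw [← ENNReal.toReal_eq_toReal_iff' (ENNReal.div_ne_top h2t hkE)
        (ENNReal.div_ne_top h1t hlE)]
      simp only [ENNReal.toReal_div, ENNReal.toReal_natCast, e1, e2]
      field_simp
    have et : ((k : ℝ≥0∞) * ρ₁).toReal = (k * l : ℕ) * c := by
      simp only [ENNReal.toReal_mul, ENNReal.toReal_natCast, e1]; push_cast; ring
    have er : (ρ₁ / (l : ℝ≥0∞)).toReal = c := by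
      simp only [ENNReal.toReal_div, ENNReal.toReal_natCast, hc]
    refine ⟨k * ρ₁, ρ₁ / l, fun h => absurd h h1t, fun _ => ⟨rfl, hτ, hρ'.symm, rfl⟩, ?_, ?_,
      fun h => absurd h (ENNReal.mul_ne_top (by simp) h1t),
      fun h => absurd h (ENNReal.div_ne_top h1t hlE), ?_, ?_⟩
    · exact ENNReal.mul_pos hkE h₁.ne'
    · exact ENNReal.div_pos h₁.ne' (by simp)
    · rw [et, e1, e2]; exact (zmultiples_mul_inf_sup hkl hc0).1
    · rw [er, e1, e2]; exact (zmultiples_mul_inf_sup hkl hc0).2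

end Periods

/-! ### A smooth atlas on a quotient from charts with smooth lifts -/

section QuotientAtlas

variable {E : Type*} [NormedAddCommGroup E] [NormedSpace ℝ E]
  {H : Type*} [TopologicalSpace H] {I : ModelWithCorners ℝ E H} [I.Boundaryless]
  {V : Type*} [NormedAddCommGroup V] [NormedSpace ℝ V]
  {V' : Type*} [NormedAddCommGroup V'] [NormedSpace ℝ V']
  {Q : Type*} [TopologicalSpace Q] [ChartedSpace H Q] [IsManifold I ∞ Q]
  {S : Type*} [TopologicalSpace S]

variable (I) in
/-- A chart of a quotient space which is smooth upstairs and has a smooth lift of its inverse. -/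
structure IsQuotientChart (π : Q → S) (e : OpenPartialHomeomorph S V) : Prop where
  smooth : ContMDiffOn I 𝓘(ℝ, V) ∞ (fun x => e (π x)) (π ⁻¹' e.source)
  exists_lift : ∃ σ : V → Q, ContMDiffOn 𝓘(ℝ, V) I ∞ σ e.target ∧
    ∀ v ∈ e.target, π (σ v) = e.symm v

theorem IsQuotientChart.transHomeomorph {π : Q → S} {e : OpenPartialHomeomorph S V}
    (h : IsQuotientChart I π e) (L : V ≃L[ℝ] V') :
    IsQuotientChart I π (e.transHomeomorph L.toHomeomorph) where
  smooth := L.contDiff.contMDiff.comp_contMDiffOn h.smooth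
  exists_lift := by
    obtain ⟨σ, hσ, hπ⟩ := h.exists_lift
    exact ⟨fun v => σ (L.symm v), hσ.comp L.symm.contDiff.contMDiff.contMDiffOn (fun v hv => hv),
      fun v hv => hπ _ hv⟩

variable (I V) in
/-- The smooth structure on a quotient given by its quotient charts. -/
abbrev quotientChartedSpace (π : Q → S)
    (h : ∀ z : S, ∃ e : OpenPartialHomeomorph S V, IsQuotientChart I π e ∧ z ∈ e.source) :
    ChartedSpace V S where
  atlas := {e | IsQuotientChart I π e}
  chartAt z := (h z).choose
  mem_chart_source z := (h z).choose_spec.2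
  chart_mem_atlas z := (h z).choose_spec.1

variable {π : Q → S}
  (h : ∀ z : S, ∃ e : OpenPartialHomeomorph S V, IsQuotientChart I π e ∧ z ∈ e.source)

-- A transition map factors as `(e' ∘ π) ∘ σ`, where `σ` is a smooth lift of the inverse of `e`;
-- both factors are smooth.
include h in
theorem isManifold_quotient :
    @IsManifold ℝ _ V _ _ V _ 𝓘(ℝ, V) ∞ S _ (quotientChartedSpace I V π h) := by
  let _ := quotientChartedSpace I V π h
  refine isManifold_of_contDiffOn _ _ _ fun e e' he he' => ?_
  obtain ⟨σ, hσ, hπ⟩ := IsQuotientChart.exists_lift he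
  have h1 : ContMDiffOn 𝓘(ℝ, V) 𝓘(ℝ, V) ∞ (fun v => e' (π (σ v))) (e.symm.trans e').source :=
    (IsQuotientChart.smooth he').comp (hσ.mono fun v hv => hv.1) fun v hv => by
      show π (σ v) ∈ e'.source
      rw [hπ v hv.1]; exact hv.2
  rw [contMDiffOn_iff_contDiffOn] at h1
  simp only [modelWithCornersSelf_coe, range_id, inter_univ]
  refine (h1.congr fun v hv => ?_)
  show e' (e.symm v) = e' (π (σ v))
  rw [hπ v hv.1]

theorem contMDiff_quotient_proj (hπ : Continuous π) :
    @ContMDiff ℝ _ E _ _ H _ I Q _ _ V _ _ V _ 𝓘(ℝ, V) S _ (quotientChartedSpace I V π h) ∞ π := by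
  let _ := quotientChartedSpace I V π h
  intro x
  rw [contMDiffAt_iff_target]
  refine ⟨hπ.continuousAt, ?_⟩
  have he : IsQuotientChart I π (chartAt V (π x)) := chart_mem_atlas V (π x)
  have := he.smooth.contMDiffAt (((chartAt V (π x)).open_source.preimage hπ).mem_nhds
    (mem_chart_source V (π x)))
  exact this

theorem exists_quotient_section (z : S) :
    ∃ σ : S → Q, (∀ᶠ w in 𝓝 z, @ContMDiffAt ℝ _ V _ _ V _ 𝓘(ℝ, V) S _
      (quotientChartedSpace I V π h) E _ _ H _ I Q _ _ ∞ σ w) ∧ ∀ᶠ w in 𝓝 z, π (σ w) = w := by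
  let _ := quotientChartedSpace I V π h
  have := isManifold_quotient h
  have he : IsQuotientChart I π (chartAt V z) := chart_mem_atlas V z
  obtain ⟨σ, hσ, hπ⟩ := he.exists_lift
  have hs := (chartAt V z).open_source.mem_nhds (mem_chart_source V z)
  refine ⟨fun w => σ (chartAt V z w), ?_, ?_⟩
  · filter_upwards [hs] with w hw
    have h1 : ContMDiffAt 𝓘(ℝ, V) 𝓘(ℝ, V) ∞ (chartAt V z) w :=
      contMDiffAt_of_mem_maximalAtlas (IsManifold.chart_mem_maximalAtlas z) hw
    have h2 : ContMDiffAt 𝓘(ℝ, V) I ∞ σ (chartAt V z w) :=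
      hσ.contMDiffAt ((chartAt V z).open_target.mem_nhds ((chartAt V z).map_source hw))
    exact h2.comp w h1
  · filter_upwards [hs] with w hw
    rw [hπ _ ((chartAt V z).map_source hw), (chartAt V z).left_inv hw]

end QuotientAtlas

/-! ### Slices transverse to a flow -/

section FlowBox

variable {E : Type*} [NormedAddCommGroup E] [NormedSpace ℝ E] [FiniteDimensional ℝ E]
  {H : Type*} [TopologicalSpace H] {I : ModelWithCorners ℝ E H} [I.Boundaryless]
  {E' : Type*} [NormedAddCommGroup E'] [NormedSpace ℝ E'] [FiniteDimensional ℝ E']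
  {H' : Type*} [TopologicalSpace H'] {J : ModelWithCorners ℝ E' H'} [J.Boundaryless]
  {M : Type*} [TopologicalSpace M] [ChartedSpace H M] [IsManifold I ∞ M]
  {N : Type*} [TopologicalSpace N] [ChartedSpace H' N] [IsManifold J ∞ N]

variable (I E') in
/-- Through every point passes a slice, parametrized by an open subset of `E'`, meeting each orbit
at most once and such that the flow gives local coordinates along its saturation. -/
structure IsSlice (φ : Flow ℝ M) (U : Set E') (s : E' → M) : Prop where
  isOpen : IsOpen U
  smooth : ContMDiffOn 𝓘(ℝ, E') I ∞ s U
  eq_of_flow : ∀ u ∈ U, ∀ u' ∈ U, ∀ t, φ t (s u) = s u' → u = u'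
  localDiffeo : ∀ u ∈ U, ∀ t : ℝ,
    IsLocalDiffeomorphAt 𝓘(ℝ, E' × ℝ) I ∞ (fun q : E' × ℝ => φ q.2 (s q.1)) (u, t)

/-- The slice is a local section of `p` read in a chart of the base. As `p` is constant on orbits
and injective on the slice, no orbit meets it twice. For `B (u, t) = φ t (s u)`, composing with `p`
shows that a vector in the kernel of the differential has no `u`-component; its time component then
vanishes because `∂ₜ` goes to `R ≠ 0`. Equality of dimensions turns injectivity into bijectivity. -/
theorem exists_isSlice {φ : Flow ℝ M} {R : VField I M} (hφ : IsFlowOf φ R) (hR : ∀ x, R x ≠ 0)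
    (hs : ContMDiff (𝓘(ℝ, ℝ).prod I) I ∞ (fun q : ℝ × M => φ q.1 q.2)) {p : M → N}
    (hp : Manifold.IsSubmersion I J ∞ p) (hpφ : ∀ t x, p (φ t x) = p x)
    (hdim : Module.finrank ℝ E = Module.finrank ℝ E' + 1) (a : M) :
    ∃ (U : Set E') (s : E' → M), IsSlice I E' φ U s ∧ ∃ u ∈ U, s u = a := by
  have := isManifold_one_of_infty (I := I) (M := M)
  have := isManifold_one_of_infty (I := J) (M := N)
  obtain ⟨σ, hσ, hσa, hpσ⟩ := (hp.isSubmersionAt a).exists_section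
  obtain ⟨O, hO, hOo, haO⟩ := eventually_nhds_iff.1 (hσ.and hpσ)
  set e := extChartAt J (p a)
  let U : Set E' := e.target ∩ e.symm ⁻¹' O
  have hU : IsOpen U := (continuousOn_extChartAt_symm (p a)).isOpen_inter_preimage
    (isOpen_extChartAt_target (p a)) hOo
  let s : E' → M := fun u => σ (e.symm u)
  have hsU : ∀ u ∈ U, ContMDiffAt 𝓘(ℝ, E') I ∞ s u := fun u hu =>
    (hO _ hu.2).1.comp u (contMDiffAt_extChartAt_symm_of_mem hu.1)
  have hps : ∀ u ∈ U, p (s u) = e.symm u := fun u hu => (hO _ hu.2).2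
  refine ⟨U, s, ⟨hU, fun u hu => (hsU u hu).contMDiffWithinAt, ?_, ?_⟩, e (p a), ?_, ?_⟩
  · intro u hu u' hu' t ht
    have h1 := congrArg p ht
    rw [hpφ, hps u hu, hps u' hu'] at h1
    exact e.symm.injOn hu.1 hu'.1 h1
  · intro u hu t
    set B : E' × ℝ → M := fun q => φ q.2 (s q.1) with hB
    have hBs : ∀ q : E' × ℝ, q.1 ∈ U → ContMDiffAt 𝓘(ℝ, E' × ℝ) I ∞ B q := fun q hq => by
      have h1 : ContMDiffAt 𝓘(ℝ, E' × ℝ) (𝓘(ℝ, ℝ).prod I) ∞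
          (fun q : E' × ℝ => (q.2, s q.1)) q :=
        contDiff_snd.contMDiff.contMDiffAt.prodMk
          ((hsU q.1 hq).comp q contDiff_fst.contMDiff.contMDiffAt)
      exact (hs _).comp q h1
    have hBe : ∀ᶠ q in 𝓝 (u, t), ContMDiffAt 𝓘(ℝ, E' × ℝ) I ∞ B q := by
      filter_upwards [(continuous_fst.tendsto (u, t)).eventually (hU.mem_nhds hu)] with q hq
      exact hBs q hq
    refine isLocalDiffeomorphAt_of_bijective_mfderiv hBe ?_
    have hBd : MDifferentiableAt 𝓘(ℝ, E' × ℝ) I B (u, t) :=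
      (hBs (u, t) hu).mdifferentiableAt (by simp)
    let D : E' × ℝ →L[ℝ] E := mfderiv 𝓘(ℝ, E' × ℝ) I B (u, t)
    have hinj : Function.Injective D := by
      rw [injective_iff_map_eq_zero]
      intro v hv
      have hpB : MDifferentiableAt I J p (B (u, t)) := (hp.contMDiff _).mdifferentiableAt (by simp)
      have hesymm : MDifferentiableAt 𝓘(ℝ, E') J e.symm u :=
        mdifferentiableAt_extChartAt_symm hu.1
      have c1 := HasMFDerivAt.comp (u, t) hpB.hasMFDerivAt hBd.hasMFDerivAt
      have c2 := HasMFDerivAt.comp (I' := 𝓘(ℝ, E')) (f := (Prod.fst : E' × ℝ → E')) (u, t)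
        hesymm.hasMFDerivAt (ContinuousLinearMap.fst ℝ E' ℝ).hasMFDerivAt
      have hev : p ∘ B =ᶠ[𝓝 (u, t)] e.symm ∘ (Prod.fst : E' × ℝ → E') := by
        filter_upwards [(continuous_fst.tendsto (u, t)).eventually (hU.mem_nhds hu)] with q hq
        simp only [Function.comp, hB, hpφ, hps q.1 hq]
      have c3 := hasMFDerivAt_unique (c1.congr_of_eventuallyEq hev.symm) c2
      have c4 := congrArg (fun T : E' × ℝ →L[ℝ] E' => T v) c3
      have h0 : (mfderiv 𝓘(ℝ, E') J e.symm u : E' →L[ℝ] E') v.1 = 0 := by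
        refine c4.symm.trans ?_
        let P : E →L[ℝ] E' := mfderiv I J p (B (u, t))
        exact (congrArg P hv).trans (map_zero P)
      have hloc : IsLocalDiffeomorphAt 𝓘(ℝ, E') J ∞ e.symm u :=
        ⟨(extChartDiffeo J (p a)).symm, hu.1, fun _ _ => rfl⟩
      have hv1 : v.1 = 0 := hloc.bijective_mfderiv.injective (h0.trans (map_zero _).symm)
      have c5 := HasMFDerivAt.comp (I' := 𝓘(ℝ, E' × ℝ)) (f := fun r : ℝ => ((u, r) : E' × ℝ)) t
        hBd.hasMFDerivAt (hasFDerivAt_prodMk_right (𝕜 := ℝ) u t).hasMFDerivAt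
      have c6 := hasMFDerivAt_unique c5 (hφ (s u) t)
      have c7 := congrArg (fun T : ℝ →L[ℝ] E => T v.2) c6
      have hv' : v = ((0, v.2) : E' × ℝ) := Prod.ext hv1 rfl
      have c8 : v.2 • (R (B (u, t)) : E) = 0 := by
        refine Eq.trans (Eq.trans ?_ c7.symm) ?_
        · rfl
        · change D ((0, v.2) : E' × ℝ) = 0
          rw [← hv', hv]
      have hv2 : v.2 = 0 := (smul_eq_zero.1 c8).resolve_right (hR (B (u, t)))
      exact Prod.ext hv1 hv2
    have hfin : Module.finrank ℝ (E' × ℝ) = Module.finrank ℝ E := by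
      rw [Module.finrank_prod, Module.finrank_self, hdim]
    exact ⟨hinj, (LinearMap.injective_iff_surjective_of_finrank_eq_finrank
      (f := D.toLinearMap) hfin).1 hinj⟩
  · refine ⟨mem_extChartAt_target (p a), ?_⟩
    show e.symm (e (p a)) ∈ O
    rw [extChartAt_to_inv]; exact haO
  · show σ (e.symm (e (p a))) = a
    rw [extChartAt_to_inv, hσa]

end FlowBox

/-- The factor `2` is there because two times in `(-ε, ε)` differ by less than `2ε`: if their
difference is a period, they coincide. -/
theorem exists_pos_forall_mem_zmultiples_eq_zero {r : ℝ} (hr : 0 ≤ r) :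
    ∃ ε > 0, ∀ t ∈ AddSubgroup.zmultiples r, |t| < 2 * ε → t = 0 := by
  rcases hr.eq_or_lt with rfl | hr
  · refine ⟨1, one_pos, fun t ht _ => ?_⟩
    simpa [AddSubgroup.zmultiples_zero_eq_bot] using ht
  · refine ⟨r / 2, by positivity, fun t ht h => ?_⟩
    obtain ⟨m, rfl⟩ := AddSubgroup.mem_zmultiples_iff.1 ht
    rw [zsmul_eq_mul, abs_mul, abs_of_pos hr, mul_div_cancel₀ _ two_ne_zero] at h
    have h1 : |(m : ℝ)| < 1 := by
      by_contra hc
      nlinarith [not_lt.1 hc]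
    have h2 : |m| < 1 := by exact_mod_cast h1
    simp [Int.abs_lt_one_iff.1 h2]

/-! ### Charts on the orbit space of the antidiagonal flow -/

section QuotientChart

variable {E₁ : Type*} [NormedAddCommGroup E₁] [NormedSpace ℝ E₁] [FiniteDimensional ℝ E₁]
  {H₁ : Type*} [TopologicalSpace H₁] {I₁ : ModelWithCorners ℝ E₁ H₁} [I₁.Boundaryless]
  {E₁' : Type*} [NormedAddCommGroup E₁'] [NormedSpace ℝ E₁'] [FiniteDimensional ℝ E₁']
  {M₁ : Type*} [TopologicalSpace M₁] [ChartedSpace H₁ M₁] [IsManifold I₁ ∞ M₁]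
  {E₂ : Type*} [NormedAddCommGroup E₂] [NormedSpace ℝ E₂] [FiniteDimensional ℝ E₂]
  {H₂ : Type*} [TopologicalSpace H₂] {I₂ : ModelWithCorners ℝ E₂ H₂} [I₂.Boundaryless]
  {E₂' : Type*} [NormedAddCommGroup E₂'] [NormedSpace ℝ E₂'] [FiniteDimensional ℝ E₂']
  {M₂ : Type*} [TopologicalSpace M₂] [ChartedSpace H₂ M₂] [IsManifold I₂ ∞ M₂]

theorem map_nhds_eq_of_isLocalDiffeomorphAt {f : M₁ → M₂} {x : M₁}
    (h : IsLocalDiffeomorphAt I₁ I₂ ∞ f x) : map f (𝓝 x) = 𝓝 (f x) := by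
  obtain ⟨Φ, hx, hΦ⟩ := h
  have h1 : f =ᶠ[𝓝 x] Φ := Filter.eventuallyEq_of_mem (Φ.open_source.mem_nhds hx) hΦ
  rw [map_congr h1, h1.self_of_nhds]
  exact Φ.toOpenPartialHomeomorph.map_nhds_eq hx

/-- The inverse chart sends `(u₁, u₂, T)` to the class of `(φ₁ T (s₁ u₁), s₂ u₂)`: two slice
parameters and a total time, all of which may be spent in the first factor. It is injective on a
short time window because slices separate orbits and an ambiguity in `T` is a period of the residual
flow. Openness, and smoothness of the chart upstairs, follow since in flow boxes the projection just
adds the two times. -/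
theorem exists_isQuotientChart {φ₁ : Flow ℝ M₁} {φ₂ : Flow ℝ M₂}
    (hs₁ : ContMDiff (𝓘(ℝ, ℝ).prod I₁) I₁ ∞ (fun q : ℝ × M₁ => φ₁ q.1 q.2))
    {r : ℝ} (hr : 0 ≤ r)
    (hfree : ∀ t z, quotientFlow φ₁ φ₂ t z = z → t ∈ AddSubgroup.zmultiples r)
    {U₁ : Set E₁'} {s₁ : E₁' → M₁} (hS₁ : IsSlice I₁ E₁' φ₁ U₁ s₁) {u₁ : E₁'} (hu₁ : u₁ ∈ U₁)
    {U₂ : Set E₂'} {s₂ : E₂' → M₂} (hS₂ : IsSlice I₂ E₂' φ₂ U₂ s₂) {u₂ : E₂'} (hu₂ : u₂ ∈ U₂) :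
    ∃ e : OpenPartialHomeomorph (OrbitSpace (antidiagonalFlow φ₁ φ₂)) (E₁' × E₂' × ℝ),
      IsQuotientChart (I₁.prod I₂) (orbitProj (antidiagonalFlow φ₁ φ₂)) e ∧
      orbitProj (antidiagonalFlow φ₁ φ₂) (s₁ u₁, s₂ u₂) ∈ e.source := by
  obtain ⟨ε, hε, hεr⟩ := exists_pos_forall_mem_zmultiples_eq_zero hr
  set π := orbitProj (antidiagonalFlow φ₁ φ₂) with hπ
  have hπo : IsOpenQuotientMap π := isOpenQuotientMap_orbitProj _
  let W : Set (E₁' × E₂' × ℝ) := U₁ ×ˢ U₂ ×ˢ Ioo (-ε) ε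
  have hW : IsOpen W := hS₁.isOpen.prod (hS₂.isOpen.prod isOpen_Ioo)
  let σ : E₁' × E₂' × ℝ → M₁ × M₂ := fun w => (φ₁ w.2.2 (s₁ w.1), s₂ w.2.1)
  have hσ : ContMDiffOn 𝓘(ℝ, E₁' × E₂' × ℝ) (I₁.prod I₂) ∞ σ W := by
    intro w hw
    have h1 : ContMDiffAt 𝓘(ℝ, E₁' × E₂' × ℝ) (𝓘(ℝ, ℝ).prod I₁) ∞
        (fun w : E₁' × E₂' × ℝ => (w.2.2, s₁ w.1)) w :=
      (contDiff_snd.comp contDiff_snd).contMDiff.contMDiffAt.prodMk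
        ((hS₁.smooth.contMDiffAt (hS₁.isOpen.mem_nhds hw.1)).comp w
          contDiff_fst.contMDiff.contMDiffAt)
    have h2 : ContMDiffAt 𝓘(ℝ, E₁' × E₂' × ℝ) I₂ ∞ (fun w : E₁' × E₂' × ℝ => s₂ w.2.1) w :=
      ContMDiffAt.comp w (g := s₂) (I' := 𝓘(ℝ, E₂'))
        (hS₂.smooth.contMDiffAt (hS₂.isOpen.mem_nhds hw.2.1))
        (contDiff_fst.comp contDiff_snd).contMDiff.contMDiffAt
    exact (((hs₁ _).comp w h1).prodMk h2).contMDiffWithinAt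
  let F : E₁' × E₂' × ℝ → OrbitSpace (antidiagonalFlow φ₁ φ₂) := fun w => π (σ w)
  have hFc : ContinuousOn F W := hπo.continuous.comp_continuousOn hσ.continuousOn
  have hinj : InjOn F W := by
    rintro ⟨v₁, v₂, T⟩ ⟨hv₁, hv₂, hT⟩ ⟨v₁', v₂', T'⟩ ⟨hv₁', hv₂', hT'⟩ h
    obtain ⟨t, ht₁, ht₂⟩ := (antidiagonal_proj_eq_iff φ₁ φ₂).1 h
    simp only [σ] at ht₁ ht₂
    have ht₁' : φ₁ (t + T - T') (s₁ v₁) = s₁ v₁' := by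
      have := congrArg (φ₁ (-T')) ht₁
      rw [← φ₁.map_add, ← φ₁.map_add, ← φ₁.map_add, neg_add_cancel, φ₁.map_zero_apply] at this
      rw [← this]; congr 1; ring
    have e₁ := hS₁.eq_of_flow v₁ hv₁ v₁' hv₁' _ ht₁'
    have e₂ := hS₂.eq_of_flow v₂ hv₂ v₂' hv₂' _ ht₂
    subst e₁ e₂
    -- The times `t + T - T'` and `-t` fix the two slice points, and their sum `T - T'` no longer
    -- involves the unknown `t`.
    have h1 := hfree (T - T') (π (s₁ v₁, s₂ v₂)) ((quotientFlow_proj_eq_iff φ₁ φ₂).2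
      ⟨t + T - T', -t, by ring, ht₁', ht₂⟩)
    have h2 := hεr _ h1 (by
      have hT := mem_Ioo.1 hT; have hT' := mem_Ioo.1 hT'
      simp only at hT hT'
      rw [abs_lt]; constructor <;> linarith)
    rw [sub_eq_zero.1 h2]
  let B₁ : E₁' × ℝ → M₁ := fun q => φ₁ q.2 (s₁ q.1)
  let B₂ : E₂' × ℝ → M₂ := fun q => φ₂ q.2 (s₂ q.1)
  let add : (E₁' × ℝ) × (E₂' × ℝ) → E₁' × E₂' × ℝ := fun q => (q.1.1, q.2.1, q.1.2 + q.2.2)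
  have hadd : ContDiff ℝ ∞ add := (contDiff_fst.comp contDiff_fst).prodMk
    ((contDiff_fst.comp contDiff_snd).prodMk
      ((contDiff_snd.comp contDiff_fst).add (contDiff_snd.comp contDiff_snd)))
  have hFadd : ∀ q, π (B₁ q.1, B₂ q.2) = F (add q) := fun q => by
    refine (antidiagonal_proj_eq_iff φ₁ φ₂).2 ⟨q.2.2, ?_, ?_⟩
    · show φ₁ q.2.2 (φ₁ q.1.2 (s₁ q.1.1)) = φ₁ (q.1.2 + q.2.2) (s₁ q.1.1)
      rw [← φ₁.map_add, add_comm]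
    · show φ₂ (-q.2.2) (φ₂ q.2.2 (s₂ q.2.1)) = s₂ q.2.1
      rw [← φ₂.map_add, neg_add_cancel, φ₂.map_zero_apply]
  have hopen : IsOpenMap (W.domRestrict F) := by
    refine IsOpenMap.of_nhds_le fun w => ?_
    obtain ⟨⟨v₁, v₂, T⟩, hw⟩ := w
    have h1 : map (W.domRestrict F) (𝓝 ⟨(v₁, v₂, T), hw⟩) = map F (𝓝 (v₁, v₂, T)) := by
      rw [← map_nhds_subtype_coe_eq_nhds hw (hW.mem_nhds hw), map_map]
      rfl
    rw [h1]
    -- The flow boxes cover a full neighbourhood upstairs and `π` is open; since `π ∘ (B₁ × B₂) = F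
    -- ∘ add`, continuity of `add` bounds the neighbourhood filter by the image under `F`.
    have hB : map (Prod.map B₁ B₂) (𝓝 ((v₁, T), (v₂, 0))) = 𝓝 (B₁ (v₁, T), B₂ (v₂, 0)) := by
      rw [nhds_prod_eq, ← prod_map_map_eq',
        map_nhds_eq_of_isLocalDiffeomorphAt (hS₁.localDiffeo v₁ hw.1 T),
        map_nhds_eq_of_isLocalDiffeomorphAt (hS₂.localDiffeo v₂ hw.2.1 0), nhds_prod_eq]
    have hFv : (W.domRestrict F ⟨(v₁, v₂, T), hw⟩) = π (B₁ (v₁, T), B₂ (v₂, 0)) := by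
      rw [hFadd ((v₁, T), (v₂, 0))]
      simp [add]
    rw [hFv]
    refine (hπo.isOpenMap.nhds_le _).trans ?_
    rw [← hB, map_map]
    have h2 : π ∘ Prod.map B₁ B₂ = F ∘ add := funext hFadd
    rw [h2, ← map_map]
    refine map_mono ?_
    have h3 := hadd.continuous.tendsto ((v₁, T), (v₂, (0 : ℝ)))
    have h4 : add ((v₁, T), (v₂, 0)) = (v₁, v₂, T) := by simp [add]
    rw [h4] at h3
    exact h3
  have : Nonempty (E₁' × E₂' × ℝ) := ⟨0⟩
  let f : OpenPartialHomeomorph (E₁' × E₂' × ℝ) (OrbitSpace (antidiagonalFlow φ₁ φ₂)) :=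
    OpenPartialHomeomorph.ofContinuousOpenRestrict (hinj.toPartialEquiv F W) hFc hopen hW
  have hfF : ∀ w, f w = F w := fun w => rfl
  have hfs : f.source = W := rfl
  refine ⟨f.symm, ⟨?_, σ, hσ, fun v hv => rfl⟩, ?_⟩
  · intro x hx
    refine ContMDiffAt.contMDiffWithinAt ?_
    have hw : f.symm (π x) ∈ W := f.map_target hx
    set w := f.symm (π x) with hwdef
    have hFw : F w = π x := f.right_inv hx
    -- The point `x` may lie far from the slices along its orbit. Its box times are `t + w.2.2` and
    -- `-t`, whose sum is again `w.2.2`; hence boxes around arbitrary times are needed.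
    obtain ⟨t, ht₁, ht₂⟩ := (antidiagonal_proj_eq_iff φ₁ φ₂).1 hFw
    have hx₁ : B₁ (w.1, t + w.2.2) = x.1 := by
      rw [← ht₁]; exact φ₁.map_add _ _ _
    have hx₂ : B₂ (w.2.1, -t) = x.2 := ht₂
    have hl₁ := hS₁.localDiffeo w.1 hw.1 (t + w.2.2)
    have hl₂ := hS₂.localDiffeo w.2.1 hw.2.1 (-t)
    let b₁ := hl₁.localInverse
    let b₂ := hl₂.localInverse
    have hb₁ : ContMDiffAt I₁ 𝓘(ℝ, E₁' × ℝ) ∞ b₁ x.1 := by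
      rw [← hx₁]; exact hl₁.localInverse_contMDiffAt
    have hb₂ : ContMDiffAt I₂ 𝓘(ℝ, E₂' × ℝ) ∞ b₂ x.2 := by
      rw [← hx₂]; exact hl₂.localInverse_contMDiffAt
    have hr₁ : ∀ᶠ y in 𝓝 x.1, B₁ (b₁ y) = y := by
      rw [← hx₁]; exact hl₁.localInverse_eventuallyEq_right
    have hr₂ : ∀ᶠ y in 𝓝 x.2, B₂ (b₂ y) = y := by
      rw [← hx₂]; exact hl₂.localInverse_eventuallyEq_right
    have hbx₁ : b₁ x.1 = (w.1, t + w.2.2) := by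
      rw [← hx₁]; exact hl₁.localInverse_left_inv hl₁.localInverse_mem_target
    have hbx₂ : b₂ x.2 = (w.2.1, -t) := by
      rw [← hx₂]; exact hl₂.localInverse_left_inv hl₂.localInverse_mem_target
    have hG : ContMDiffAt (I₁.prod I₂) 𝓘(ℝ, E₁' × E₂' × ℝ) ∞
        (fun y : M₁ × M₂ => add (b₁ y.1, b₂ y.2)) x :=
      hadd.contMDiff.contMDiffAt.comp x
        ((hb₁.comp x contMDiffAt_fst).prodMk_space (hb₂.comp x contMDiffAt_snd))
    have hGx : add (b₁ x.1, b₂ x.2) = w := by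
      rw [hbx₁, hbx₂]
      simp [add]
    refine hG.congr_of_eventuallyEq ?_
    filter_upwards [(continuous_fst.tendsto x).eventually hr₁,
      (continuous_snd.tendsto x).eventually hr₂,
      hG.continuousAt.eventually (hW.mem_nhds (show add (b₁ x.1, b₂ x.2) ∈ W by rwa [hGx]))]
      with y hy₁ hy₂ hy
    have h1 : π y = F (add (b₁ y.1, b₂ y.2)) := by
      rw [← hFadd (b₁ y.1, b₂ y.2)]
      simp only [hy₁, hy₂]
    rw [h1]
    exact f.left_inv hy
  · have h1 : F (u₁, u₂, 0) = π (s₁ u₁, s₂ u₂) := by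
      show π (φ₁ 0 (s₁ u₁), s₂ u₂) = _
      rw [φ₁.map_zero_apply]
    rw [← h1]
    exact f.map_source (show (u₁, u₂, (0 : ℝ)) ∈ W from ⟨hu₁, hu₂, by simp [hε]⟩)

end QuotientChart

/-! ### Descent of forms along a submersion and the contact condition -/

section Descent

variable {E : Type*} [NormedAddCommGroup E] [NormedSpace ℝ E] [FiniteDimensional ℝ E]
  {H : Type*} [TopologicalSpace H] {I : ModelWithCorners ℝ E H} [I.Boundaryless]
  {E' : Type*} [NormedAddCommGroup E'] [NormedSpace ℝ E'] [FiniteDimensional ℝ E']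
  {H' : Type*} [TopologicalSpace H'] {J : ModelWithCorners ℝ E' H'} [J.Boundaryless]
  {M : Type*} [TopologicalSpace M] [ChartedSpace H M] [IsManifold I ∞ M]
  {N : Type*} [TopologicalSpace N] [ChartedSpace H' N] [IsManifold J ∞ N] {k : ℕ}

theorem exists_eq_smul_of_apply_eq_zero {L : E →L[ℝ] E'} (hL : Function.Surjective L)
    (hdim : Module.finrank ℝ E = Module.finrank ℝ E' + 1) {X v : E} (hX : X ≠ 0) (hLX : L X = 0)
    (hv : L v = 0) : ∃ a : ℝ, v = a • X := by
  have h1 := LinearMap.finrank_range_add_finrank_ker L.toLinearMap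
  have h2 : LinearMap.range L.toLinearMap = ⊤ := LinearMap.range_eq_top.2 hL
  rw [h2, finrank_top, hdim] at h1
  have h3 : Module.finrank ℝ (LinearMap.ker L.toLinearMap) = 1 := by omega
  let X' : LinearMap.ker L.toLinearMap := ⟨X, hLX⟩
  have hX' : X' ≠ 0 := fun h => hX (congrArg Subtype.val h)
  obtain ⟨a, ha⟩ := (finrank_eq_one_iff_of_nonzero' X' hX').1 h3 ⟨v, hv⟩
  exact ⟨a, (congrArg Subtype.val ha).symm⟩

theorem mfderiv_flow_eq_zero {φ : Flow ℝ M} {X : VField I M} (hφ : IsFlowOf φ X) {f : M → N}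
    (hf : MDifferentiable I J f) (hfφ : ∀ t x, f (φ t x) = f x) (x : M) :
    (mfderiv I J f x (X x) : E') = 0 := by
  have h1 := HasMFDerivAt.comp (0 : ℝ) (hf (φ 0 x)).hasMFDerivAt (hφ x 0)
  have h2 : f ∘ (fun t => φ t x) = fun _ => f x := funext fun t => hfφ t x
  rw [h2] at h1
  have h3 := hasMFDerivAt_unique h1 (hasMFDerivAt_const (f x) 0)
  have h4 := congrArg (fun L : ℝ →L[ℝ] E' => L 1) h3
  -- The derivative was taken at `φ 0 x`; as a function into the fixed space `E'`, `F` allows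
  -- rewriting this point to `x`.
  let F : M → E' := fun y => mfderiv I J f y (X y)
  have h5 : F (φ 0 x) = 0 := by
    refine Eq.trans ?_ h4
    change (mfderiv I J f (φ 0 x) : E →L[ℝ] E') (X (φ 0 x)) =
      (mfderiv I J f (φ 0 x) : E →L[ℝ] E') ((1 : ℝ) • (X (φ 0 x) : E))
    rw [one_smul]
  rw [φ.map_zero_apply] at h5
  exact h5

theorem exists_eq_smul_of_mfderiv_eq_zero {φ : Flow ℝ M} {X : VField I M} (hφ : IsFlowOf φ X)
    {f : M → N} (hf : Manifold.IsSubmersion I J ∞ f) (hfφ : ∀ t x, f (φ t x) = f x)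
    (hdim : Module.finrank ℝ E = Module.finrank ℝ E' + 1) {x : M} (hX : X x ≠ 0)
    {v : TangentSpace I x} (hv : mfderiv I J f x v = 0) : ∃ a : ℝ, v = a • X x :=
  exists_eq_smul_of_apply_eq_zero (E := E) (E' := E') (hf.isSubmersionAt x).surjective_mfderiv hdim
    hX (mfderiv_flow_eq_zero hφ (hf.contMDiff.mdifferentiable (by simp)) hfφ x) hv

theorem pullback_injective {f : M → N} (hf : Function.Surjective f)
    (hf' : ∀ x, Function.Surjective (mfderiv I J f x)) {σ τ : DForm J N k}
    (h : (pullback f σ : DForm I M k) = pullback f τ) : σ = τ := by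
  funext y
  obtain ⟨x, rfl⟩ := hf y
  ext v
  choose w hw using fun i => hf' x (v i)
  have h1 := congrArg (fun α : E [⋀^Fin k]→L[ℝ] ℝ => α w) (congrFun h x)
  have hv : v = fun i => mfderiv I J f x (w i) := funext fun i => (hw i).symm
  rw [hv]
  exact h1

/-- A form is smooth if its pullback under a surjective submersion is. -/
theorem isSmoothForm_of_pullback {f : M → N} (hf : Manifold.IsSubmersion I J ∞ f)
    (hs : Function.Surjective f) {σ : DForm J N k}
    (h : IsSmoothForm (pullback f σ : DForm I M k)) : IsSmoothForm σ := by
  intro y₀ y hy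
  set e := extChartAt J y₀
  obtain ⟨x, hx⟩ := hs (e.symm y)
  obtain ⟨s, hs, -, hfs⟩ := (hf.isSubmersionAt x).exists_section
  rw [hx] at hs hfs
  have h1 := h.contDiffAt_coordRep_pullback (x₀ := y₀) hy hs
  refine (h1.congr_of_eventuallyEq ?_).contDiffWithinAt
  have hc : Tendsto e.symm (𝓝 y) (𝓝 (e.symm y)) := continuousAt_extChartAt_symm'' hy
  refine coordRep_congr hy ?_
  filter_upwards [hs, hfs.eventually_nhds] with z hz1 hz2
  exact eq_pullback_section (hz1.mdifferentiableAt (by simp))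
    ((hf.contMDiff _).mdifferentiableAt (by simp)) hz2

theorem exists_clm_eq_oneForm (α : E [⋀^Fin 1]→L[ℝ] ℝ) : ∃ l : E →L[ℝ] ℝ, ∀ v, α ![v] = l v := by
  refine ⟨(ContinuousAlternatingMap.ofSubsingleton ℝ E ℝ (0 : Fin 1)).symm α, fun v => ?_⟩
  refine congrArg α ?_
  ext i
  fin_cases i
  rfl

/-- A one-form invariant under a flow and annihilating its generator descends to the orbit space. -/
theorem exists_pullback_eq {ψ : Flow ℝ M} {X : VField I M} (hψ : IsFlowOf ψ X)
    (hψd : ∀ t, MDifferentiable I I (ψ t)) {f : M → N} (hf : Manifold.IsSubmersion I J ∞ f)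
    (hs : Function.Surjective f) (hfψ : ∀ x y, f x = f y ↔ ∃ t, ψ t x = y)
    (hdim : Module.finrank ℝ E = Module.finrank ℝ E' + 1) (hX : ∀ x, X x ≠ 0)
    {θ : DForm I M 1} (hθ : ∀ t, pullback (ψ t) θ = θ) (hθX : ∀ x, θ x ![X x] = 0) :
    ∃ η : DForm J N 1, pullback f η = θ := by
  have hfψ' : ∀ t x, f (ψ t x) = f x := fun t x => ((hfψ _ _).2 ⟨t, rfl⟩).symm
  have hfd := hf.contMDiff.mdifferentiable (by simp : (∞ : WithTop ℕ∞) ≠ 0)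
  have hsurj : ∀ x, Function.Surjective (mfderiv I J f x) := fun x =>
    (hf.isSubmersionAt x).surjective_mfderiv
  choose l hl using fun x => exists_clm_eq_oneForm (E := E) (θ x)
  -- The kernel of the differential is the line spanned by `X`, on which `θ` vanishes.
  have hker : ∀ (x : M) (v : E), (mfderiv I J f x : E →L[ℝ] E') v = 0 → l x v = 0 := by
    intro x v hv
    obtain ⟨a, rfl⟩ := exists_eq_smul_of_mfderiv_eq_zero hψ hf hfψ' hdim (hX x) hv
    refine ((l x).map_smul a (X x)).trans ?_
    rw [← hl x (X x)]
    erw [hθX x, smul_zero]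
  -- The value of `θ` depends only on the projected vector: the flow transports `v` to the fibre
  -- point `x'` without changing `θ`, and the remaining difference is vertical.
  have key : ∀ x x', f x = f x' → ∀ v v' : E, (mfderiv I J f x : E →L[ℝ] E') v =
      (mfderiv I J f x' : E →L[ℝ] E') v' → l x v = l x' v' := by
    intro x x' h v v' hv
    obtain ⟨t, rfl⟩ := (hfψ x x').1 h
    have h1 : l (ψ t x) ((mfderiv I I (ψ t) x : E →L[ℝ] E) v) = l x v := by
      have h2 := congrArg (fun α : E [⋀^Fin 1]→L[ℝ] ℝ => α ![v]) (congrFun (hθ t) x)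
      refine ((hl _ _).symm.trans ?_).trans (h2.trans (hl _ _))
      refine congrArg (θ (ψ t x)) ?_
      ext i
      fin_cases i
      rfl
    have h3 : (mfderiv I J f (ψ t x) : E →L[ℝ] E') ((mfderiv I I (ψ t) x : E →L[ℝ] E) v) =
        (mfderiv I J f x : E →L[ℝ] E') v := by
      have h4 := mfderiv_comp x (hfd (ψ t x)) (hψd t x)
      rw [show f ∘ ψ t = f from funext (hfψ' t)] at h4
      exact (congrArg (fun T : E →L[ℝ] E' => T v) h4).symm
    have h5 : ∀ w : E, (mfderiv I J f (ψ t x) : E →L[ℝ] E') w =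
        (mfderiv I J f (ψ t x) : E →L[ℝ] E') v' → l (ψ t x) w = l (ψ t x) v' := fun w hw => by
      have h6 := hker (ψ t x) (w - v') ((ContinuousLinearMap.map_sub
        (mfderiv I J f (ψ t x) : E →L[ℝ] E') w v').trans (sub_eq_zero.2 hw))
      rwa [map_sub, sub_eq_zero] at h6
    exact h1.symm.trans (h5 _ (h3.trans hv))
  -- By `key`, arbitrary choices of fibre points and linear lifts are harmless. Smoothness is not at
  -- stake here; it follows separately from `isSmoothForm_of_pullback`.
  choose x hx using hs
  have hinv : ∀ x : M, ∃ L : E' →L[ℝ] E, ∀ u, (mfderiv I J f x : E →L[ℝ] E') (L u) = u := by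
    intro x
    let D : E →L[ℝ] E' := mfderiv I J f x
    obtain ⟨L, hL⟩ := D.toLinearMap.exists_rightInverse_of_surjective
      (LinearMap.range_eq_top.2 (hsurj x))
    exact ⟨L.toContinuousLinearMap, fun u => congrArg (fun T : E' →ₗ[ℝ] E' => T u) hL⟩
  choose L hL using hinv
  let η : N → E' [⋀^Fin 1]→L[ℝ] ℝ := fun z =>
    ContinuousAlternatingMap.ofSubsingleton ℝ E' ℝ (0 : Fin 1)
      ((l (x z)).comp (L (x z)))
  refine ⟨η, ?_⟩
  funext y
  ext v
  have hv : v = ![v 0] := by ext i; fin_cases i; rfl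
  rw [hv]
  refine Eq.trans ?_ (hl y (v 0)).symm
  refine key (x (f y)) y (hx (f y)) _ (v 0) ?_
  exact hL (x (f y)) _

theorem twoForm_swap (α : E [⋀^Fin 2]→L[ℝ] ℝ) (v w : E) : α ![v, w] = -α ![w, v] := by
  refine Eq.trans (congrArg α ?_)
    (α.toAlternatingMap.map_swap ![w, v] (zero_ne_one (α := Fin 2)))
  ext i
  fin_cases i <;> rfl

/-- A two-form vanishes on `v` once it vanishes on `v` paired with a line and a complement. -/
theorem twoForm_eq_zero_of_ker (α : E [⋀^Fin 2]→L[ℝ] ℝ) (l : E →L[ℝ] ℝ) {R v : E} (hR : l R = 1)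
    (hαR : α ![R, v] = 0) (h : ∀ w, l w = 0 → α ![v, w] = 0) (w : E) : α ![v, w] = 0 := by
  have h1 : α ![v, w - l w • R] = 0 := h _ (by simp [hR])
  rw [twoForm_swap, neg_eq_zero] at h1 ⊢
  rw [α.map_vecCons_sub, α.vecCons_smul, hαR, smul_zero, sub_zero] at h1
  exact h1

theorem twoForm_smul_left (α : E [⋀^Fin 2]→L[ℝ] ℝ) (a : ℝ) (v w : E) :
    α ![a • v, w] = a * α ![v, w] :=
  α.vecCons_smul ![w] a v

theorem IsReebField.ne_zero {η : DForm I M 1} {R : VField I M} (hR : IsReebField η R) (x : M) :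
    R x ≠ 0 := fun h0 => by
  obtain ⟨l, hl⟩ := exists_clm_eq_oneForm (E := E) (η x)
  have h2 : (0 : ℝ) = 1 := by
    refine Eq.trans ?_ (hR.apply_eq_one x)
    rw [h0]
    exact ((hl 0).trans (map_zero l)).symm
  exact zero_ne_one h2

/-- A one-form whose differential is the pullback of a symplectic form under the projection along
its Reeb field is a contact form. -/
theorem IsReebField.isContactForm {η : DForm I M 1} {R : VField I M} (hR : IsReebField η R)
    (hη : IsSmoothForm η) {φ : Flow ℝ M} (hφ : IsFlowOf φ R) {f : M → N}
    (hf : Manifold.IsSubmersion I J ∞ f) (hfφ : ∀ t x, f (φ t x) = f x)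
    (hdim : Module.finrank ℝ E = Module.finrank ℝ E' + 1) {σ : DForm J N 2}
    (hσ : IsSymplecticForm σ) (h : pullback f σ = extD η) : IsContactForm η := by
  refine ⟨hη, fun x h0 => ?_, fun x v hv hvw => ?_⟩
  · have h1 := hR.apply_eq_one x
    rw [h0] at h1
    exact zero_ne_one h1
  · obtain ⟨l, hl⟩ := exists_clm_eq_oneForm (E := E) (η x)
    have hall : ∀ w : E, extD η x ![v, w] = 0 :=
      twoForm_eq_zero_of_ker (E := E) (extD η x) l ((hl _).symm.trans (hR.apply_eq_one x))
        (hR.contract_eq_zero x v) fun w hw => hvw w ((hl w).trans hw)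
    -- Nondegeneracy on the base makes `v` vertical, so `v = a • R`, and `η(v) = 0` forces `a = 0`.
    have hfv : mfderiv I J f x v = 0 := by
      refine hσ.nondegenerate _ _ fun w => ?_
      obtain ⟨w, rfl⟩ := (hf.isSubmersionAt x).surjective_mfderiv w
      refine Eq.trans ?_ (hall w)
      rw [← h]
      refine congrArg (σ (f x)) ?_
      ext i
      fin_cases i <;> rfl
    obtain ⟨a, rfl⟩ := exists_eq_smul_of_mfderiv_eq_zero hφ hf hfφ hdim (hR.ne_zero x) hfv
    have h3 : a * l (R x) = 0 := (l.map_smul a (R x)).symm.trans ((hl _).symm.trans hv)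
    have h4 : l (R x) = 1 := (hl _).symm.trans (hR.apply_eq_one x)
    rw [h4, mul_one] at h3
    subst h3
    exact zero_smul ℝ (R x : E)

end Descent

/-! ### Smoothness, generator and invariance for the antidiagonal flow -/

section ProductFlow

variable {E₁ : Type*} [NormedAddCommGroup E₁] [NormedSpace ℝ E₁] [FiniteDimensional ℝ E₁]
  {H₁ : Type*} [TopologicalSpace H₁] {I₁ : ModelWithCorners ℝ E₁ H₁} [I₁.Boundaryless]
  {M₁ : Type*} [TopologicalSpace M₁] [ChartedSpace H₁ M₁] [IsManifold I₁ ∞ M₁]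
  {E₂ : Type*} [NormedAddCommGroup E₂] [NormedSpace ℝ E₂] [FiniteDimensional ℝ E₂]
  {H₂ : Type*} [TopologicalSpace H₂] {I₂ : ModelWithCorners ℝ E₂ H₂} [I₂.Boundaryless]
  {M₂ : Type*} [TopologicalSpace M₂] [ChartedSpace H₂ M₂] [IsManifold I₂ ∞ M₂]
  {φ₁ : Flow ℝ M₁} {R₁ : VField I₁ M₁} {φ₂ : Flow ℝ M₂} {R₂ : VField I₂ M₂}

theorem IsFlowOf.hasMFDerivAt_mul (hφ : IsFlowOf φ₁ R₁) (a : ℝ) (x : M₁) (t : ℝ) :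
    HasMFDerivAt 𝓘(ℝ, ℝ) I₁ (fun t => φ₁ (a * t) x) t
      ((1 : ℝ →L[ℝ] ℝ).smulRight ((a • R₁ (φ₁ (a * t) x) : E₁))) := by
  have h1 : HasMFDerivAt 𝓘(ℝ, ℝ) 𝓘(ℝ, ℝ) (fun t : ℝ => a * t) t (a • (1 : ℝ →L[ℝ] ℝ)) :=
    ((hasFDerivAt_id t).const_mul a).hasMFDerivAt
  have h2 := HasMFDerivAt.comp t (hφ x (a * t)) h1
  refine h2.congr_mfderiv (ContinuousLinearMap.ext_ring (R₁ := ℝ) (M₁ := E₁) ?_)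
  change (a * 1) • (R₁ (φ₁ (a * t) x) : E₁) = (1 : ℝ) • (a • R₁ (φ₁ (a * t) x) : E₁)
  rw [one_smul, mul_one]

theorem IsFlowOf.hasMFDerivAt_prod (h₁ : IsFlowOf φ₁ R₁) (h₂ : IsFlowOf φ₂ R₂) (a b : ℝ)
    (q : M₁ × M₂) (t : ℝ) :
    HasMFDerivAt 𝓘(ℝ, ℝ) (I₁.prod I₂) (fun t => (φ₁ (a * t) q.1, φ₂ (b * t) q.2)) t
      ((1 : ℝ →L[ℝ] ℝ).smulRight
        ((a • R₁ (φ₁ (a * t) q.1), b • R₂ (φ₂ (b * t) q.2)) : E₁ × E₂)) := by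
  exact (h₁.hasMFDerivAt_mul a q.1 t).prodMk (h₂.hasMFDerivAt_mul b q.2 t)

theorem isFlowOf_antidiagonalFlow (h₁ : IsFlowOf φ₁ R₁) (h₂ : IsFlowOf φ₂ R₂) :
    IsFlowOf (antidiagonalFlow φ₁ φ₂) (sumField R₁ (-R₂)) := fun q t => by
  have h := h₁.hasMFDerivAt_prod h₂ 1 (-1) q t
  have e : ∀ s, antidiagonalFlow φ₁ φ₂ s q = (φ₁ (1 * s) q.1, φ₂ (-1 * s) q.2) := fun s => by
    rw [one_mul, neg_one_mul, antidiagonalFlow_apply]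
  let X : M₁ × M₂ → E₁ × E₂ := sumField R₁ (-R₂)
  refine (h.congr_of_eventuallyEq (Eventually.of_forall e)).congr_mfderiv
    (congrArg (fun v : E₁ × E₂ => (1 : ℝ →L[ℝ] ℝ).smulRight v) ?_)
  refine Eq.trans ?_ (congrArg X (e t).symm)
  exact Prod.ext (one_smul ℝ (R₁ _ : E₁)) (neg_one_smul ℝ (R₂ _ : E₂))

theorem contMDiff_antidiagonalFlow
    (h₁ : ContMDiff (𝓘(ℝ, ℝ).prod I₁) I₁ ∞ (fun q : ℝ × M₁ => φ₁ q.1 q.2))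
    (h₂ : ContMDiff (𝓘(ℝ, ℝ).prod I₂) I₂ ∞ (fun q : ℝ × M₂ => φ₂ q.1 q.2)) :
    ContMDiff (𝓘(ℝ, ℝ).prod (I₁.prod I₂)) (I₁.prod I₂) ∞
      (fun q : ℝ × (M₁ × M₂) => antidiagonalFlow φ₁ φ₂ q.1 q.2) := by
  have hn : ContMDiff 𝓘(ℝ, ℝ) 𝓘(ℝ, ℝ) ∞ (fun t : ℝ => -t) := contDiff_neg.contMDiff
  exact (h₁.comp (contMDiff_fst.prodMk (contMDiff_fst.comp contMDiff_snd))).prodMk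
    (h₂.comp ((hn.comp contMDiff_fst).prodMk (contMDiff_snd.comp contMDiff_snd)))

theorem pullback_antidiagonalFlow {η₁ : DForm I₁ M₁ 1} {η₂ : DForm I₂ M₂ 1} {t : ℝ}
    (hd₁ : MDifferentiable I₁ I₁ (φ₁ t)) (hd₂ : MDifferentiable I₂ I₂ (φ₂ (-t)))
    (h₁ : pullback (φ₁ t) η₁ = η₁) (h₂ : pullback (φ₂ (-t)) η₂ = η₂) :
    pullback (antidiagonalFlow φ₁ φ₂ t) (directSum η₁ η₂) = directSum η₁ η₂ := by
  funext q
  have e : mfderiv (I₁.prod I₂) (I₁.prod I₂) (antidiagonalFlow φ₁ φ₂ t) q =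
      (mfderiv I₁ I₁ (φ₁ t) q.1 : E₁ →L[ℝ] E₁).prodMap (mfderiv I₂ I₂ (φ₂ (-t)) q.2 : E₂ →L[ℝ] E₂) :=
    ((hd₁ q.1).hasMFDerivAt.prodMap (hd₂ q.2).hasMFDerivAt).mfderiv
  ext v
  rw [directSum_apply]
  have e₁ := congrArg (fun α : E₁ [⋀^Fin 1]→L[ℝ] ℝ => α (fun i => (v i : E₁ × E₂).1))
    (congrFun h₁ q.1)
  have e₂ := congrArg (fun α : E₂ [⋀^Fin 1]→L[ℝ] ℝ => α (fun i => (v i : E₁ × E₂).2))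
    (congrFun h₂ q.2)
  refine Eq.trans ?_ (congrArg₂ (· + ·) e₁ e₂)
  simp only [pullback]
  rw [e]
  exact directSum_apply η₁ η₂ _ _

end ProductFlow

/-! ### Smoothness and generator of the residual flow -/

section QuotientFlow

variable {E₁ : Type*} [NormedAddCommGroup E₁] [NormedSpace ℝ E₁] [FiniteDimensional ℝ E₁]
  {H₁ : Type*} [TopologicalSpace H₁] {I₁ : ModelWithCorners ℝ E₁ H₁} [I₁.Boundaryless]
  {M₁ : Type*} [TopologicalSpace M₁] [ChartedSpace H₁ M₁] [IsManifold I₁ ∞ M₁]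
  {E₂ : Type*} [NormedAddCommGroup E₂] [NormedSpace ℝ E₂] [FiniteDimensional ℝ E₂]
  {H₂ : Type*} [TopologicalSpace H₂] {I₂ : ModelWithCorners ℝ E₂ H₂} [I₂.Boundaryless]
  {M₂ : Type*} [TopologicalSpace M₂] [ChartedSpace H₂ M₂] [IsManifold I₂ ∞ M₂]
  {φ₁ : Flow ℝ M₁} {R₁ : VField I₁ M₁} {φ₂ : Flow ℝ M₂} {R₂ : VField I₂ M₂}
  {E' : Type*} [NormedAddCommGroup E'] [NormedSpace ℝ E'] [FiniteDimensional ℝ E']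
  {H' : Type*} [TopologicalSpace H'] {J : ModelWithCorners ℝ E' H'} [J.Boundaryless]
  [ChartedSpace H' (OrbitSpace (antidiagonalFlow φ₁ φ₂))]
  [IsManifold J ∞ (OrbitSpace (antidiagonalFlow φ₁ φ₂))]

/-- The quotient flow is the flow of the projection of `(R₁ + R₂) / 2`. -/
theorem exists_isFlowOf_quotientFlow (h₁ : IsFlowOf φ₁ R₁) (h₂ : IsFlowOf φ₂ R₂)
    (hπ : MDifferentiable (I₁.prod I₂) J (orbitProj (antidiagonalFlow φ₁ φ₂))) :
    ∃ R : VField J (OrbitSpace (antidiagonalFlow φ₁ φ₂)),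
      IsFlowOf (quotientFlow φ₁ φ₂) R ∧
      ∀ q, mfderiv (I₁.prod I₂) J (orbitProj (antidiagonalFlow φ₁ φ₂)) q
        ((1 / 2 : ℝ) • sumField R₁ R₂ q) = R (orbitProj (antidiagonalFlow φ₁ φ₂) q) := by
  let F : M₁ × M₂ → E' := fun q => mfderiv (I₁.prod I₂) J (orbitProj (antidiagonalFlow φ₁ φ₂)) q
    ((1 / 2 : ℝ) • sumField R₁ R₂ q)
  have key : ∀ q t, HasMFDerivAt 𝓘(ℝ, ℝ) J
      (fun t => quotientFlow φ₁ φ₂ t (orbitProj (antidiagonalFlow φ₁ φ₂) q)) t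
      ((1 : ℝ →L[ℝ] ℝ).smulRight (F (φ₁ (1 / 2 * t) q.1, φ₂ (1 / 2 * t) q.2))) := by
    intro q t
    have h := HasMFDerivAt.comp t (hπ _).hasMFDerivAt
      (h₁.hasMFDerivAt_prod h₂ (1 / 2) (1 / 2) q t)
    have e : (fun t => quotientFlow φ₁ φ₂ t (orbitProj (antidiagonalFlow φ₁ φ₂) q)) =
        orbitProj (antidiagonalFlow φ₁ φ₂) ∘ fun t => (φ₁ (1 / 2 * t) q.1, φ₂ (1 / 2 * t) q.2) := by
      funext t
      rw [quotientFlow_proj, div_eq_inv_mul, Function.comp, one_div]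
    rw [e]
    refine h.congr_mfderiv (ContinuousLinearMap.ext_ring (R₁ := ℝ) (M₁ := E') ?_)
    refine Eq.trans ?_ (one_smul ℝ (F _)).symm
    let D : E₁ × E₂ →L[ℝ] E' := mfderiv (I₁.prod I₂) J (orbitProj (antidiagonalFlow φ₁ φ₂))
      (φ₁ (1 / 2 * t) q.1, φ₂ (1 / 2 * t) q.2)
    exact congrArg D (one_smul ℝ ((1 / 2 : ℝ) • ((R₁ (φ₁ (1 / 2 * t) q.1),
      R₂ (φ₂ (1 / 2 * t) q.2)) : E₁ × E₂)))
  -- Taking the initial velocity of the residual flow makes the field well defined without choosing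
  -- representatives; `hR` then identifies it with the projected field.
  let R : OrbitSpace (antidiagonalFlow φ₁ φ₂) → E' := fun z =>
    (mfderiv 𝓘(ℝ, ℝ) J (fun t => quotientFlow φ₁ φ₂ t z) 0 : ℝ →L[ℝ] E') 1
  have hR : ∀ q, F q = R (orbitProj (antidiagonalFlow φ₁ φ₂) q) := fun q => by
    have h := congrArg (fun L : ℝ →L[ℝ] E' => L 1) (key q 0).mfderiv
    refine Eq.trans ?_ h.symm
    refine Eq.trans ?_ (one_smul ℝ (F _)).symm
    simp only [mul_zero, Flow.map_zero_apply]
  refine ⟨R, fun z t => ?_, hR⟩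
  obtain ⟨q, rfl⟩ := orbitProj_surjective _ z
  refine (key q t).congr_mfderiv (congrArg (fun v : E' => (1 : ℝ →L[ℝ] ℝ).smulRight v) ?_)
  refine (hR _).trans (congrArg R ?_)
  change _ = quotientFlow φ₁ φ₂ t _
  rw [quotientFlow_proj, show t / 2 = 1 / 2 * t by ring]

/-- Near any point the residual flow is a composite of smooth maps: lift by a local section, flow
for time `t / 2` in each factor, and project. -/
theorem contMDiff_quotientFlow
    (h₁ : ContMDiff (𝓘(ℝ, ℝ).prod I₁) I₁ ∞ (fun q : ℝ × M₁ => φ₁ q.1 q.2))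
    (h₂ : ContMDiff (𝓘(ℝ, ℝ).prod I₂) I₂ ∞ (fun q : ℝ × M₂ => φ₂ q.1 q.2))
    (hπ : Manifold.IsSubmersion (I₁.prod I₂) J ∞ (orbitProj (antidiagonalFlow φ₁ φ₂))) :
    ContMDiff (𝓘(ℝ, ℝ).prod J) J ∞
      (fun q : ℝ × OrbitSpace (antidiagonalFlow φ₁ φ₂) => quotientFlow φ₁ φ₂ q.1 q.2) := by
  rintro ⟨t, z⟩
  obtain ⟨x, rfl⟩ := orbitProj_surjective _ z
  obtain ⟨s, hs, hsx, hfs⟩ := (hπ.isSubmersionAt x).exists_section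
  have hh : ContMDiff 𝓘(ℝ, ℝ) 𝓘(ℝ, ℝ) ∞ (fun t : ℝ => t / 2) := (contDiff_id.div_const 2).contMDiff
  have hh' := hh.contMDiffAt.comp (t, orbitProj (antidiagonalFlow φ₁ φ₂) x)
    (contMDiffAt_fst (I := 𝓘(ℝ, ℝ)) (J := J) (n := ∞))
  have hs' := hs.self_of_nhds.comp (t, orbitProj (antidiagonalFlow φ₁ φ₂) x)
    (contMDiffAt_snd (I := 𝓘(ℝ, ℝ)) (J := J) (n := ∞))
  have h1 := (hπ.contMDiff _).comp (t, orbitProj (antidiagonalFlow φ₁ φ₂) x)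
    (((h₁ _).comp _ (hh'.prodMk (contMDiffAt_fst.comp _ hs'))).prodMk
      ((h₂ _).comp _ (hh'.prodMk (contMDiffAt_snd.comp _ hs'))))
  refine h1.congr_of_eventuallyEq ?_
  filter_upwards [(continuous_snd.tendsto _).eventually hfs] with q hq
  refine (congrArg (quotientFlow φ₁ φ₂ q.1) hq.symm).trans ?_
  rfl

theorem exists_continuousAt_section
    (hπ : Manifold.IsSubmersion (I₁.prod I₂) J ∞ (orbitProj (antidiagonalFlow φ₁ φ₂)))
    (z : OrbitSpace (antidiagonalFlow φ₁ φ₂)) :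
    ∃ σ : OrbitSpace (antidiagonalFlow φ₁ φ₂) → M₁ × M₂,
      ContinuousAt σ z ∧ ∀ᶠ w in 𝓝 z, orbitProj (antidiagonalFlow φ₁ φ₂) (σ w) = w := by
  obtain ⟨x, rfl⟩ := orbitProj_surjective _ z
  obtain ⟨s, hs, -, hfs⟩ := (hπ.isSubmersionAt x).exists_section
  exact ⟨s, hs.self_of_nhds.continuousAt, hfs⟩

end QuotientFlow

/-! ### Maps induced on the base of a submersion -/

section SubmersionComp

variable {E : Type*} [NormedAddCommGroup E] [NormedSpace ℝ E] [FiniteDimensional ℝ E]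
  {H : Type*} [TopologicalSpace H] {I : ModelWithCorners ℝ E H} [I.Boundaryless]
  {E' : Type*} [NormedAddCommGroup E'] [NormedSpace ℝ E'] [FiniteDimensional ℝ E']
  {H' : Type*} [TopologicalSpace H'] {J : ModelWithCorners ℝ E' H'} [J.Boundaryless]
  {E'' : Type*} [NormedAddCommGroup E''] [NormedSpace ℝ E''] [FiniteDimensional ℝ E'']
  {H'' : Type*} [TopologicalSpace H''] {K : ModelWithCorners ℝ E'' H''} [K.Boundaryless]
  {M : Type*} [TopologicalSpace M] [ChartedSpace H M] [IsManifold I ∞ M]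
  {N : Type*} [TopologicalSpace N] [ChartedSpace H' N] [IsManifold J ∞ N]
  {P : Type*} [TopologicalSpace P] [ChartedSpace H'' P] [IsManifold K ∞ P]

/-- Locally `g = h ∘ s` for a section `s` of `f`, which gives smoothness; the chain rule for `h = g
∘ f` then passes surjectivity of the differential on to `g`. -/
theorem isSubmersion_of_comp {f : M → N} (hf : Manifold.IsSubmersion I J ∞ f)
    (hs : Function.Surjective f) {g : N → P} {h : M → P} (hgf : ∀ x, g (f x) = h x)
    (hh : ContMDiff I K ∞ h) (hh' : ∀ x, Function.Surjective (mfderiv I K h x)) :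
    Manifold.IsSubmersion J K ∞ g := by
  have hg : ContMDiff J K ∞ g := fun y => by
    obtain ⟨x, rfl⟩ := hs y
    obtain ⟨s, hs, -, hfs⟩ := (hf.isSubmersionAt x).exists_section
    refine ((hh _).comp (f x) hs.self_of_nhds).congr_of_eventuallyEq ?_
    filter_upwards [hfs] with z hz
    rw [Function.comp, ← hgf, hz]
  refine isSubmersion_of_surjective_mfderiv hg fun y => ?_
  obtain ⟨x, rfl⟩ := hs y
  have h1 := mfderiv_comp x ((hg (f x)).mdifferentiableAt (by simp))
    ((hf.contMDiff x).mdifferentiableAt (by simp))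
  rw [show g ∘ f = h from funext hgf] at h1
  intro v
  obtain ⟨u, hu⟩ := hh' x v
  exact ⟨mfderiv I J f x u, (congrArg (fun T : E →L[ℝ] E'' => T u) h1).symm.trans hu⟩

end SubmersionComp

/-! ### The principal contactification on the orbit space -/

section Contactification

variable {E₁ : Type*} [NormedAddCommGroup E₁] [NormedSpace ℝ E₁] [FiniteDimensional ℝ E₁]
  {H₁ : Type*} [TopologicalSpace H₁] {I₁ : ModelWithCorners ℝ E₁ H₁} [I₁.Boundaryless]
  {M₁ : Type*} [TopologicalSpace M₁] [ChartedSpace H₁ M₁] [IsManifold I₁ ∞ M₁]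
  {E₁' : Type*} [NormedAddCommGroup E₁'] [NormedSpace ℝ E₁'] [FiniteDimensional ℝ E₁']
  {H₁' : Type*} [TopologicalSpace H₁'] {J₁ : ModelWithCorners ℝ E₁' H₁'} [J₁.Boundaryless]
  {N₁ : Type*} [TopologicalSpace N₁] [ChartedSpace H₁' N₁] [IsManifold J₁ ∞ N₁]
  {E₂ : Type*} [NormedAddCommGroup E₂] [NormedSpace ℝ E₂] [FiniteDimensional ℝ E₂]
  {H₂ : Type*} [TopologicalSpace H₂] {I₂ : ModelWithCorners ℝ E₂ H₂} [I₂.Boundaryless]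
  {M₂ : Type*} [TopologicalSpace M₂] [ChartedSpace H₂ M₂] [IsManifold I₂ ∞ M₂]
  {E₂' : Type*} [NormedAddCommGroup E₂'] [NormedSpace ℝ E₂'] [FiniteDimensional ℝ E₂']
  {H₂' : Type*} [TopologicalSpace H₂'] {J₂ : ModelWithCorners ℝ E₂' H₂'} [J₂.Boundaryless]
  {N₂ : Type*} [TopologicalSpace N₂] [ChartedSpace H₂' N₂] [IsManifold J₂ ∞ N₂]
  {V : Type*} [NormedAddCommGroup V] [NormedSpace ℝ V] [FiniteDimensional ℝ V]
  {H : Type*} [TopologicalSpace H] {J : ModelWithCorners ℝ V H} [J.Boundaryless]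
  {η₁ : DForm I₁ M₁ 1} {R₁ : VField I₁ M₁} {p₁ : M₁ → N₁} {σ₁ : DForm J₁ N₁ 2} {ρ₁ : ℝ≥0∞}
  {η₂ : DForm I₂ M₂ 1} {R₂ : VField I₂ M₂} {p₂ : M₂ → N₂} {σ₂ : DForm J₂ N₂ 2} {ρ₂ : ℝ≥0∞}
  {φ₁ : Flow ℝ M₁} {φ₂ : Flow ℝ M₂} {τ ρ : ℝ≥0∞}

theorem IsReebField.apply_smul (h : IsReebField η₁ R₁) (x : M₁) (a : ℝ) :
    η₁ x ![a • R₁ x] = a := by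
  obtain ⟨l, hl⟩ := exists_clm_eq_oneForm (E := E₁) (η₁ x)
  have h1 : l (R₁ x) = 1 := (hl _).symm.trans (h.apply_eq_one x)
  refine (hl _).trans ((l.map_smul a (R₁ x)).trans ?_)
  rw [h1, smul_eq_mul, mul_one]

theorem IsReebField.contract_smul (h : IsReebField η₁ R₁) (x : M₁) (a : ℝ)
    (v : TangentSpace I₁ x) : extD η₁ x ![a • R₁ x, v] = 0 :=
  (twoForm_smul_left (E := E₁) (extD η₁ x) a (R₁ x) v).trans
    ((congrArg (a * ·) (h.contract_eq_zero x v)).trans (mul_zero a))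

theorem directSum_oneForm_apply (α : DForm I₁ M₁ 1) (β : DForm I₂ M₂ 1) (x : M₁ × M₂)
    (v : E₁ × E₂) : directSum α β x ![v] = α x.1 ![v.1] + β x.2 ![v.2] := by
  rw [directSum_apply]
  refine congrArg₂ (· + ·) (congrArg (α x.1) ?_) (congrArg (β x.2) ?_) <;>
  · ext i
    fin_cases i
    rfl

theorem directSum_twoForm_apply (α : DForm I₁ M₁ 2) (β : DForm I₂ M₂ 2) (x : M₁ × M₂)
    (v w : E₁ × E₂) :
    directSum α β x ![v, w] = α x.1 ![v.1, w.1] + β x.2 ![v.2, w.2] := by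
  rw [directSum_apply]
  refine congrArg₂ (· + ·) (congrArg (α x.1) ?_) (congrArg (β x.2) ?_) <;>
  · ext i
    fin_cases i <;> rfl

theorem IsPrincipalFlow.contMDiff (h : IsPrincipalFlow I₁ φ₁ ρ₁) (t : ℝ) :
    ContMDiff I₁ I₁ ∞ (φ₁ t) := h.smooth.comp (contMDiff_const.prodMk contMDiff_id)

theorem IsPrincipalFlow.hasConvergentTimes [T2Space M₁] (h : IsPrincipalFlow I₁ φ₁ ρ₁)
    (hρ : ρ₁ = ⊤) : HasConvergentTimes φ₁ :=
  (properVAdd_top_iff φ₁ hρ h.periodic).1 h.proper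

/-- Time `t` fixes a point exactly when `t` is a period of `φ₁` and `-t` one of `φ₂`, so the periods
are intersected. -/
theorem IsPrincipalFlow.antidiagonalFlow [T2Space M₁] [T2Space M₂]
    (h₁ : IsPrincipalFlow I₁ φ₁ ρ₁) (h₂ : IsPrincipalFlow I₂ φ₂ ρ₂) (h0 : 0 < τ)
    (hτ : τ = ⊤ → ρ₁ = ⊤) (hmem : ∀ t : ℝ, t ∈ AddSubgroup.zmultiples τ.toReal ↔
      t ∈ AddSubgroup.zmultiples ρ₁.toReal ∧ t ∈ AddSubgroup.zmultiples ρ₂.toReal) :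
    IsPrincipalFlow (I₁.prod I₂) (antidiagonalFlow φ₁ φ₂) τ where
  period_pos := h0
  smooth := contMDiff_antidiagonalFlow h₁.smooth h₂.smooth
  periodic t ht q := Prod.ext (h₁.periodic t ((hmem t).1 ht).1 q.1)
    (h₂.periodic (-t) (neg_mem ((hmem t).1 ht).2) q.2)
  free t q h := (hmem t).2 ⟨h₁.free t q.1 (congrArg Prod.fst h),
    neg_mem_iff.1 (h₂.free (-t) q.2 (congrArg Prod.snd h))⟩
  proper := properVAdd_of_hasConvergentTimes _ h0
    (fun h => (h₁.hasConvergentTimes (hτ h)).antidiagonalFlow φ₂) _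

theorem mem_zmultiples_of_quotientFlow_eq (h₁ : IsPrincipalFlow I₁ φ₁ ρ₁)
    (h₂ : IsPrincipalFlow I₂ φ₂ ρ₂) (hmem : ∀ t : ℝ, t ∈ AddSubgroup.zmultiples ρ.toReal ↔
      ∃ a ∈ AddSubgroup.zmultiples ρ₁.toReal, ∃ b ∈ AddSubgroup.zmultiples ρ₂.toReal, a + b = t)
    (t : ℝ) (z : OrbitSpace (antidiagonalFlow φ₁ φ₂)) (h : quotientFlow φ₁ φ₂ t z = z) :
    t ∈ AddSubgroup.zmultiples ρ.toReal := by
  obtain ⟨q, rfl⟩ := orbitProj_surjective _ z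
  obtain ⟨a, b, hab, ha, hb⟩ := (quotientFlow_proj_eq_iff φ₁ φ₂).1 h
  exact (hmem t).2 ⟨a, h₁.free _ _ ha, b, h₂.free _ _ hb, hab⟩

variable (V) in
/-- The orbit space of the antidiagonal flow of two principal contactifications is a manifold. -/
theorem exists_isSubmersion_orbitProj (hR₁ : ∀ x, R₁ x ≠ 0) (hR₂ : ∀ x, R₂ x ≠ 0)
    (hφ₁ : IsFlowOf φ₁ R₁) (hφ₂ : IsFlowOf φ₂ R₂)
    (h₁ : IsPrincipalFlow I₁ φ₁ ρ₁) (h₂ : IsPrincipalFlow I₂ φ₂ ρ₂)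
    (hp₁ : Manifold.IsSubmersion I₁ J₁ ∞ p₁) (hp₂ : Manifold.IsSubmersion I₂ J₂ ∞ p₂)
    (hpφ₁ : ∀ t x, p₁ (φ₁ t x) = p₁ x) (hpφ₂ : ∀ t x, p₂ (φ₂ t x) = p₂ x)
    (hmem : ∀ t : ℝ, t ∈ AddSubgroup.zmultiples ρ.toReal ↔
      ∃ a ∈ AddSubgroup.zmultiples ρ₁.toReal, ∃ b ∈ AddSubgroup.zmultiples ρ₂.toReal, a + b = t)
    (hd₁ : Module.finrank ℝ E₁ = Module.finrank ℝ E₁' + 1)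
    (hd₂ : Module.finrank ℝ E₂ = Module.finrank ℝ E₂' + 1)
    (hV : Module.finrank ℝ V = Module.finrank ℝ E₁' + Module.finrank ℝ E₂' + 1) :
    ∃ _ : ChartedSpace V (OrbitSpace (antidiagonalFlow φ₁ φ₂)),
      IsManifold 𝓘(ℝ, V) ∞ (OrbitSpace (antidiagonalFlow φ₁ φ₂)) ∧
      Manifold.IsSubmersion (I₁.prod I₂) 𝓘(ℝ, V) ∞ (orbitProj (antidiagonalFlow φ₁ φ₂)) := by
  set ψ := antidiagonalFlow φ₁ φ₂ with hψ
  have hcharts : ∀ z : OrbitSpace ψ, ∃ e : OpenPartialHomeomorph (OrbitSpace ψ) V,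
      IsQuotientChart (I₁.prod I₂) (orbitProj ψ) e ∧ z ∈ e.source := by
    intro z
    obtain ⟨⟨x₁, x₂⟩, rfl⟩ := orbitProj_surjective _ z
    obtain ⟨U₁, s₁, hS₁, u₁, hu₁, rfl⟩ := exists_isSlice hφ₁ hR₁ h₁.smooth hp₁ hpφ₁ hd₁ x₁
    obtain ⟨U₂, s₂, hS₂, u₂, hu₂, rfl⟩ := exists_isSlice hφ₂ hR₂ h₂.smooth hp₂ hpφ₂ hd₂ x₂
    obtain ⟨e, he, hz⟩ := exists_isQuotientChart h₁.smooth ENNReal.toReal_nonneg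
      (mem_zmultiples_of_quotientFlow_eq h₁ h₂ hmem) hS₁ hu₁ hS₂ hu₂
    have hf : Module.finrank ℝ (E₁' × E₂' × ℝ) = Module.finrank ℝ V := by
      rw [Module.finrank_prod, Module.finrank_prod, Module.finrank_self, hV, add_assoc]
    exact ⟨_, he.transHomeomorph (ContinuousLinearEquiv.ofFinrankEq hf), hz⟩
  let _ := quotientChartedSpace (I₁.prod I₂) V (orbitProj ψ) hcharts
  have hM := isManifold_quotient hcharts
  have hπ : ContMDiff (I₁.prod I₂) 𝓘(ℝ, V) ∞ (orbitProj ψ) :=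
    contMDiff_quotient_proj hcharts (isOpenQuotientMap_orbitProj ψ).continuous
  refine ⟨inferInstance, hM, isSubmersion_of_surjective_mfderiv hπ fun q => ?_⟩
  obtain ⟨σ, hσ, hπσ⟩ := exists_quotient_section hcharts (orbitProj ψ q)
  -- The section meets the orbit of `q` but perhaps not at `q`; moving it by `ψ t` corrects this.
  obtain ⟨t, ht⟩ := (orbitProj_eq_iff ψ).1 hπσ.self_of_nhds
  have hψt : ContMDiff (I₁.prod I₂) (I₁.prod I₂) ∞ (ψ t) :=
    (contMDiff_antidiagonalFlow h₁.smooth h₂.smooth).comp (contMDiff_const.prodMk contMDiff_id)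
  refine surjective_mfderiv_of_section (s := fun z => ψ t (σ z))
    ((hπ q).mdifferentiableAt (by simp))
    (((hψt _).comp _ hσ.self_of_nhds).mdifferentiableAt (by simp)) ht ?_
  filter_upwards [hπσ] with z hz
  rw [orbitProj_flow, hz]

/-- A total time returns to the same class exactly when it is a sum of periods of the factors. The
noncompact case occurs only when both factors are noncompact, and then properness comes from the two
factors through local sections. -/
theorem IsPrincipalFlow.quotientFlow [T2Space M₁] [T2Space M₂]
    [T2Space (OrbitSpace (ContactProduct.antidiagonalFlow φ₁ φ₂))]
    [ChartedSpace H (OrbitSpace (ContactProduct.antidiagonalFlow φ₁ φ₂))]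
    [IsManifold J ∞ (OrbitSpace (ContactProduct.antidiagonalFlow φ₁ φ₂))]
    (h₁ : IsPrincipalFlow I₁ φ₁ ρ₁) (h₂ : IsPrincipalFlow I₂ φ₂ ρ₂)
    (hπ : Manifold.IsSubmersion (I₁.prod I₂) J ∞
      (orbitProj (ContactProduct.antidiagonalFlow φ₁ φ₂))) (h0 : 0 < ρ)
    (hρ : ρ = ⊤ → ρ₁ = ⊤ ∧ ρ₂ = ⊤) (hmem : ∀ t : ℝ, t ∈ AddSubgroup.zmultiples ρ.toReal ↔
      ∃ a ∈ AddSubgroup.zmultiples ρ₁.toReal, ∃ b ∈ AddSubgroup.zmultiples ρ₂.toReal, a + b = t) :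
    IsPrincipalFlow J (quotientFlow φ₁ φ₂) ρ where
  period_pos := h0
  smooth := contMDiff_quotientFlow h₁.smooth h₂.smooth hπ
  periodic t ht z := by
    obtain ⟨q, rfl⟩ := orbitProj_surjective _ z
    obtain ⟨a, ha, b, hb, hab⟩ := (hmem t).1 ht
    exact (quotientFlow_proj_eq_iff φ₁ φ₂).2 ⟨a, b, hab, h₁.periodic a ha _, h₂.periodic b hb _⟩
  free := mem_zmultiples_of_quotientFlow_eq h₁ h₂ hmem
  proper := properVAdd_of_hasConvergentTimes _ h0
    (fun h => HasConvergentTimes.quotientFlow (h₁.hasConvergentTimes (hρ h).1)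
      (h₂.hasConvergentTimes (hρ h).2) (exists_continuousAt_section hπ)) _

/-- The product of two principal contactifications, on the orbit space of the antidiagonal flow. -/
theorem exists_isPrincipalContactification [T2Space M₁] [T2Space M₂]
    [T2Space (OrbitSpace (antidiagonalFlow φ₁ φ₂))]
    [ChartedSpace H (OrbitSpace (antidiagonalFlow φ₁ φ₂))]
    [IsManifold J ∞ (OrbitSpace (antidiagonalFlow φ₁ φ₂))]
    (h₁ : IsPrincipalContactification η₁ R₁ p₁ σ₁ ρ₁)
    (h₂ : IsPrincipalContactification η₂ R₂ p₂ σ₂ ρ₂)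
    (hφ₁ : IsFlowOf φ₁ R₁) (hφ₂ : IsFlowOf φ₂ R₂)
    (hP₁ : IsPrincipalFlow I₁ φ₁ ρ₁) (hP₂ : IsPrincipalFlow I₂ φ₂ ρ₂)
    (hf₁ : ∀ x y, p₁ x = p₁ y ↔ y ∈ φ₁.orbit x) (hf₂ : ∀ x y, p₂ x = p₂ y ↔ y ∈ φ₂.orbit x)
    (hinv : ∀ t, pullback (antidiagonalFlow φ₁ φ₂ t) (directSum η₁ η₂) = directSum η₁ η₂)
    (hπ : Manifold.IsSubmersion (I₁.prod I₂) J ∞ (orbitProj (antidiagonalFlow φ₁ φ₂)))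
    (h0 : 0 < ρ) (hρ : ρ = ⊤ → ρ₁ = ⊤ ∧ ρ₂ = ⊤)
    (hmem : ∀ t : ℝ, t ∈ AddSubgroup.zmultiples ρ.toReal ↔
      ∃ a ∈ AddSubgroup.zmultiples ρ₁.toReal, ∃ b ∈ AddSubgroup.zmultiples ρ₂.toReal, a + b = t)
    (hd₁ : Module.finrank ℝ E₁ = Module.finrank ℝ E₁' + 1)
    (hd₂ : Module.finrank ℝ E₂ = Module.finrank ℝ E₂' + 1)
    (hV : Module.finrank ℝ V = Module.finrank ℝ E₁' + Module.finrank ℝ E₂' + 1) :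
    ∃ (η : DForm J (OrbitSpace (antidiagonalFlow φ₁ φ₂)) 1)
      (R : VField J (OrbitSpace (antidiagonalFlow φ₁ φ₂)))
      (p : OrbitSpace (antidiagonalFlow φ₁ φ₂) → N₁ × N₂),
      pullback (orbitProj (antidiagonalFlow φ₁ φ₂)) η = directSum η₁ η₂ ∧
      (∀ x, p (orbitProj (antidiagonalFlow φ₁ φ₂) x) = (p₁ x.1, p₂ x.2)) ∧
      IsPrincipalContactification η R p (directSum σ₁ σ₂) ρ ∧
      ∀ x, mfderiv (I₁.prod I₂) J (orbitProj (antidiagonalFlow φ₁ φ₂)) x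
        ((1 / 2 : ℝ) • sumField R₁ R₂ x) = R (orbitProj (antidiagonalFlow φ₁ φ₂) x) := by
  let π := orbitProj (antidiagonalFlow φ₁ φ₂)
  have hπs : Function.Surjective π := orbitProj_surjective _
  have hπ' : ∀ x, Function.Surjective (mfderiv (I₁.prod I₂) J π x) := fun x =>
    (hπ.isSubmersionAt x).surjective_mfderiv
  have hπd : MDifferentiable (I₁.prod I₂) J π := hπ.contMDiff.mdifferentiable (by simp)
  have hθs : IsSmoothForm (directSum η₁ η₂) := h₁.contact.smooth.directSum h₂.contact.smooth
  have hψs := contMDiff_antidiagonalFlow hP₁.smooth hP₂.smooth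
  have hne : ∀ x, sumField R₁ (-R₂) x ≠ 0 := fun x h =>
    h₁.reeb.ne_zero x.1 (congrArg (fun v : E₁ × E₂ => v.1) h)
  -- The two Reeb normalizations cancel: `1 + (-1) = 0`.
  have hθ0 : ∀ x, directSum η₁ η₂ x ![sumField R₁ (-R₂) x] = 0 := fun x => by
    have e := (congrArg (fun v : E₂ => η₂ x.2 ![v]) (neg_one_smul ℝ (R₂ x.2 : E₂)).symm).trans
      (h₂.reeb.apply_smul x.2 (-1))
    exact (directSum_oneForm_apply η₁ η₂ x _).trans
      ((congrArg₂ (· + ·) (h₁.reeb.apply_eq_one x.1) e).trans (by norm_num))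
  obtain ⟨η, hη⟩ := exists_pullback_eq (J := J) (isFlowOf_antidiagonalFlow hφ₁ hφ₂)
    (fun t => (hψs.comp (contMDiff_const.prodMk contMDiff_id)).mdifferentiable (by simp))
    hπ hπs (fun x y => orbitProj_eq_iff _)
    (by rw [Module.finrank_prod, hd₁, hd₂, hV]; ring) hne hinv hθ0
  obtain ⟨R, hΦ, hR⟩ := exists_isFlowOf_quotientFlow hφ₁ hφ₂ hπd
  have hηs : IsSmoothForm η := isSmoothForm_of_pullback hπ hπs (by rw [hη]; exact hθs)
  have hdη : pullback π (extD η) = directSum (extD η₁) (extD η₂) := by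
    rw [← extD_directSum h₁.contact.smooth h₂.contact.smooth, ← hη]
    funext x
    exact (extD_pullback hηs (Eventually.of_forall hπ.contMDiff)).symm
  -- Both conditions are checked upstairs on `(R₁ + R₂) / 2`: the normalization reads `1/2 + 1/2 =
  -- 1`, and each summand contracts to zero.
  have hreeb : IsReebField η R := by
    refine ⟨fun z => ?_, fun z w => ?_⟩
    · obtain ⟨x, rfl⟩ := hπs z
      have e := congrArg (fun α : DForm (I₁.prod I₂) (M₁ × M₂) 1 =>
        α x ![(1 / 2 : ℝ) • sumField R₁ R₂ x]) hη
      have e' := (directSum_oneForm_apply η₁ η₂ x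
        ((1 / 2 : ℝ) • R₁ x.1, (1 / 2 : ℝ) • R₂ x.2)).trans
        (congrArg₂ (· + ·) (h₁.reeb.apply_smul x.1 (1 / 2)) (h₂.reeb.apply_smul x.2 (1 / 2)))
      refine Eq.trans (congrArg (η (π x)) ?_) ((e.trans e').trans (by norm_num))
      ext i
      fin_cases i
      exact (hR x).symm
    · obtain ⟨x, rfl⟩ := hπs z
      obtain ⟨w, rfl⟩ := hπ' x w
      have e := congrArg (fun α : DForm (I₁.prod I₂) (M₁ × M₂) 2 =>
        α x ![(1 / 2 : ℝ) • sumField R₁ R₂ x, w]) hdη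
      have e' := (directSum_twoForm_apply (extD η₁) (extD η₂) x
        ((1 / 2 : ℝ) • R₁ x.1, (1 / 2 : ℝ) • R₂ x.2) w).trans
        (congrArg₂ (· + ·) (h₁.reeb.contract_smul x.1 (1 / 2) _)
          (h₂.reeb.contract_smul x.2 (1 / 2) _))
      refine Eq.trans (congrArg (extD η (π x)) ?_) ((e.trans e').trans (by norm_num))
      ext i
      fin_cases i
      · exact (hR x).symm
      · rfl
  let p : OrbitSpace (antidiagonalFlow φ₁ φ₂) → N₁ × N₂ := Quotient.lift (fun x => (p₁ x.1, p₂ x.2)) fun x y hxy => by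
    obtain ⟨t, ht₁, ht₂⟩ := (antidiagonal_proj_eq_iff φ₁ φ₂).1 (Quotient.sound hxy)
    exact Prod.ext ((hf₁ _ _).2 ⟨t, ht₁⟩) ((hf₂ _ _).2 ⟨-t, ht₂⟩)
  have hpπ : ∀ x, p (π x) = (p₁ x.1, p₂ x.2) := fun x => rfl
  have hd₁' := h₁.submersion.contMDiff.mdifferentiable (by simp : (∞ : WithTop ℕ∞) ≠ 0)
  have hd₂' := h₂.submersion.contMDiff.mdifferentiable (by simp : (∞ : WithTop ℕ∞) ≠ 0)
  have hpp : ∀ x : M₁ × M₂, HasMFDerivAt (I₁.prod I₂) (J₁.prod J₂)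
      (fun x : M₁ × M₂ => (p₁ x.1, p₂ x.2)) x ((mfderiv I₁ J₁ p₁ x.1 : E₁ →L[ℝ] E₁').prodMap
        (mfderiv I₂ J₂ p₂ x.2 : E₂ →L[ℝ] E₂')) := fun x =>
    (hd₁' x.1).hasMFDerivAt.prodMap (hd₂' x.2).hasMFDerivAt
  have hp : Manifold.IsSubmersion J (J₁.prod J₂) ∞ p := by
    refine isSubmersion_of_comp hπ hπs hpπ
      (h₁.submersion.contMDiff.prodMap h₂.submersion.contMDiff) fun x => ?_
    have h := (hpp x).mfderiv
    rintro ⟨v₁, v₂⟩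
    obtain ⟨w₁, hw₁⟩ := (h₁.submersion.isSubmersionAt x.1).surjective_mfderiv v₁
    obtain ⟨w₂, hw₂⟩ := (h₂.submersion.isSubmersionAt x.2).surjective_mfderiv v₂
    exact ⟨((w₁, w₂) : E₁ × E₂),
      (congrArg (fun T : E₁ × E₂ →L[ℝ] E₁' × E₂' => T (w₁, w₂)) h).trans (Prod.ext hw₁ hw₂)⟩
  have hpω : pullback p (directSum σ₁ σ₂) = extD η := by
    -- Along `π` both sides become `dη₁ ⊕ dη₂`, and pullback by a surjective submersion loses no
    -- information.
    refine pullback_injective hπs hπ' ?_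
    rw [hdη]
    funext x
    rw [pullback_pullback _ (hπd x) (hp.contMDiff.mdifferentiable (by simp) _)]
    ext v
    rw [directSum_apply, ← h₁.pullback_eq, ← h₂.pullback_eq]
    have h : ∀ i, _ := fun i =>
      congrArg (fun T : E₁ × E₂ →L[ℝ] E₁' × E₂' => T (v i)) (hpp x).mfderiv
    refine (directSum_apply σ₁ σ₂ _ _).trans (congrArg₂ (· + ·) (congrArg (σ₁ (p₁ x.1)) ?_)
      (congrArg (σ₂ (p₂ x.2)) ?_))
    · exact funext fun i => congrArg Prod.fst (h i)
    · exact funext fun i => congrArg Prod.snd (h i)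
  -- Independent times `a` and `b` in the two factors amount to the single time `a + b` in the
  -- quotient.
  have hfib : ∀ z w, p z = p w ↔ w ∈ (quotientFlow φ₁ φ₂).orbit z := by
    intro z w
    obtain ⟨x, rfl⟩ := hπs z
    obtain ⟨y, rfl⟩ := hπs w
    rw [hpπ, hpπ, Prod.ext_iff]
    simp only [hf₁, hf₂, Flow.mem_orbit_iff]
    constructor
    · rintro ⟨⟨a, ha⟩, b, hb⟩
      exact ⟨a + b, (quotientFlow_proj_eq_iff φ₁ φ₂).2 ⟨a, b, rfl, ha, hb⟩⟩
    · rintro ⟨t, ht⟩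
      obtain ⟨a, b, -, ha, hb⟩ := (quotientFlow_proj_eq_iff φ₁ φ₂).1 ht
      exact ⟨⟨a, ha⟩, b, hb⟩
  have hsymp := h₁.symplectic.directSum h₂.symplectic
  refine ⟨η, R, p, hη, hpπ, ⟨?_, hreeb, hsymp, hp, ?_, ⟨quotientFlow φ₁ φ₂, hΦ,
    hP₁.quotientFlow hP₂ hπ h0 hρ hmem, hfib⟩, hpω⟩, hR⟩
  · exact hreeb.isContactForm hηs hΦ hp (fun t z => ((hfib _ _).2 ⟨t, rfl⟩).symm)
      (by rw [Module.finrank_prod, hV]) hsymp hpω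
  · rintro ⟨y₁, y₂⟩
    obtain ⟨x₁, rfl⟩ := h₁.surjective y₁
    obtain ⟨x₂, rfl⟩ := h₂.surjective y₂
    exact ⟨π (x₁, x₂), rfl⟩

end Contactification

end ContactProduct

end

/-! ### The theorem for Euclidean models -/

theorem mainTheorem3 {n₁ n₂ : ℕ} {M₁ M₂ N₁ N₂ : Type*}
    [TopologicalSpace M₁] [T2Space M₁] [SecondCountableTopology M₁] [ConnectedSpace M₁]
    [ChartedSpace (EuclideanSpace ℝ (Fin (2 * n₁ + 1))) M₁] [IsManifold (𝓡 (2 * n₁ + 1)) ∞ M₁]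
    [TopologicalSpace M₂] [T2Space M₂] [SecondCountableTopology M₂] [ConnectedSpace M₂]
    [ChartedSpace (EuclideanSpace ℝ (Fin (2 * n₂ + 1))) M₂] [IsManifold (𝓡 (2 * n₂ + 1)) ∞ M₂]
    [TopologicalSpace N₁] [T2Space N₁] [SecondCountableTopology N₁]
    [ChartedSpace (EuclideanSpace ℝ (Fin (2 * n₁))) N₁] [IsManifold (𝓡 (2 * n₁)) ∞ N₁]
    [TopologicalSpace N₂] [T2Space N₂] [SecondCountableTopology N₂]
    [ChartedSpace (EuclideanSpace ℝ (Fin (2 * n₂))) N₂] [IsManifold (𝓡 (2 * n₂)) ∞ N₂]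
    (η₁ : DForm (𝓡 (2 * n₁ + 1)) M₁ 1) (R₁ : VField (𝓡 (2 * n₁ + 1)) M₁)
    (p₁ : M₁ → N₁) (ω₁ : DForm (𝓡 (2 * n₁)) N₁ 2) (ρ₁ : ℝ≥0∞)
    (h₁ : IsPrincipalContactification η₁ R₁ p₁ ω₁ ρ₁)
    (η₂ : DForm (𝓡 (2 * n₂ + 1)) M₂ 1) (R₂ : VField (𝓡 (2 * n₂ + 1)) M₂)
    (p₂ : M₂ → N₂) (ω₂ : DForm (𝓡 (2 * n₂)) N₂ 2) (ρ₂ : ℝ≥0∞)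
    (h₂ : IsPrincipalContactification η₂ R₂ p₂ ω₂ ρ₂)
    (k l : ℕ)
    (hρ : ρ₁ = ⊤ ∨ (ρ₁ ≠ ⊤ ∧ ρ₂ ≠ ⊤ ∧ 0 < k ∧ 0 < l ∧ k.Coprime l ∧
      ρ₂ / ρ₁ = (k : ℝ≥0∞) / (l : ℝ≥0∞))) :
    ∃ ψ : Flow ℝ (M₁ × M₂), IsFlowOf ψ (sumField R₁ (-R₂)) ∧
    ∃ τ ρ : ℝ≥0∞,
      (ρ₁ = ⊤ → τ = ⊤ ∧ ρ = ρ₂) ∧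
      (ρ₁ ≠ ⊤ → τ = k * ρ₁ ∧ τ = l * ρ₂ ∧ ρ = ρ₂ / k ∧ ρ = ρ₁ / l) ∧
      IsPrincipalFlow ((𝓡 (2 * n₁ + 1)).prod (𝓡 (2 * n₂ + 1))) ψ τ ∧
      (∀ t : ℝ, pullback (ψ t) (directSum η₁ η₂) = directSum η₁ η₂) ∧
      T2Space (OrbitSpace ψ) ∧ SecondCountableTopology (OrbitSpace ψ) ∧
      ConnectedSpace (OrbitSpace ψ) ∧
      ∃ _ : ChartedSpace (EuclideanSpace ℝ (Fin (2 * (n₁ + n₂) + 1))) (OrbitSpace ψ),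
        IsManifold (𝓡 (2 * (n₁ + n₂) + 1)) ∞ (OrbitSpace ψ) ∧
        Manifold.IsSubmersion ((𝓡 (2 * n₁ + 1)).prod (𝓡 (2 * n₂ + 1)))
          (𝓡 (2 * (n₁ + n₂) + 1)) ∞ (orbitProj ψ) ∧
        ∃ (η : DForm (𝓡 (2 * (n₁ + n₂) + 1)) (OrbitSpace ψ) 1)
          (R : VField (𝓡 (2 * (n₁ + n₂) + 1)) (OrbitSpace ψ))
          (p : OrbitSpace ψ → N₁ × N₂),
          pullback (orbitProj ψ) η = directSum η₁ η₂ ∧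
          (∀ x : M₁ × M₂, p (orbitProj ψ x) = (p₁ x.1, p₂ x.2)) ∧
          IsPrincipalContactification η R p (directSum ω₁ ω₂) ρ ∧
          ∀ x : M₁ × M₂,
            mfderiv ((𝓡 (2 * n₁ + 1)).prod (𝓡 (2 * n₂ + 1))) (𝓡 (2 * (n₁ + n₂) + 1))
              (orbitProj ψ) x ((1 / 2 : ℝ) • sumField R₁ R₂ x) = R (orbitProj ψ x) := by
  obtain ⟨φ₁, hφ₁, hP₁, hf₁⟩ := h₁.principal
  obtain ⟨φ₂, hφ₂, hP₂, hf₂⟩ := h₂.principal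
  obtain ⟨τ, ρ, hcase, hcase', hτ0, hρ0, hτ, hρ', hmτ, hmρ⟩ :=
    exists_periods hP₁.period_pos hP₂.period_pos hρ
  have hψ := hP₁.antidiagonalFlow hP₂ hτ0 hτ hmτ
  have hT2 := t2Space_orbitSpace _ hψ.periodic hψ.proper
  have hinv : ∀ t : ℝ, pullback (antidiagonalFlow φ₁ φ₂ t) (directSum η₁ η₂) = directSum η₁ η₂ :=
    fun t => pullback_antidiagonalFlow ((hP₁.contMDiff t).mdifferentiable (by simp))
      ((hP₂.contMDiff (-t)).mdifferentiable (by simp))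
      (h₁.reeb.pullback_flow h₁.contact.smooth hφ₁ hP₁.smooth t)
      (h₂.reeb.pullback_flow h₂.contact.smooth hφ₂ hP₂.smooth (-t))
  have hd : ∀ n : ℕ, Module.finrank ℝ (EuclideanSpace ℝ (Fin (2 * n + 1))) =
      Module.finrank ℝ (EuclideanSpace ℝ (Fin (2 * n))) + 1 := fun n => by
    rw [finrank_euclideanSpace_fin, finrank_euclideanSpace_fin]
  have hV : Module.finrank ℝ (EuclideanSpace ℝ (Fin (2 * (n₁ + n₂) + 1))) =
      Module.finrank ℝ (EuclideanSpace ℝ (Fin (2 * n₁))) +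
        Module.finrank ℝ (EuclideanSpace ℝ (Fin (2 * n₂))) + 1 := by
    simp only [finrank_euclideanSpace_fin, mul_add]
  obtain ⟨hC, hM, hπ⟩ := exists_isSubmersion_orbitProj
    (EuclideanSpace ℝ (Fin (2 * (n₁ + n₂) + 1))) h₁.reeb.ne_zero h₂.reeb.ne_zero hφ₁ hφ₂ hP₁ hP₂
    h₁.submersion h₂.submersion (fun t x => ((hf₁ _ _).2 ⟨t, rfl⟩).symm)
    (fun t x => ((hf₂ _ _).2 ⟨t, rfl⟩).symm) hmρ (hd n₁) (hd n₂) hV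
  exact ⟨antidiagonalFlow φ₁ φ₂, isFlowOf_antidiagonalFlow hφ₁ hφ₂, τ, ρ, hcase, hcase', hψ, hinv,
    hT2, secondCountableTopology_orbitSpace _, inferInstance, hC, hM, hπ,
    exists_isPrincipalContactification h₁ h₂ hφ₁ hφ₂ hP₁ hP₂ hf₁ hf₂ hinv hπ hρ0 hρ' hmρ
      (hd n₁) (hd n₂) hV⟩
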